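/- Let $A=V/\Lambda$ be a complex abelian variety of dimension $8$. Let $\mathrm{Hod}(A)$ be its Hodge group, i.e. the smallest algebraic subgroup of $GL(H^1(A,\mathbf{Q}))$ defined over $\mathbf{Q}$ whose complex points contain $h(z)$ for all $z\in\mathbf{C}$ with $|z|=1$, where $h(z)$ acts on $H^{p,q}(A)\subset H^1(A,\mathbf{C})$ ($p+q=1$) as multiplication by $z^p\bar z^q$. Assume that $A$ is of $so(7)$-type in the following sense: the Lie algebra of $\mathrm{Hod}(A)(\mathbf{C})$ is $so(7)=so(7,\mathbf{C})$, and as a representation of it $H^1(A,\mathbf{C})\cong\Gamma\oplus\Gamma$, where $\Gamma$ is the $8$-dimensional spin representation of $so(7)$. For $p\geq 0$ let $B^p(A)=H^{2p}(A,\mathbf{Q})\cap H^{p,p}(A)$ be the $\mathbf{Q}$-vector space of Hodge classes of codimension $p$. Then $$\dim_{\mathbf{Q}} B^1(A)=1,\qquad \dim_{\mathbf{Q}} B^2(A)=6,\qquad \dim_{\mathbf{Q}}\bigl(\mathrm{End}(A)\otimes_{\mathbf{Z}}\mathbf{Q}\bigr)=4 .$$ -/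

import Mathlib

open scoped TensorProduct Topology

/-! ## The spin representation of `so(7)` -/

namespace Spin7

attribute [local instance 100] LieRing.ofAssociativeRing

/-- Index set of the basis `e₀; e₁, e₂, e₃; f₁, f₂, f₃` of `ℂ⁷`, on which the quadratic form is
`Q = x₀² + ∑ xᵢ yᵢ`; the Gram matrix of its polar form is `LieAlgebra.Orthogonal.JB (Fin 3) ℂ`. -/
abbrev Idx : Type := Unit ⊕ Fin 3 ⊕ Fin 3

/-- The complex Lie algebra `so(7)` of the quadratic form `Q`. -/
abbrev so7 : LieSubalgebra ℂ (Matrix Idx Idx ℂ) := LieAlgebra.Orthogonal.typeB (Fin 3) ℂ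

/-- The space of spinors `S = ⋀ R`, `R = ⟨e₁, e₂, e₃⟩`, with its basis `e_I`, `I ⊆ {1, 2, 3}`. -/
abbrev Spinor : Type := Finset (Fin 3) → ℂ

/-- Exterior multiplication by `eᵢ` on `⋀ R`, as an integral matrix in the basis `e_I`. -/
def wedge (i : Fin 3) : Matrix (Finset (Fin 3)) (Finset (Fin 3)) ℤ :=
  fun J I => if i ∉ I ∧ J = insert i I then (-1) ^ (I.filter (· < i)).card else 0

/-- Integral matrices of the Clifford action of the basis of `ℂ⁷` on `⋀ R`: `e₀` acts by the sign
`(-1)^|I|`, `eᵢ` by exterior multiplication, `fᵢ` by contraction. -/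
def gammaInt : Idx → Matrix (Finset (Fin 3)) (Finset (Fin 3)) ℤ
  | .inl _ => Matrix.diagonal fun I => (-1) ^ I.card
  | .inr (.inl i) => wedge i
  | .inr (.inr i) => (wedge i).transpose

/-- The Clifford action of the basis vectors of `ℂ⁷` on spinors. -/
def gamma (a : Idx) : Matrix (Finset (Fin 3)) (Finset (Fin 3)) ℂ :=
  (gammaInt a).map (Int.castRingHom ℂ)

/-- The inverse of the Gram matrix `JB` of the polar form of `Q`. -/
noncomputable def gramInv : Matrix Idx Idx ℂ :=
  Matrix.fromBlocks ((1 / 2 : ℂ) • 1) 0 0 (LieAlgebra.Orthogonal.JD (Fin 3) ℂ)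

/-- The image of a bivector `∑ T_{ab} v_a ⊗ v_b` in the endomorphisms of the spinors. -/
noncomputable def quadGamma :
    Matrix Idx Idx ℂ →ₗ[ℂ] Matrix (Finset (Fin 3)) (Finset (Fin 3)) ℂ where
  toFun T := ∑ a, ∑ b, T a b • (gamma a * gamma b)
  map_add' S T := by simp [add_smul, Finset.sum_add_distrib]
  map_smul' c T := by simp [Finset.smul_sum, smul_smul]

theorem gammaInt_rel : ∀ a b, gammaInt a * gammaInt b + gammaInt b * gammaInt a =
    LieAlgebra.Orthogonal.JB (Fin 3) ℤ a b • 1 := by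
  decide +kernel

theorem gamma_rel (a b : Idx) : gamma a * gamma b + gamma b * gamma a =
    LieAlgebra.Orthogonal.JB (Fin 3) ℂ a b • 1 := by
  have h := congrArg (fun M => M.map (Int.castRingHom ℂ)) (gammaInt_rel a b)
  have hJ : ((LieAlgebra.Orthogonal.JB (Fin 3) ℤ a b : ℤ) : ℂ) =
      LieAlgebra.Orthogonal.JB (Fin 3) ℂ a b := by
    rcases a with a | a | a <;> rcases b with b | b | b <;>
      simp [LieAlgebra.Orthogonal.JB, LieAlgebra.Orthogonal.JD, Matrix.one_apply, two_smul]
    norm_num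
  rw [← hJ]
  ext I J
  have h' := congrFun (congrFun h I) J
  simp only [Matrix.map_apply, Matrix.add_apply, map_add, Matrix.smul_apply, Matrix.mul_apply,
    map_sum, map_mul] at h'
  simp only [gamma, Matrix.add_apply, Matrix.mul_apply, Matrix.map_apply, h', Matrix.smul_apply]
  by_cases hIJ : I = J <;> simp [Matrix.one_apply, hIJ]

theorem gram_mul_gramInv : LieAlgebra.Orthogonal.JB (Fin 3) ℂ * gramInv = 1 := by
  simp [LieAlgebra.Orthogonal.JB, gramInv, LieAlgebra.Orthogonal.JD, Matrix.fromBlocks_multiply]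

theorem gramInv_mul_gram : gramInv * LieAlgebra.Orthogonal.JB (Fin 3) ℂ = 1 := by
  simp [LieAlgebra.Orthogonal.JB, gramInv, LieAlgebra.Orthogonal.JD, Matrix.fromBlocks_multiply]

theorem gramInv_transpose : gramInv.transpose = gramInv := by
  simp [gramInv, LieAlgebra.Orthogonal.JD, Matrix.fromBlocks_transpose]

theorem gram_transpose : (LieAlgebra.Orthogonal.JB (Fin 3) ℂ).transpose =
    LieAlgebra.Orthogonal.JB (Fin 3) ℂ := by
  simp [LieAlgebra.Orthogonal.JB, LieAlgebra.Orthogonal.JD, Matrix.fromBlocks_transpose]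

theorem gramInv_mul_transpose {X : Matrix Idx Idx ℂ} (hX : X ∈ so7) :
    gramInv * X.transpose = -(X * gramInv) := by
  have h : X.transpose * LieAlgebra.Orthogonal.JB (Fin 3) ℂ =
      LieAlgebra.Orthogonal.JB (Fin 3) ℂ * (-X) :=
    (mem_skewAdjointMatricesSubmodule _ _).1 hX
  calc gramInv * X.transpose
      = gramInv * (X.transpose * LieAlgebra.Orthogonal.JB (Fin 3) ℂ) * gramInv := by
        rw [Matrix.mul_assoc, Matrix.mul_assoc, gram_mul_gramInv, Matrix.mul_one]
    _ = -(X * gramInv) := by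
        rw [h, ← Matrix.mul_assoc, gramInv_mul_gram, Matrix.one_mul, Matrix.neg_mul]

theorem quadGamma_comm_gamma (T : Matrix Idx Idx ℂ) (c : Idx) :
    quadGamma T * gamma c - gamma c * quadGamma T =
      ∑ a, ((T - T.transpose) * LieAlgebra.Orthogonal.JB (Fin 3) ℂ) a c • gamma a := by
  have key : ∀ a b : Idx, gamma a * gamma b * gamma c - gamma c * (gamma a * gamma b) =
      LieAlgebra.Orthogonal.JB (Fin 3) ℂ b c • gamma a -
        LieAlgebra.Orthogonal.JB (Fin 3) ℂ a c • gamma b := by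
    intro a b
    have h1 := congrArg (fun M => gamma a * M) (gamma_rel b c)
    have h2 := congrArg (fun M => M * gamma b) (gamma_rel a c)
    simp only [mul_add, add_mul, Matrix.mul_smul, Matrix.smul_mul, Matrix.mul_one,
      Matrix.one_mul] at h1 h2
    rw [← h1, ← h2]
    noncomm_ring
  have h3 : quadGamma T * gamma c - gamma c * quadGamma T =
      ∑ a, ∑ b, T a b • (LieAlgebra.Orthogonal.JB (Fin 3) ℂ b c • gamma a -
        LieAlgebra.Orthogonal.JB (Fin 3) ℂ a c • gamma b) := by
    simp only [quadGamma, LinearMap.coe_mk, AddHom.coe_mk, Finset.sum_mul, Finset.mul_sum,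
      ← Finset.sum_sub_distrib, Matrix.smul_mul, Matrix.mul_smul, ← smul_sub, key]
  rw [h3]
  simp only [smul_sub, Finset.sum_sub_distrib, Matrix.sub_mul, Matrix.sub_apply, sub_smul,
    smul_smul]
  congr 1
  · simp only [Matrix.mul_apply, Finset.sum_smul]
  · rw [Finset.sum_comm]
    simp only [Matrix.mul_apply, Finset.sum_smul, Matrix.transpose_apply]

/-- The spin representation of `so(7)` on the `8`-dimensional space `S = ⋀ R`: the composite
`so(Q) ≅ ⋀² ℂ⁷ → Cl(Q) → End S`. -/
noncomputable def spinMatrix : so7 →ₗ⁅ℂ⁆ Matrix (Finset (Fin 3)) (Finset (Fin 3)) ℂ where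
  toFun X := (1 / 2 : ℂ) • quadGamma ((X : Matrix Idx Idx ℂ) * gramInv)
  map_add' X Y := by simp [Matrix.add_mul]
  map_smul' c X := by simp [smul_comm c]
  map_lie' := by
    intro X Y
    have hX := gramInv_mul_transpose X.2
    have hcomm : ∀ c, ⁅(1 / 2 : ℂ) • quadGamma ((X : Matrix Idx Idx ℂ) * gramInv), gamma c⁆ =
        ∑ a, (X : Matrix Idx Idx ℂ) a c • gamma a := by
      intro c
      rw [Ring.lie_def, Matrix.smul_mul, Matrix.mul_smul, ← smul_sub, quadGamma_comm_gamma,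
        Matrix.transpose_mul, gramInv_transpose, hX, sub_neg_eq_add, Matrix.add_mul,
        Matrix.mul_assoc, gramInv_mul_gram, Matrix.mul_one, Finset.smul_sum]
      refine Finset.sum_congr rfl fun a _ => ?_
      rw [Matrix.add_apply, smul_smul]
      congr 1
      ring
    generalize hA : (1 / 2 : ℂ) • quadGamma ((X : Matrix Idx Idx ℂ) * gramInv) = A at hcomm ⊢
    have hprod : ∀ a b, ⁅A, gamma a * gamma b⁆ =
        (∑ c, (X : Matrix Idx Idx ℂ) c a • gamma c) * gamma b +
          gamma a * ∑ c, (X : Matrix Idx Idx ℂ) c b • gamma c := by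
      intro a b
      rw [← hcomm, ← hcomm]
      simp only [Ring.lie_def]
      noncomm_ring
    have hquad : ∀ T : Matrix Idx Idx ℂ, ⁅A, quadGamma T⁆ =
        quadGamma ((X : Matrix Idx Idx ℂ) * T + T * (X : Matrix Idx Idx ℂ).transpose) := by
      intro T
      rw [map_add]
      have h1 : ⁅A, quadGamma T⁆ = ∑ a, ∑ b, T a b • ⁅A, gamma a * gamma b⁆ := by
        simp only [quadGamma, LinearMap.coe_mk, AddHom.coe_mk, lie_sum, lie_smul]
      rw [h1]
      simp only [hprod, smul_add, Finset.sum_add_distrib]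
      congr 1
      · simp only [quadGamma, LinearMap.coe_mk, AddHom.coe_mk, Matrix.mul_apply, Finset.sum_mul,
          Finset.smul_sum, Finset.sum_smul, Matrix.smul_mul, smul_smul]
        calc _ = ∑ a, ∑ c, ∑ b, (T a b * (X : Matrix Idx Idx ℂ) c a) • (gamma c * gamma b) :=
              Finset.sum_congr rfl fun a _ => Finset.sum_comm
          _ = ∑ c, ∑ a, ∑ b, (T a b * (X : Matrix Idx Idx ℂ) c a) • (gamma c * gamma b) :=
              Finset.sum_comm
          _ = _ := by
              refine Finset.sum_congr rfl fun c _ => ?_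
              rw [Finset.sum_comm]
              simp only [mul_comm]
      · simp only [quadGamma, LinearMap.coe_mk, AddHom.coe_mk, Matrix.mul_apply, Finset.mul_sum,
          Finset.smul_sum, Finset.sum_smul, Matrix.mul_smul, smul_smul, Matrix.transpose_apply]
        refine Finset.sum_congr rfl fun a _ => ?_
        rw [Finset.sum_comm]
    rw [lie_smul, hquad, Matrix.mul_assoc (Y : Matrix Idx Idx ℂ), hX]
    congr 2
    rw [LieSubalgebra.coe_bracket, Ring.lie_def]
    noncomm_ring

/-- The spin representation as endomorphisms of the space of spinors. -/
noncomputable def spin (X : so7) : Module.End ℂ Spinor := Matrix.toLin' (spinMatrix X)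

end Spin7

/-! ## Complex abelian varieties -/

/-- A complex abelian variety `A = V / Λ`: a lattice `Λ` in a finite-dimensional complex vector
space `V` such that the complex torus `V / Λ` admits a polarization (a Riemann form). -/
structure ComplexAbelianVariety (V : Type*) [NormedAddCommGroup V] [NormedSpace ℂ V]
    [FiniteDimensional ℂ V] where
  /-- the lattice `Λ = H₁(A, ℤ)` -/
  lattice : Submodule ℤ V
  discrete : DiscreteTopology lattice
  span_eq_top : Submodule.span ℝ (lattice : Set V) = ⊤
  polarizable : ∃ E : V →ₗ[ℝ] V →ₗ[ℝ] ℝ,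
    (∀ v, E v v = 0) ∧
    (∀ v ∈ lattice, ∀ w ∈ lattice, ∃ n : ℤ, E v w = n) ∧
    (∀ v w, E (Complex.I • v) (Complex.I • w) = E v w) ∧
    (∀ v, v ≠ 0 → 0 < E v (Complex.I • v))

namespace ComplexAbelianVariety

section Cohomology

variable (V : Type*) [NormedAddCommGroup V] [NormedSpace ℂ V]

/-- `H¹(A, ℂ) = Hom(Λ, ℂ)`, as the space of real-linear forms `V → ℂ`. -/
abbrev H1 : Type _ := V →ₗ[ℝ] ℂ

/-- `Hᵏ(A, ℂ) = ⋀ᵏ H¹(A, ℂ)`, as the space of alternating real-multilinear `k`-forms on `V`, that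
is, of translation invariant complex differential `k`-forms on the torus `A`. -/
abbrev H (k : ℕ) : Type _ := V [⋀^Fin k]→ₗ[ℝ] ℂ

/-- `H^{p,q}(A)`: the forms of type `(p, q)`, that is, those on which the homotheties `z ∈ ℂ` of
the tangent space `V` act through `z ^ p * conj z ^ q`. -/
noncomputable def hodgeType (p q : ℕ) : Submodule ℂ (H V (p + q)) where
  carrier := {ω | ∀ (z : ℂ) (v : Fin (p + q) → V),
    ω (fun i => z • v i) = z ^ p * (starRingEnd ℂ z) ^ q * ω v}
  zero_mem' := by simp
  add_mem' {a b} ha hb z v := by simp [ha z v, hb z v, mul_add]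
  smul_mem' c ω h z v := by simp [h z v, mul_left_comm]

/-- `h(z)` for `z ∈ ℂ` of absolute value `1`, acting on `H¹(A, ℂ)` by pull-back along the
homothety `z` of `V`; it is multiplication by `z ^ p * conj z ^ q` on `H^{p,q}(A)`, `p + q = 1`. -/
noncomputable def hodgeCircleHom : Circle →* Module.End ℂ (H1 V) where
  toFun z :=
    { toFun := fun ω => ω ∘ₗ (DistribSMul.toLinearMap ℝ V (z : ℂ))
      map_add' := fun _ _ => rfl
      map_smul' := fun _ _ => rfl }
  map_one' := by ext ω v; simp
  map_mul' z w := by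
    ext ω v
    simp [mul_smul, smul_comm (z : ℂ)]

/-- The homomorphism `h : S¹ → GL(H¹(A, ℂ))` that gives the Hodge structure. -/
noncomputable def hodgeCircle : Circle →* (Module.End ℂ (H1 V))ˣ :=
  (hodgeCircleHom V).toHomUnits

end Cohomology

variable {V : Type*} [NormedAddCommGroup V] [NormedSpace ℂ V] [FiniteDimensional ℂ V]
  (A : ComplexAbelianVariety V)

/-- `H¹(A, ℚ) ⊆ H¹(A, ℂ)`: the forms with rational values on `Λ = H₁(A, ℤ)`. -/
noncomputable def H1Rat : Submodule ℚ (H1 V) where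
  carrier := {ω | ∀ v ∈ A.lattice, ∃ r : ℚ, ω v = r}
  zero_mem' v _ := ⟨0, by simp⟩
  add_mem' {a b} ha hb v hv := by
    obtain ⟨r, hr⟩ := ha v hv
    obtain ⟨s, hs⟩ := hb v hv
    exact ⟨r + s, by simp [hr, hs]⟩
  smul_mem' c ω h v hv := by
    obtain ⟨r, hr⟩ := h v hv
    exact ⟨c * r, by simp [hr, Rat.smul_def]⟩

/-- `Hᵏ(A, ℚ) ⊆ Hᵏ(A, ℂ)`: the forms with rational values on `Λ = H₁(A, ℤ)`. -/
noncomputable def HRat (k : ℕ) : Submodule ℚ (H V k) where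
  carrier := {ω | ∀ v : Fin k → V, (∀ i, v i ∈ A.lattice) → ∃ r : ℚ, ω v = r}
  zero_mem' v _ := ⟨0, by simp⟩
  add_mem' {a b} ha hb v hv := by
    obtain ⟨r, hr⟩ := ha v hv
    obtain ⟨s, hs⟩ := hb v hv
    exact ⟨r + s, by simp [hr, hs]⟩
  smul_mem' c ω h v hv := by
    obtain ⟨r, hr⟩ := h v hv
    exact ⟨c * r, by simp [hr, Rat.smul_def]⟩

/-- The space of Hodge classes `Bᵖ(A) = H^{2p}(A, ℚ) ∩ H^{p,p}(A)`. -/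
noncomputable def hodgeClasses (p : ℕ) : Submodule ℚ (H V (p + p)) :=
  A.HRat (p + p) ⊓ (hodgeType V p p).restrictScalars ℚ

/-! ### The Hodge group and its Lie algebra -/

/-- The polynomial functions with rational coefficients on `End(H¹(A, ℂ)) = End(H¹(A, ℚ)) ⊗ ℂ`:
they are generated by the matrix coefficients `g ↦ ⟨g ω, v⟩` with `ω ∈ H¹(A, ℚ)` and
`v ∈ Λ = H₁(A, ℤ)`. -/
noncomputable def ratPolynomials : Subalgebra ℚ (Module.End ℂ (H1 V) → ℂ) :=
  Algebra.adjoin ℚ {F | ∃ ω ∈ A.H1Rat, ∃ v ∈ A.lattice, F = fun g => g ω v}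

/-- `G` is (the group of complex points of) an algebraic subgroup of `GL(H¹(A, ℚ))`, defined
over `ℚ`. -/
def IsAlgebraicOverRat (G : Subgroup (Module.End ℂ (H1 V))ˣ) : Prop :=
  ∃ S ⊆ (A.ratPolynomials : Set (Module.End ℂ (H1 V) → ℂ)),
    ∀ g, g ∈ G ↔ ∀ F ∈ S, F (g : Module.End ℂ (H1 V)) = 0

/-- The complex points `Hod(A)(ℂ)` of the Hodge group: the smallest algebraic subgroup of
`GL(H¹(A, ℚ))` defined over `ℚ` that contains `h(S¹)`. -/
noncomputable def hodgeGroup : Subgroup (Module.End ℂ (H1 V))ˣ :=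
  sInf {G | A.IsAlgebraicOverRat G ∧ ∀ z, hodgeCircle V z ∈ G}

/-- The Lie algebra of `Hod(A)(ℂ)`, as a subset of `End(H¹(A, ℂ))`: the tangent space at the
identity, cut out by the differentials of the rational polynomials that vanish on `Hod(A)`. -/
noncomputable def hodgeLie : Set (Module.End ℂ (H1 V)) :=
  {X | ∀ F ∈ A.ratPolynomials, (∀ g ∈ A.hodgeGroup, F (g : Module.End ℂ (H1 V)) = 0) →
    lineDeriv ℂ F 1 X = 0}

/-- `A` is an abelian `8`-fold of `so(7)`-type: the Lie algebra of `Hod(A)(ℂ)` is `so(7)`, and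
`H¹(A, ℂ)` is the sum of two copies of the spin representation of `so(7)`. -/
def IsSo7Type : Prop :=
  Module.finrank ℂ V = 8 ∧
    ∃ e : H1 V ≃ₗ[ℂ] Spin7.Spinor × Spin7.Spinor,
      A.hodgeLie = {X | ∃ x : Spin7.so7, ∀ ω,
        e (X ω) = (Spin7.spin x (e ω).1, Spin7.spin x (e ω).2)}

/-! ### Endomorphisms -/

/-- A map `A → A` is holomorphic if locally it lifts to holomorphic maps on `V`. -/
def IsHolomorphic (φ : V ⧸ A.lattice → V ⧸ A.lattice) : Prop :=
  ∀ v : V, ∃ f : V → V, ∀ᶠ w in 𝓝 v, DifferentiableAt ℂ f w ∧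
    A.lattice.mkQ (f w) = φ (A.lattice.mkQ w)

/-- The ring `End(A)` of holomorphic group endomorphisms of `A = V / Λ`. -/
noncomputable def endRing : Subring (AddMonoid.End (V ⧸ A.lattice)) where
  carrier := {φ | A.IsHolomorphic φ}
  zero_mem' v := ⟨fun _ => 0, .of_forall fun w => ⟨differentiableAt_const _, by simp⟩⟩
  one_mem' v := ⟨id, .of_forall fun w => ⟨differentiableAt_id, rfl⟩⟩
  add_mem' {φ ψ} hφ hψ v := by
    obtain ⟨f, hf⟩ := hφ v
    obtain ⟨g, hg⟩ := hψ v
    refine ⟨fun w => f w + g w, ?_⟩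
    filter_upwards [hf, hg] with w hfw hgw
    exact ⟨hfw.1.add hgw.1, by rw [map_add, hfw.2, hgw.2]; rfl⟩
  neg_mem' {φ} hφ v := by
    obtain ⟨f, hf⟩ := hφ v
    refine ⟨fun w => -f w, ?_⟩
    filter_upwards [hf] with w hfw
    exact ⟨hfw.1.neg, by rw [map_neg, hfw.2]; rfl⟩
  mul_mem' {φ ψ} hφ hψ v := by
    obtain ⟨g, hg⟩ := hψ v
    obtain ⟨f, hf⟩ := hφ (g v)
    refine ⟨fun w => f (g w), ?_⟩
    filter_upwards [hg, hg.self_of_nhds.1.continuousAt.eventually hf] with w hgw hfw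
    exact ⟨hfw.1.comp w hgw.1, by rw [hfw.2, hgw.2]; rfl⟩

end ComplexAbelianVariety

/-! A form in H^{2p} has type (p, p) exactly when the circle h(S¹) fixes it. The stabilizer of a
rational form is algebraic over ℚ, so a rational (p, p)-form is fixed by all of Hod(A), and
differentiating shows that the Lie algebra kills it. Conversely the derivative of h lies in the Lie
algebra, so a form killed by the Lie algebra is constant along the circle; connectedness of Hod(A)
plays no role. This is `restrictForm_mem_hodgeClasses_iff`. The Lie algebra is cut out by linear
equations over ℚ, hence so are its invariants, and dim_ℚ Bᵖ(A) is the complex dimension of the space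
of invariant forms (`finrank_hodgeClasses`, by `finrank_rational_eq`). Likewise End(A) ⊗ ℚ is the
rational part of the commutant of the Lie algebra (`finrank_endRing`).

What remains is invariant theory of so(7) on S ⊗ ℂ². Here S ⊗ S = ⋀⁰ ⊕ ⋀¹ ⊕ ⋀² ⊕ ⋀³ of ℂ⁷, of
dimensions 1 + 7 + 21 + 35, is multiplicity free. So S ⊗ S has one invariant, the symmetric `form`,
and S^{⊗4} has four: the three products of `form` with itself, and the alternating Cayley form. In
degree two, `form` must be paired with the alternating form on ℂ², which gives dimension 1
(`finrank_so7Forms_two`). In degree four, the Cayley form is paired with symmetric tensors in Sym⁴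
ℂ² (dimension 5), and the products contribute only the square of the degree two invariant (dimension
1), in total 6 (`finrank_so7Forms_four`). By Schur's lemma the commutant is M₂(ℂ), of dimension 4
(`finrank_commutant`).

The representation theory becomes a finite computation with Pauli matrices: so(7) is spanned by 21
of the 64, and each of these sends every Pauli matrix to a multiple of another. Irreducibility and
multiplicity statements thus turn into sign tables on 𝔽₂⁶. -/

namespace Spin7

/-! ### Pauli matrices on the spinors and their labels in 𝔽₂⁶. -/

/-- The index set of the basis of the space of spinors. -/
abbrev Wt : Type := Finset (Fin 3)

/-- Labels of the `64` Pauli matrices. -/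
abbrev Label : Type := Wt × Wt

/-- The sum of two labels, viewed as elements of `𝔽₂⁶`. -/
def Label.add (u v : Label) : Label := (symmDiff u.1 v.1, symmDiff u.2 v.2)

/-- The cocycle of the multiplication of Pauli matrices. -/
def pauliSign (u v : Label) : ℤ := (-1) ^ (v.1 ∩ u.2).card

/-- The integral Pauli matrix `e_I ↦ (-1)^|I ∩ b| e_{I + a}` with label `(a, b)`. -/
def pauliInt (u : Label) : Matrix Wt Wt ℤ :=
  fun J I => if J = symmDiff I u.1 then (-1) ^ (I ∩ u.2).card else 0

/-- The Pauli matrix with label `u`. -/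
def pauli (u : Label) : Matrix Wt Wt ℂ := (pauliInt u).map (Int.castRingHom ℂ)

theorem sign_symmDiff_left : ∀ a b c : Wt,
    (-1 : ℤ) ^ (symmDiff a b ∩ c).card = (-1) ^ (a ∩ c).card * (-1) ^ (b ∩ c).card := by
  decide +kernel

theorem sign_symmDiff_right : ∀ a b c : Wt,
    (-1 : ℤ) ^ (c ∩ symmDiff a b).card = (-1) ^ (c ∩ a).card * (-1) ^ (c ∩ b).card := by
  decide +kernel

/-- A Pauli matrix is a character of 𝔽₂³ followed by a translation. Moving the character of `u` past
the translation of `v` costs the cocycle sign; everything else adds up in 𝔽₂⁶. -/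
theorem pauliInt_mul (u v : Label) :
    pauliInt u * pauliInt v = pauliSign u v • pauliInt (u.add v) := by
  ext J I
  rw [Matrix.mul_apply, Finset.sum_eq_single (symmDiff I v.1)]
  · have h : symmDiff (symmDiff I v.1) u.1 = symmDiff I (symmDiff u.1 v.1) := by
      rw [symmDiff_assoc, symmDiff_comm v.1]
    simp only [pauliInt, Label.add, h, Matrix.smul_apply, pauliSign, if_true,
      sign_symmDiff_left, sign_symmDiff_right, smul_eq_mul]
    split_ifs <;> ring
  · intro K _ hK
    simp [pauliInt, hK]
  · simp

theorem pauliInt_transpose (u : Label) :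
    (pauliInt u).transpose = pauliSign u u • pauliInt u := by
  ext J I
  simp only [Matrix.transpose_apply, Matrix.smul_apply, pauliInt, pauliSign, smul_eq_mul]
  by_cases h : J = symmDiff I u.1
  · have h' : I = symmDiff J u.1 := by rw [h, symmDiff_symmDiff_cancel_right]
    rw [if_pos h, if_pos h', h, sign_symmDiff_left]; ring
  · have h' : I ≠ symmDiff J u.1 := by
      rintro rfl; apply h; rw [symmDiff_symmDiff_cancel_right]
    rw [if_neg h, if_neg h', mul_zero]

theorem pauli_mul (u v : Label) :
    pauli u * pauli v = (pauliSign u v : ℂ) • pauli (u.add v) := by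
  have := congrArg (fun M => M.map (Int.castRingHom ℂ)) (pauliInt_mul u v)
  simp only [Matrix.map_mul] at this
  rw [pauli, pauli, this, pauli]
  ext
  simp only [Matrix.map_apply, Matrix.smul_apply, smul_eq_mul, map_mul, eq_intCast]

theorem pauli_transpose (u : Label) :
    (pauli u).transpose = (pauliSign u u : ℂ) • pauli u := by
  have := congrArg (fun M => M.map (Int.castRingHom ℂ)) (pauliInt_transpose u)
  rw [pauli, ← Matrix.transpose_map, this]
  ext
  simp only [Matrix.map_apply, Matrix.smul_apply, smul_eq_mul, map_mul, eq_intCast]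

/-- Elementary matrices are combinations of Pauli matrices. -/
theorem single_eq_sum_pauli (J I : Wt) :
    (Matrix.single J I 1 : Matrix Wt Wt ℂ) =
      ∑ c : Wt, ((8⁻¹ : ℂ) * (((-1) ^ (I ∩ c).card : ℤ) : ℂ)) • pauli (symmDiff I J, c) := by
  -- Orthogonality of the eight characters of 𝔽₂³.
  have hs : ∀ I K : Wt, ∑ c : Wt, ((-1 : ℤ) ^ (I ∩ c).card * (-1) ^ (K ∩ c).card) =
      if I = K then 8 else 0 := by decide +kernel
  ext J' K
  simp only [Matrix.sum_apply, Matrix.smul_apply, pauli, Matrix.map_apply, pauliInt, smul_eq_mul]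
  have h := congrArg (fun z : ℤ => (8⁻¹ : ℂ) * z) (hs I K)
  simp only [Int.cast_sum, Int.cast_mul, Finset.mul_sum] at h
  by_cases hK : I = K
  · subst hK
    rw [if_pos rfl] at h
    have hJ : symmDiff I (symmDiff I J) = J := by rw [← symmDiff_assoc]; simp
    by_cases hJJ : J' = J
    · subst hJJ
      simp only [hJ, if_true, Matrix.single_apply_same]
      rw [eq_comm]
      refine Eq.trans ?_ (h.trans (by norm_num))
      exact Finset.sum_congr rfl fun c _ => by simp; ring
    · simp [hJ, hJJ, Ne.symm hJJ]
  · rw [if_neg hK] at h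
    rw [Matrix.single_apply, if_neg (by tauto)]
    by_cases hJJ : J' = symmDiff K (symmDiff I J)
    · simp only [hJJ, if_true]
      rw [eq_comm]
      refine Eq.trans ?_ (h.trans (by norm_num))
      exact Finset.sum_congr rfl fun c _ => by simp; ring
    · simp [hJJ]

/-- Labels of the Pauli matrices that generate the Clifford algebra of `ℂ⁷`. -/
def gen : Fin 7 → Label :=
  ![({0}, ∅), ({1}, {0}), ({2}, {0, 1}), ({0}, {0}), ({1}, {0, 1}), ({2}, {0, 1, 2}),
    (∅, {0, 1, 2})]

/-- Labels of the Pauli matrices that span the image of `so(7)`. -/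
def roots : Finset Label :=
  (Finset.univ.filter fun p : Fin 7 × Fin 7 => p.1 < p.2).image fun p => (gen p.1).add (gen p.2)

/-- The structure constants of the action of `so(7)` on the tensor square of the spinors. -/
def kap (r u : Label) : ℤ := pauliSign r u + pauliSign r r * pauliSign u r

theorem pauli_act (r u : Label) :
    pauli r * pauli u + pauli u * (pauli r).transpose = (kap r u : ℂ) • pauli (r.add u) := by
  have h : u.add r = r.add u := by simp [Label.add, symmDiff_comm]
  rw [pauli_transpose, Matrix.mul_smul, pauli_mul, pauli_mul, h, smul_smul, ← add_smul, kap]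
  push_cast; rfl

theorem pauli_act_transpose (r u : Label) :
    (pauli r).transpose * pauli u + pauli u * pauli r =
      ((pauliSign r r * kap r u : ℤ) : ℂ) • pauli (r.add u) := by
  have h : u.add r = r.add u := by simp [Label.add, symmDiff_comm]
  have h2 : pauliSign r r * pauliSign r r = 1 := by
    rw [pauliSign, ← mul_pow]; norm_num
  rw [pauli_transpose, Matrix.smul_mul, pauli_mul, pauli_mul, h, smul_smul, ← add_smul, kap,
    mul_add, ← mul_assoc, h2, one_mul]
  push_cast; rfl

/-- The label of the invariant symmetric bilinear form on spinors. -/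
def formLabel : Label := (Finset.univ, {0, 2})

theorem kap_formLabel : ∀ r ∈ roots, kap r formLabel = 0 := by decide +kernel

/-- Every Pauli matrix except the invariant form lies in the image of the action, so an invariant is
orthogonal to all of them. -/
theorem exists_kap_ne_zero : ∀ u : Label, u ≠ formLabel → ∃ r ∈ roots, kap r (r.add u) ≠ 0 := by
  decide +kernel

/-- A root that moves some label to `u` and kills `v`, or the reverse, leaves a single term in the
invariance relation. This forces the off-diagonal Pauli components of an invariant of order four to
vanish. -/
theorem exists_kap_separating : ∀ u v : Label, u ≠ v → ∃ r ∈ roots,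
    (kap r (r.add u) ≠ 0 ∧ kap r v = 0) ∨ (kap r (r.add v) ≠ 0 ∧ kap r u = 0) := by
  decide +kernel

theorem Label.add_add_cancel (r u : Label) : r.add (r.add u) = u := by
  simp [Label.add]

/-- Representatives of the orbits of labels. -/
def orbitRep : Fin 4 → Label :=
  ![formLabel, (∅, ∅), ({0}, {0}), ({0, 1}, {1})]

/-- Shifted by `formLabel`, the labels are the sums of at most three of the seven generators, and a
root with nonzero `kap` exchanges one generator for another. The orbits are the weight bases of ⋀⁰,
..., ⋀³ of ℂ⁷, and three exchanges connect any two subsets of size at most three. -/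
theorem kap_orbit : ∀ u : Label, (∃ k, u = orbitRep k) ∨ ∃ r ∈ roots, kap r u ≠ 0 ∧
    ((∃ k, r.add u = orbitRep k) ∨ ∃ s ∈ roots, kap s (r.add u) ≠ 0 ∧
    ((∃ k, s.add (r.add u) = orbitRep k) ∨ ∃ q ∈ roots, kap q (s.add (r.add u)) ≠ 0 ∧
    (∃ k, q.add (s.add (r.add u)) = orbitRep k))) := by
  decide +kernel

/-- Moves between labels are reversible, so the vanishing of a diagonal component travels back along
a path. -/
theorem kap_add_ne_zero : ∀ r ∈ roots, ∀ u, kap r u ≠ 0 → kap r (r.add u) ≠ 0 := by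
  decide +kernel

end Spin7

namespace Spin7

/-! ### The image of `so(7)` -/

/-- The preimage is the bivector v_a ∧ v_b with one index lowered by the Gram matrix; `gramInv`
raises it again in `spinMatrix`. -/
theorem half_commutator_mem_range (a b : Idx) :
    ∃ x : so7, spinMatrix x = (1 / 2 : ℂ) • (gamma a * gamma b - gamma b * gamma a) := by
  set T : Matrix Idx Idx ℂ := Matrix.single a b 1 - Matrix.single b a 1 with hT
  have hTt : T.transpose = -T := by simp [hT]
  have hmem : T * LieAlgebra.Orthogonal.JB (Fin 3) ℂ ∈ so7 := by
    refine (mem_skewAdjointMatricesSubmodule _ _).2 ?_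
    show (T * LieAlgebra.Orthogonal.JB (Fin 3) ℂ).transpose * LieAlgebra.Orthogonal.JB (Fin 3) ℂ =
      LieAlgebra.Orthogonal.JB (Fin 3) ℂ * -(T * LieAlgebra.Orthogonal.JB (Fin 3) ℂ)
    rw [Matrix.transpose_mul, gram_transpose, hTt]
    noncomm_ring
  refine ⟨⟨_, hmem⟩, ?_⟩
  show (1 / 2 : ℂ) • quadGamma (T * LieAlgebra.Orthogonal.JB (Fin 3) ℂ * gramInv) = _
  rw [Matrix.mul_assoc, gram_mul_gramInv, Matrix.mul_one]
  congr 1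
  have hs : ∀ c d : Idx, quadGamma (Matrix.single c d 1) = gamma c * gamma d := by
    intro c d
    simp only [quadGamma, LinearMap.coe_mk, AddHom.coe_mk]
    rw [Finset.sum_eq_single c, Finset.sum_eq_single d]
    · simp
    · intro e _ he; simp [Ne.symm he]
    · simp
    · intro e _ he; simp [Ne.symm he]
    · simp
  rw [hT, map_sub, hs, hs]

/-- Raising an index turns an element of so(7) into a skew tensor, which sees only the antisymmetric
part of γ_a γ_b. -/
theorem spinMatrix_mem_span (x : so7) : spinMatrix x ∈ Submodule.span ℂ
    (Set.range fun p : Idx × Idx => gamma p.1 * gamma p.2 - gamma p.2 * gamma p.1) := by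
  set T := (x : Matrix Idx Idx ℂ) * gramInv with hT
  have hskew : T.transpose = -T := by
    rw [hT, Matrix.transpose_mul, gramInv_transpose, gramInv_mul_transpose x.2]
  have h1 : spinMatrix x = (1 / 2 : ℂ) • quadGamma T := rfl
  have h2 : quadGamma T = (1 / 2 : ℂ) • ∑ a, ∑ b, T a b • (gamma a * gamma b - gamma b * gamma a) := by
    have h3 : quadGamma T.transpose = ∑ a, ∑ b, T a b • (gamma b * gamma a) := by
      simp only [quadGamma, LinearMap.coe_mk, AddHom.coe_mk, Matrix.transpose_apply]
      exact Finset.sum_comm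
    have h4 : quadGamma T = ∑ a, ∑ b, T a b • (gamma a * gamma b) := rfl
    rw [hskew, map_neg] at h3
    simp only [smul_sub, Finset.sum_sub_distrib]
    rw [← h3, ← h4, smul_neg, sub_neg_eq_add, ← two_smul ℂ, smul_smul]
    norm_num
  rw [h1, h2]
  refine Submodule.smul_mem _ _ (Submodule.smul_mem _ _ ?_)
  exact Submodule.sum_mem _ fun a _ => Submodule.sum_mem _ fun b _ =>
    Submodule.smul_mem _ _ (Submodule.subset_span ⟨(a, b), rfl⟩)

/-- The coefficients of the Pauli generators in the vectors `γ_a`. -/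
def genCoeff : Fin 7 → Idx → ℤ
  | 0, .inr (.inl 0) => 1
  | 0, .inr (.inr 0) => 1
  | 1, .inr (.inl 1) => 1
  | 1, .inr (.inr 1) => 1
  | 2, .inr (.inl 2) => 1
  | 2, .inr (.inr 2) => 1
  | 3, .inr (.inl 0) => 1
  | 3, .inr (.inr 0) => -1
  | 4, .inr (.inl 1) => 1
  | 4, .inr (.inr 1) => -1
  | 5, .inr (.inl 2) => 1
  | 5, .inr (.inr 2) => -1
  | 6, .inl _ => 1
  | _, _ => 0

theorem pauliInt_gen : ∀ i, pauliInt (gen i) = ∑ a, genCoeff i a • gammaInt a := by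
  decide +kernel

/-- Inverts the change of basis eᵢ ± fᵢ. The factor 2 keeps the matrices integral, and `e₀` needs an
extra 2 because it occurs in one generator only. -/
theorem two_smul_gammaInt : ∀ a, (2 : ℤ) • gammaInt a =
    ∑ i, ((if a = .inl () then 2 else 1) * genCoeff i a) • pauliInt (gen i) := by
  decide +kernel

theorem map_sum_smul {ι : Type*} [Fintype ι] (c : ι → ℤ) (M : ι → Matrix Wt Wt ℤ) :
    (∑ i, c i • M i).map (Int.castRingHom ℂ) =
      ∑ i, (c i : ℂ) • (M i).map (Int.castRingHom ℂ) := by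
  ext I J
  simp only [Matrix.map_apply, Matrix.sum_apply, Matrix.smul_apply, smul_eq_mul, map_sum, map_mul,
    eq_intCast]

theorem pauli_gen (i : Fin 7) : pauli (gen i) = ∑ a, (genCoeff i a : ℂ) • gamma a := by
  rw [pauli, pauliInt_gen, map_sum_smul]; rfl

theorem gamma_mem_span (a : Idx) :
    gamma a ∈ Submodule.span ℂ (Set.range fun i => pauli (gen i)) := by
  have h := congrArg (fun M => M.map (Int.castRingHom ℂ)) (two_smul_gammaInt a)
  simp only [map_sum_smul] at h
  have h2 : gamma a = (1 / 2 : ℂ) • ((2 : ℤ) • gammaInt a).map (Int.castRingHom ℂ) := by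
    ext I J
    simp only [gamma, Matrix.map_apply, Matrix.smul_apply, smul_eq_mul, map_mul, eq_intCast]
    push_cast; ring
  rw [h2, h]
  exact Submodule.smul_mem _ _ (Submodule.sum_mem _ fun i _ =>
    Submodule.smul_mem _ _ (Submodule.subset_span ⟨i, rfl⟩))

theorem pauliSign_gen : ∀ i j, i ≠ j →
    pauliSign (gen i) (gen j) = -pauliSign (gen j) (gen i) := by decide +kernel

theorem pauliSign_ne_zero (u v : Label) : (pauliSign u v : ℂ) ≠ 0 := by
  simp [pauliSign]

theorem Label.add_comm (u v : Label) : u.add v = v.add u := by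
  simp [Label.add, symmDiff_comm]

theorem commutator_pauli_gen (i j : Fin 7) (hij : i ≠ j) :
    pauli (gen i) * pauli (gen j) - pauli (gen j) * pauli (gen i) =
      (2 * pauliSign (gen i) (gen j) : ℂ) • pauli ((gen i).add (gen j)) := by
  rw [pauli_mul, pauli_mul, Label.add_comm (gen j), pauliSign_gen j i hij.symm, ← sub_smul]
  push_cast
  congr 1; ring

theorem mem_roots {r : Label} : r ∈ roots ↔ ∃ i j, i < j ∧ (gen i).add (gen j) = r := by
  simp [roots]

/-- Commutators are bilinear. This passes between the isotropic vectors `gamma` and the orthogonal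
vectors `pauli (gen i)`, which span the same copy of ℂ⁷. -/
theorem commutator_mem_of_mem_span {S : Set (Matrix Wt Wt ℂ)} {W : Submodule ℂ (Matrix Wt Wt ℂ)}
    (hS : ∀ v ∈ S, ∀ w ∈ S, v * w - w * v ∈ W) {v w : Matrix Wt Wt ℂ}
    (hv : v ∈ Submodule.span ℂ S) (hw : w ∈ Submodule.span ℂ S) : v * w - w * v ∈ W := by
  induction hv, hw using Submodule.span_induction₂ with
  | mem_mem v w hv hw => exact hS v hv w hw
  | zero_left => simp
  | zero_right => simp
  | add_left v v' w _ _ _ h h' => convert add_mem h h' using 1; noncomm_ring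
  | add_right v w w' _ _ _ h h' => convert add_mem h h' using 1; noncomm_ring
  | smul_left c v w _ _ h => convert Submodule.smul_mem _ c h using 1; simp [smul_sub]
  | smul_right c v w _ _ h => convert Submodule.smul_mem _ c h using 1; simp [smul_sub]

theorem exists_spinMatrix_eq_pauli {r : Label} (hr : r ∈ roots) :
    ∃ x : so7, spinMatrix x = pauli r := by
  obtain ⟨i, j, hij, rfl⟩ := mem_roots.1 hr
  have hgen : ∀ i, pauli (gen i) ∈ Submodule.span ℂ (Set.range gamma) := fun i => by
    rw [pauli_gen]
    exact Submodule.sum_mem _ fun a _ => Submodule.smul_mem _ _ (Submodule.subset_span ⟨a, rfl⟩)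
  have h := commutator_mem_of_mem_span
    (W := LinearMap.range (spinMatrix : so7 →ₗ[ℂ] Matrix Wt Wt ℂ)) (by
      rintro _ ⟨a, rfl⟩ _ ⟨b, rfl⟩
      obtain ⟨x, hx⟩ := half_commutator_mem_range a b
      refine ⟨(2 : ℂ) • x, ?_⟩
      rw [map_smul]
      show (2 : ℂ) • spinMatrix x = _
      rw [hx, smul_smul]; norm_num) (hgen i) (hgen j)
  rw [commutator_pauli_gen i j hij.ne] at h
  obtain ⟨x, hx⟩ := (Submodule.smul_mem_iff _
    (mul_ne_zero two_ne_zero (pauliSign_ne_zero (gen i) (gen j)))).1 h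
  exact ⟨x, hx⟩

/-- Together with `exists_spinMatrix_eq_pauli`, this allows invariance under so(7) to be tested on
the Pauli matrices in `roots`. -/
theorem spinMatrix_mem_span_pauli (x : so7) :
    spinMatrix x ∈ Submodule.span ℂ (pauli '' roots) := by
  refine (Submodule.span_le.2 ?_) (spinMatrix_mem_span x)
  rintro _ ⟨⟨a, b⟩, rfl⟩
  refine commutator_mem_of_mem_span ?_ (gamma_mem_span a) (gamma_mem_span b)
  rintro _ ⟨i, rfl⟩ _ ⟨j, rfl⟩
  rcases lt_trichotomy i j with h | rfl | h
  · dsimp only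
    rw [commutator_pauli_gen i j h.ne]
    exact Submodule.smul_mem _ _ (Submodule.subset_span ⟨_, mem_roots.2 ⟨i, j, h, rfl⟩, rfl⟩)
  · simp
  · dsimp only
    rw [commutator_pauli_gen i j h.ne', Label.add_comm]
    exact Submodule.smul_mem _ _ (Submodule.subset_span ⟨_, mem_roots.2 ⟨j, i, h, rfl⟩, rfl⟩)

end Spin7

namespace Spin7

/-! ### Invariant tensors on the spinors -/

theorem eq_zero_of_trace_pauli {t : Matrix Wt Wt ℂ}
    (h : ∀ u, ((pauli u).transpose * t).trace = 0) : t = 0 := by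
  ext J I
  have h1 : ((Matrix.single J I (1 : ℂ)).transpose * t).trace = 0 := by
    rw [single_eq_sum_pauli, Matrix.transpose_sum, Finset.sum_mul, Matrix.trace_sum]
    refine Finset.sum_eq_zero fun c _ => ?_
    rw [Matrix.transpose_smul, Matrix.smul_mul, Matrix.trace_smul, h, smul_zero]
  simpa [Matrix.trace_single_mul] using h1

/-- For the trace pairing, the action of `x` on bilinear tensors is adjoint to the action of its
transpose. -/
theorem trace_act (x P t : Matrix Wt Wt ℂ) :
    ((x.transpose * P + P * x).transpose * t).trace =
      (P.transpose * (x * t + t * x.transpose)).trace := by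
  rw [Matrix.transpose_add, Matrix.transpose_mul, Matrix.transpose_mul, Matrix.transpose_transpose,
    Matrix.add_mul, Matrix.trace_add, Matrix.mul_add, Matrix.trace_add, Matrix.mul_assoc,
    Matrix.mul_assoc x.transpose, Matrix.trace_mul_comm x.transpose, Matrix.mul_assoc]

/-- The invariant symmetric bilinear form on the spinors. -/
def form : Matrix Wt Wt ℂ := pauli formLabel

theorem pauli_mul_form {r : Label} (hr : r ∈ roots) :
    pauli r * form + form * (pauli r).transpose = 0 := by
  rw [form, pauli_act, kap_formLabel r hr]; simp

theorem trace_pauli_of_invariant {t : Matrix Wt Wt ℂ}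
    (ht : ∀ r ∈ roots, pauli r * t + t * (pauli r).transpose = 0) {u : Label}
    (hu : u ≠ formLabel) : ((pauli u).transpose * t).trace = 0 := by
  obtain ⟨r, hr, hk⟩ := exists_kap_ne_zero u hu
  have h := trace_act (pauli r) (pauli (r.add u)) t
  rw [ht r hr, Matrix.mul_zero, Matrix.trace_zero, pauli_act_transpose, Label.add_add_cancel,
    Matrix.transpose_smul, Matrix.smul_mul, Matrix.trace_smul, smul_eq_mul, mul_eq_zero] at h
  refine h.resolve_left ?_
  push_cast
  exact mul_ne_zero (pauliSign_ne_zero r r) (Int.cast_ne_zero.2 hk)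

theorem formInt_transpose_mul : (pauliInt formLabel).transpose * pauliInt formLabel = 1 := by
  decide +kernel

theorem form_transpose_mul : form.transpose * form = 1 := by
  have := congrArg (fun M => M.map (Int.castRingHom ℂ)) formInt_transpose_mul
  rw [form, pauli, ← Matrix.transpose_map, ← Matrix.map_mul, this]
  simp

/-- Invariant bilinear forms on the spinors are multiples of `form`. -/
theorem eq_smul_form_of_invariant {t : Matrix Wt Wt ℂ}
    (ht : ∀ r ∈ roots, pauli r * t + t * (pauli r).transpose = 0) : ∃ c : ℂ, t = c • form := by
  -- The orthogonal projection to `form`, a signed permutation matrix of size 8, hence of squared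
  -- norm 8.
  refine ⟨(form.transpose * t).trace / 8, ?_⟩
  rw [← sub_eq_zero]
  refine eq_zero_of_trace_pauli fun u => ?_
  rw [Matrix.mul_sub, Matrix.trace_sub, Matrix.mul_smul, Matrix.trace_smul]
  by_cases hu : u = formLabel
  · subst hu
    have h8 : (form.transpose * form).trace = 8 := by
      rw [form_transpose_mul, Matrix.trace_one]; norm_num
    rw [← form, h8, smul_eq_mul]; ring
  · rw [trace_pauli_of_invariant ht hu, trace_pauli_of_invariant (fun r hr => pauli_mul_form hr) hu]
    simp

/-- Tensors of order four on the spinors. -/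
abbrev Tensor4 : Type := Wt → Wt → Wt → Wt → ℂ

/-- The action of a matrix on tensors of order four, as a derivation. -/
def derivTensor (x : Matrix Wt Wt ℂ) : Tensor4 →ₗ[ℂ] Tensor4 where
  toFun t i j k l := (∑ a, x i a * t a j k l) + (∑ a, x j a * t i a k l) +
    (∑ a, x k a * t i j a l) + ∑ a, x l a * t i j k a
  map_add' s t := by
    ext i j k l
    simp only [Pi.add_apply, mul_add, Finset.sum_add_distrib]; ring
  map_smul' c t := by
    ext i j k l
    simp only [Pi.smul_apply, smul_eq_mul, mul_left_comm _ c, ← Finset.mul_sum, RingHom.id_apply]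
    ring

/-- The invariant tensors of order four. -/
def invTensor : Submodule ℂ Tensor4 := ⨅ r ∈ roots, LinearMap.ker (derivTensor (pauli r))

theorem mem_invTensor {t : Tensor4} :
    t ∈ invTensor ↔ ∀ r ∈ roots, derivTensor (pauli r) t = 0 := by
  simp [invTensor, Submodule.mem_iInf]

/-- Contraction of a tensor with a matrix in the first two slots. -/
def contract (P : Matrix Wt Wt ℂ) : Tensor4 →ₗ[ℂ] Matrix Wt Wt ℂ where
  toFun t := Matrix.of fun k l => ∑ i, ∑ j, P i j * t i j k l
  map_add' s t := by
    ext k l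
    simp [mul_add, Finset.sum_add_distrib]
  map_smul' c t := by
    ext k l
    simp [mul_left_comm _ c, ← Finset.mul_sum]

theorem contract_add (P P' : Matrix Wt Wt ℂ) (t : Tensor4) :
    contract (P + P') t = contract P t + contract P' t := by
  ext k l
  simp [contract, add_mul, Finset.sum_add_distrib]

theorem contract_smul (c : ℂ) (P : Matrix Wt Wt ℂ) (t : Tensor4) :
    contract (c • P) t = c • contract P t := by
  ext k l
  simp [contract, mul_assoc, ← Finset.mul_sum]

/-- Leibniz rule: the first two slots of the derivation are moved onto `P`, and the last two act on
the contracted matrix. -/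
theorem contract_act (x P : Matrix Wt Wt ℂ) (t : Tensor4) :
    contract P (derivTensor x t) = contract (x.transpose * P + P * x) t +
      (x * contract P t + contract P t * x.transpose) := by
  ext k l
  have h1 : ∑ a, ∑ j, (∑ i, x i a * P i j) * t a j k l =
      ∑ i, ∑ j, P i j * ∑ a, x i a * t a j k l := by
    simp only [Finset.mul_sum, Finset.sum_mul]
    rw [Finset.sum_congr rfl fun a _ => Finset.sum_comm, Finset.sum_comm]
    refine Finset.sum_congr rfl fun i _ => ?_
    rw [Finset.sum_comm]
    refine Finset.sum_congr rfl fun j _ => Finset.sum_congr rfl fun a _ => ?_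
    ring
  have h2 : ∑ i, ∑ a, (∑ j, P i j * x j a) * t i a k l =
      ∑ i, ∑ j, P i j * ∑ a, x j a * t i a k l := by
    refine Finset.sum_congr rfl fun i _ => ?_
    simp only [Finset.mul_sum, Finset.sum_mul]
    rw [Finset.sum_comm]
    simp only [mul_assoc]
  have h3 : ∑ a, x k a * ∑ i, ∑ j, P i j * t i j a l =
      ∑ i, ∑ j, P i j * ∑ a, x k a * t i j a l := by
    simp only [Finset.mul_sum]
    rw [Finset.sum_comm]
    refine Finset.sum_congr rfl fun i _ => ?_
    rw [Finset.sum_comm]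
    simp only [mul_left_comm]
  have h4 : ∑ a, (∑ i, ∑ j, P i j * t i j k a) * x l a =
      ∑ i, ∑ j, P i j * ∑ a, x l a * t i j k a := by
    simp only [Finset.mul_sum, Finset.sum_mul]
    rw [Finset.sum_comm]
    refine Finset.sum_congr rfl fun i _ => ?_
    rw [Finset.sum_comm]
    refine Finset.sum_congr rfl fun j _ => Finset.sum_congr rfl fun a _ => ?_
    ring
  simp only [contract, derivTensor, LinearMap.coe_mk, AddHom.coe_mk, Matrix.of_apply,
    Matrix.add_apply, Matrix.mul_apply, Matrix.transpose_apply, mul_add, add_mul,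
    Finset.sum_add_distrib, h1, h2, h3, h4]
  ring

/-- The components of a tensor in the basis of Pauli matrices. -/
noncomputable def pauliCoeff (u v : Label) : Tensor4 →ₗ[ℂ] ℂ :=
  Matrix.traceLinearMap Wt ℂ ℂ ∘ₗ LinearMap.mulLeft ℂ (pauli v).transpose ∘ₗ contract (pauli u)

theorem pauliCoeff_apply (u v : Label) (t : Tensor4) :
    pauliCoeff u v t = ((pauli v).transpose * contract (pauli u) t).trace := rfl

theorem eq_zero_of_pauliCoeff {t : Tensor4} (h : ∀ u v, pauliCoeff u v t = 0) : t = 0 := by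
  have h1 : ∀ u, contract (pauli u) t = 0 := fun u => eq_zero_of_trace_pauli fun v => h u v
  have h2 : ∀ (s : Finset Wt) (f : Wt → Matrix Wt Wt ℂ), (∀ c, contract (f c) t = 0) →
      contract (∑ c ∈ s, f c) t = 0 := by
    intro s f hf
    induction s using Finset.induction_on with
    | empty => ext; simp [contract]
    | insert a s ha ih => rw [Finset.sum_insert ha, contract_add, ih, hf, add_zero]
  funext i j k l
  have h3 : contract (Matrix.single i j 1) t = 0 := by
    rw [single_eq_sum_pauli]
    exact h2 _ _ fun c => by rw [contract_smul, h1, smul_zero]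
  have h4 := congrFun (congrFun h3 k) l
  simp only [contract, LinearMap.coe_mk, AddHom.coe_mk, Matrix.of_apply] at h4
  rw [Finset.sum_eq_single i, Finset.sum_eq_single j] at h4
  · simpa using h4
  · intro b _ hb; simp [Ne.symm hb]
  · simp
  · intro b _ hb; simp [Ne.symm hb]
  · simp

/-- Invariance under `pauli r`, paired with `pauli u` in the first two slots and `pauli v` in the
last two. -/
theorem pauliCoeff_relation {t : Tensor4} (ht : t ∈ invTensor) {r : Label} (hr : r ∈ roots)
    (u v : Label) : (kap r u : ℂ) * pauliCoeff (r.add u) v t +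
      (kap r v : ℂ) * pauliCoeff u (r.add v) t = 0 := by
  have h := contract_act (pauli r) (pauli u) t
  rw [mem_invTensor.1 ht r hr, map_zero, pauli_act_transpose, contract_smul] at h
  have h' := trace_act (pauli r) (pauli v) (contract (pauli u) t)
  rw [eq_neg_of_add_eq_zero_right h.symm, pauli_act_transpose, Matrix.transpose_smul,
    Matrix.smul_mul, Matrix.trace_smul, Matrix.mul_neg, Matrix.trace_neg, Matrix.mul_smul,
    Matrix.trace_smul, ← pauliCoeff_apply, ← pauliCoeff_apply, smul_eq_mul, smul_eq_mul] at h'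
  have hs := pauliSign_ne_zero r r
  push_cast at h'
  have : (pauliSign r r : ℂ) * ((kap r u : ℂ) * pauliCoeff (r.add u) v t +
      (kap r v : ℂ) * pauliCoeff u (r.add v) t) = 0 := by linear_combination h'
  exact (mul_eq_zero.1 this).resolve_left hs

theorem pauliCoeff_off_diagonal {t : Tensor4} (ht : t ∈ invTensor) {u v : Label} (huv : u ≠ v) :
    pauliCoeff u v t = 0 := by
  obtain ⟨r, hr, ⟨h1, h2⟩ | ⟨h1, h2⟩⟩ := exists_kap_separating u v huv
  · have h := pauliCoeff_relation ht hr (r.add u) v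
    rw [Label.add_add_cancel, h2] at h
    simpa [h1] using h
  · have h := pauliCoeff_relation ht hr u (r.add v)
    rw [Label.add_add_cancel, h2] at h
    simpa [h1] using h

theorem pauliCoeff_diagonal {t : Tensor4} (ht : t ∈ invTensor) {r : Label} (hr : r ∈ roots)
    {u : Label} (hk : kap r u ≠ 0) (h0 : pauliCoeff (r.add u) (r.add u) t = 0) :
    pauliCoeff u u t = 0 := by
  have h := pauliCoeff_relation ht hr u (r.add u)
  rw [Label.add_add_cancel, h0] at h
  simpa [kap_add_ne_zero r hr u hk] using h

/-- An invariant tensor is determined by four of its components. -/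
theorem eq_zero_of_mem_invTensor {t : Tensor4} (ht : t ∈ invTensor)
    (h : ∀ k, pauliCoeff (orbitRep k) (orbitRep k) t = 0) : t = 0 := by
  refine eq_zero_of_pauliCoeff fun u v => ?_
  by_cases huv : u = v
  · subst huv
    rcases kap_orbit u with ⟨k, rfl⟩ | ⟨r, hr, hkr, ⟨k, hk⟩ | ⟨s, hs, hks, ⟨k, hk⟩ |
      ⟨q, hq, hkq, k, hk⟩⟩⟩
    · exact h k
    · exact pauliCoeff_diagonal ht hr hkr (by rw [hk]; exact h k)
    · exact pauliCoeff_diagonal ht hr hkr (pauliCoeff_diagonal ht hs hks (by rw [hk]; exact h k))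
    · exact pauliCoeff_diagonal ht hr hkr (pauliCoeff_diagonal ht hs hks
        (pauliCoeff_diagonal ht hq hkq (by rw [hk]; exact h k)))
  · exact pauliCoeff_off_diagonal ht huv

/-- One diagonal component for each irreducible summand of S ⊗ S determines the invariant. -/
theorem finrank_invTensor_le : Module.finrank ℂ invTensor ≤ 4 := by
  have h := LinearMap.finrank_le_finrank_of_injective
    (f := (LinearMap.pi fun k => pauliCoeff (orbitRep k) (orbitRep k)) ∘ₗ invTensor.subtype) (by
      rw [← LinearMap.ker_eq_bot, LinearMap.ker_eq_bot']
      rintro ⟨t, ht⟩ h0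
      exact Subtype.ext (eq_zero_of_mem_invTensor ht fun k => congrFun h0 k))
  simpa using h

end Spin7

namespace Spin7

/-! ### A basis of the invariant tensors of order four -/

/-- The product of two matrices, as a tensor with slots `12|34`. -/
def prodTensor (p q : Matrix Wt Wt ℂ) : Tensor4 := fun i j k l => p i j * q k l

/-- The tensor with the second and third slot exchanged. -/
def swapMid (t : Tensor4) : Tensor4 := fun i j k l => t i k j l

/-- The tensor with the last three slots permuted cyclically. -/
def rotate (t : Tensor4) : Tensor4 := fun i j k l => t i l j k

theorem derivTensor_swapMid (x : Matrix Wt Wt ℂ) (t : Tensor4) :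
    derivTensor x (swapMid t) = swapMid (derivTensor x t) := by
  funext i j k l
  simp only [derivTensor, swapMid, LinearMap.coe_mk, AddHom.coe_mk]
  ring

theorem derivTensor_rotate (x : Matrix Wt Wt ℂ) (t : Tensor4) :
    derivTensor x (rotate t) = rotate (derivTensor x t) := by
  funext i j k l
  simp only [derivTensor, rotate, LinearMap.coe_mk, AddHom.coe_mk]
  ring

theorem swapMid_mem {t : Tensor4} (ht : t ∈ invTensor) : swapMid t ∈ invTensor :=
  mem_invTensor.2 fun r hr => by
    rw [derivTensor_swapMid, mem_invTensor.1 ht r hr]; rfl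

theorem rotate_mem {t : Tensor4} (ht : t ∈ invTensor) : rotate t ∈ invTensor :=
  mem_invTensor.2 fun r hr => by
    rw [derivTensor_rotate, mem_invTensor.1 ht r hr]; rfl

theorem derivTensor_prodTensor (x p q : Matrix Wt Wt ℂ) :
    derivTensor x (prodTensor p q) = prodTensor (x * p + p * x.transpose) q +
      prodTensor p (x * q + q * x.transpose) := by
  funext i j k l
  simp only [derivTensor, prodTensor, LinearMap.coe_mk, AddHom.coe_mk, Pi.add_apply,
    Matrix.add_apply, Matrix.mul_apply, Matrix.transpose_apply, add_mul, mul_add, Finset.sum_mul,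
    Finset.mul_sum]
  rw [add_assoc]
  congr 1
  · congr 1 <;> exact Finset.sum_congr rfl fun a _ => by ring
  · congr 1 <;> exact Finset.sum_congr rfl fun a _ => by ring

/-- The labels of the invariant map `⋀² S → ℂ⁷`. -/
def vecLabel : Fin 7 → Label :=
  ![({0, 1}, {1}), ({0, 1}, {1, 2}), ({0, 2}, {2}), ({0, 2}, {1, 2}), ({1, 2}, {2}),
    ({1, 2}, {0, 2}), ({0, 1, 2}, {1})]

/-- The signs of the quadratic form on `ℂ⁷` in the basis `vecLabel`. -/
def vecSign : Fin 7 → ℤ := ![1, -1, -1, 1, 1, -1, -1]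

/-- The invariant tensor that is given by the quadratic form on `ℂ⁷ ⊆ ⋀² S`. -/
def vecTensor : Tensor4 :=
  ∑ m, (vecSign m : ℂ) • prodTensor (pauli (vecLabel m)) (pauli (vecLabel m))

/-- A root acts on the span of these matrices as an infinitesimal rotation of one coordinate plane,
compatible with the signs `vecSign`; this is why the quadratic tensor is invariant. -/
theorem vecLabel_act : ∀ r ∈ roots, (∀ m, kap r (vecLabel m) = 0) ∨ ∃ m n, m ≠ n ∧
    r.add (vecLabel m) = vecLabel n ∧ r.add (vecLabel n) = vecLabel m ∧
    vecSign m * kap r (vecLabel m) + vecSign n * kap r (vecLabel n) = 0 ∧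
    ∀ l, l ≠ m → l ≠ n → kap r (vecLabel l) = 0 := by
  decide +kernel

theorem prodTensor_smul_left (c : ℂ) (p q : Matrix Wt Wt ℂ) :
    prodTensor (c • p) q = c • prodTensor p q := by
  funext i j k l; simp [prodTensor, mul_assoc]

theorem prodTensor_smul_right (c : ℂ) (p q : Matrix Wt Wt ℂ) :
    prodTensor p (c • q) = c • prodTensor p q := by
  funext i j k l; simp [prodTensor, mul_left_comm]

theorem vecTensor_mem : vecTensor ∈ invTensor := by
  refine mem_invTensor.2 fun r hr => ?_
  have hterm : ∀ m, derivTensor (pauli r)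
      ((vecSign m : ℂ) • prodTensor (pauli (vecLabel m)) (pauli (vecLabel m))) =
      ((vecSign m * kap r (vecLabel m) : ℤ) : ℂ) •
        (prodTensor (pauli (r.add (vecLabel m))) (pauli (vecLabel m)) +
          prodTensor (pauli (vecLabel m)) (pauli (r.add (vecLabel m)))) := by
    intro m
    rw [map_smul, derivTensor_prodTensor, pauli_act, prodTensor_smul_left, prodTensor_smul_right,
      ← smul_add, smul_smul]
    push_cast; rfl
  rw [vecTensor, map_sum]
  simp only [hterm]
  rcases vecLabel_act r hr with h | ⟨m, n, hmn, h1, h2, h3, h4⟩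
  · exact Finset.sum_eq_zero fun m _ => by simp [h m]
  · rw [Finset.sum_eq_add m n hmn (fun l _ hl => by simp [h4 l hl.1 hl.2]) (by simp) (by simp),
      h1, h2, add_comm (prodTensor (pauli (vecLabel m)) _), ← add_smul]
    rw [← Int.cast_add, h3]; simp

/-- The Cayley form, the invariant alternating tensor of order four. -/
noncomputable def cayley : Tensor4 := vecTensor - swapMid vecTensor + rotate vecTensor

theorem cayley_mem : cayley ∈ invTensor :=
  add_mem (sub_mem vecTensor_mem (swapMid_mem vecTensor_mem)) (rotate_mem vecTensor_mem)

theorem form_sq_mem : prodTensor form form ∈ invTensor :=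
  mem_invTensor.2 fun r hr => by
    rw [derivTensor_prodTensor, pauli_mul_form hr]
    funext i j k l
    simp [prodTensor]

/-- The integral Cayley form. -/
def cayleyInt (i j k l : Wt) : ℤ := ∑ m, vecSign m *
  (pauliInt (vecLabel m) i j * pauliInt (vecLabel m) k l -
    pauliInt (vecLabel m) i k * pauliInt (vecLabel m) j l +
    pauliInt (vecLabel m) i l * pauliInt (vecLabel m) j k)

theorem cayley_apply (i j k l : Wt) : cayley i j k l = cayleyInt i j k l := by
  simp only [cayley, vecTensor, swapMid, rotate, Pi.add_apply, Pi.sub_apply, Finset.sum_apply,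
    Pi.smul_apply, prodTensor, pauli, Matrix.map_apply, smul_eq_mul, eq_intCast, cayleyInt]
  push_cast
  rw [← Finset.sum_sub_distrib, ← Finset.sum_add_distrib]
  exact Finset.sum_congr rfl fun m _ => by ring

theorem vecInt_skew : ∀ m, ∀ i j, pauliInt (vecLabel m) i j = -pauliInt (vecLabel m) j i := by
  have h : ∀ m, pauliSign (vecLabel m) (vecLabel m) = -1 := by decide +kernel
  intro m i j
  have := congrFun (congrFun (pauliInt_transpose (vecLabel m)) j) i
  rw [h] at this
  simpa using this

theorem form_apply (i j : Wt) : form i j = pauliInt formLabel i j := rfl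

theorem form_comm (i j : Wt) : form i j = form j i := by
  have h : pauliSign formLabel formLabel = 1 := by decide +kernel
  have := congrFun (congrFun (pauliInt_transpose formLabel) j) i
  rw [h] at this
  simp only [form_apply]
  exact congrArg _ (by simpa using this)

/-- Each factor is skew in its two slots and the pairing is symmetric in its two factors. A
transposition therefore negates one of the terms 12|34, 13|24, 14|23 and exchanges the other two,
and the signs +, −, + make the sum skew. -/
theorem cayley_swap01 (i j k l : Wt) : cayley j i k l = -cayley i j k l := by
  rw [cayley_apply, cayley_apply, ← Int.cast_neg, cayleyInt, cayleyInt, ← Finset.sum_neg_distrib]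
  congr 1
  refine Finset.sum_congr rfl fun m _ => ?_
  rw [vecInt_skew m j i]; ring

theorem cayley_swap12 (i j k l : Wt) : cayley i k j l = -cayley i j k l := by
  rw [cayley_apply, cayley_apply, ← Int.cast_neg, cayleyInt, cayleyInt, ← Finset.sum_neg_distrib]
  congr 1
  refine Finset.sum_congr rfl fun m _ => ?_
  rw [vecInt_skew m k j]; ring

theorem cayley_swap23 (i j k l : Wt) : cayley i j l k = -cayley i j k l := by
  rw [cayley_apply, cayley_apply, ← Int.cast_neg, cayleyInt, cayleyInt, ← Finset.sum_neg_distrib]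
  congr 1
  refine Finset.sum_congr rfl fun m _ => ?_
  rw [vecInt_skew m l k]; ring

/-- A basis of the space of invariant tensors: the three products of the invariant form with
itself, and the Cayley form. -/
noncomputable def invBasis : Fin 4 → Tensor4 :=
  ![prodTensor form form, swapMid (prodTensor form form), rotate (prodTensor form form), cayley]

theorem invBasis_mem (k : Fin 4) : invBasis k ∈ invTensor := by
  fin_cases k
  · exact form_sq_mem
  · exact swapMid_mem form_sq_mem
  · exact rotate_mem form_sq_mem
  · exact cayley_mem

/-- The tensor with given coefficients in the basis `invBasis`. -/
theorem sum_invBasis_apply (c : Fin 4 → ℂ) (i j k l : Wt) :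
    (∑ n, c n • invBasis n) i j k l = c 0 * (form i j * form k l) + c 1 * (form i k * form j l) +
      c 2 * (form i l * form j k) + c 3 * cayley i j k l := by
  simp [Fin.sum_univ_four, invBasis, prodTensor, swapMid, rotate]

theorem form_values : pauliInt formLabel ∅ ∅ = 0 ∧ pauliInt formLabel ∅ Finset.univ = 1 ∧
    pauliInt formLabel Finset.univ ∅ = 1 ∧ pauliInt formLabel Finset.univ Finset.univ = 0 ∧
    pauliInt formLabel ∅ {0, 1} = 0 ∧ pauliInt formLabel ∅ {0, 2} = 0 ∧
    pauliInt formLabel ∅ {1, 2} = 0 ∧ pauliInt formLabel ∅ {0} = 0 ∧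
    pauliInt formLabel {0} {1, 2} = -1 := by
  decide +kernel

theorem cayley_values : cayleyInt ∅ {0, 1} {0, 2} {1, 2} = 6 ∧
    cayleyInt ∅ ∅ Finset.univ Finset.univ = 0 ∧ cayleyInt ∅ Finset.univ ∅ Finset.univ = 0 ∧
    cayleyInt ∅ Finset.univ Finset.univ ∅ = 0 := by
  decide +kernel

/-- The coefficients of an invariant tensor are determined by it. -/
theorem sum_invBasis_eq_zero {c : Fin 4 → ℂ} (h : ∑ n, c n • invBasis n = 0) : c = 0 := by
  have h' : ∀ i j k l, (∑ n, c n • invBasis n) i j k l = 0 := fun i j k l => by rw [h]; rfl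
  simp only [sum_invBasis_apply, form_apply, cayley_apply] at h'
  obtain ⟨f1, f2, f3, f4, f5, f6, f7, -, -⟩ := form_values
  obtain ⟨c1, c2, c3, c4⟩ := cayley_values
  -- `form i j` is nonzero only for complementary `i`, `j`. No two of these four sets are
  -- complementary, which isolates the Cayley coefficient; each of the next three evaluations gives
  -- the sum of two product coefficients.
  have e1 := h' ∅ {0, 1} {0, 2} {1, 2}
  have e2 := h' ∅ ∅ Finset.univ Finset.univ
  have e3 := h' ∅ Finset.univ ∅ Finset.univ
  have e4 := h' ∅ Finset.univ Finset.univ ∅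
  simp only [f1, f2, f3, f4, f5, f6, f7, c1, c2, c3, c4] at e1 e2 e3 e4
  norm_num at e1 e2 e3 e4
  ext n
  fin_cases n
  · show c 0 = 0
    linear_combination (e3 + e4 - e2) / 2
  · show c 1 = 0
    linear_combination (e2 + e4 - e3) / 2
  · show c 2 = 0
    linear_combination (e2 + e3 - e4) / 2
  · exact e1

/-- Four independent invariants meet the upper bound `finrank_invTensor_le`. -/
theorem exists_eq_sum_invBasis {t : Tensor4} (ht : t ∈ invTensor) :
    ∃ c : Fin 4 → ℂ, t = ∑ n, c n • invBasis n := by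
  have hli : LinearIndependent ℂ fun k => (⟨invBasis k, invBasis_mem k⟩ : invTensor) := by
    rw [Fintype.linearIndependent_iff]
    intro g hg n
    refine congrFun (sum_invBasis_eq_zero (c := g) ?_) n
    simpa using congrArg (fun y : invTensor => (y : Tensor4)) hg
  have hcard : Fintype.card (Fin 4) = Module.finrank ℂ invTensor :=
    le_antisymm hli.fintype_card_le_finrank (by simpa using finrank_invTensor_le)
  have hspan := hli.span_eq_top_of_card_eq_finrank hcard
  have hmem : (⟨t, ht⟩ : invTensor) ∈ Submodule.span ℂ
      (Set.range fun k => (⟨invBasis k, invBasis_mem k⟩ : invTensor)) := by rw [hspan]; trivial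
  obtain ⟨c, hc⟩ := (Submodule.mem_span_range_iff_exists_fun ℂ).1 hmem
  exact ⟨c, by simpa using (congrArg (fun y : invTensor => (y : Tensor4)) hc).symm⟩

end Spin7

/-! ### Alternating forms given by their values on a basis -/

section Alternating

variable {M : Type*} [AddCommGroup M] [Module ℂ M] {k : ℕ}

theorem exists_multilinearMap_of_basis {ι : Type*} [Fintype ι] [DecidableEq ι]
    (β : Module.Basis ι ℂ M) (t : (Fin k → ι) → ℂ) :
    ∃ μ : MultilinearMap ℂ (fun _ : Fin k => M) ℂ, ∀ m, μ (fun i => β (m i)) = t m := by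
  refine ⟨∑ m, t m • (MultilinearMap.mkPiAlgebra ℂ (Fin k) ℂ).compLinearMap
    fun i => β.coord (m i), fun m => ?_⟩
  simp only [sum_apply, smul_apply,
    MultilinearMap.compLinearMap_apply, MultilinearMap.mkPiAlgebra_apply, Module.Basis.coord_apply,
    Module.Basis.repr_self, smul_eq_mul]
  rw [Finset.sum_eq_single m]
  · simp
  · intro n _ hn
    obtain ⟨i, hi⟩ := Function.ne_iff.1 hn
    rw [Finset.prod_eq_zero (Finset.mem_univ i), mul_zero]
    rw [Finsupp.single_apply, if_neg (Ne.symm hi)]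
  · simp

/-- A form that changes sign under transpositions is alternating because 2 is invertible in ℂ. -/
theorem exists_alternatingMap_of_basis {ι : Type*} [Fintype ι] [DecidableEq ι]
    (β : Module.Basis ι ℂ M) (t : (Fin k → ι) → ℂ)
    (ht : ∀ m i j, i ≠ j → t (m ∘ Equiv.swap i j) = -t m) :
    ∃ η : M [⋀^Fin k]→ₗ[ℂ] ℂ, ∀ m, η (fun i => β (m i)) = t m := by
  obtain ⟨μ, hμ⟩ := exists_multilinearMap_of_basis β t
  have hswap : ∀ i j, i ≠ j → μ.domDomCongr (Equiv.swap i j) = -μ := by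
    intro i j hij
    refine Module.Basis.ext_multilinear (fun _ => β) fun m => ?_
    rw [MultilinearMap.domDomCongr_apply, neg_apply, hμ, hμ]
    exact ht m i j hij
  refine ⟨{ μ with map_eq_zero_of_eq' := ?_ }, hμ⟩
  intro v i j hv hij
  have h1 := congrArg (fun f => f v) (hswap i j hij)
  simp only [MultilinearMap.domDomCongr_apply, neg_apply] at h1
  have h2 : (fun l => v (Equiv.swap i j l)) = v := by
    ext l
    by_cases hl : l = i
    · subst hl; rw [Equiv.swap_apply_left, hv]
    · by_cases hl' : l = j
      · subst hl'; rw [Equiv.swap_apply_right, hv]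
      · rw [Equiv.swap_apply_of_ne_of_ne hl hl']
  rw [h2] at h1
  exact self_eq_neg.1 h1

/-- The action of an endomorphism on multilinear forms, as a derivation. -/
noncomputable def derivForm (η : M [⋀^Fin k]→ₗ[ℂ] ℂ) (X : Module.End ℂ M) :
    MultilinearMap ℂ (fun _ : Fin k => M) ℂ :=
  ∑ i, (η : MultilinearMap ℂ (fun _ : Fin k => M) ℂ).compLinearMap
    (Function.update (fun _ => LinearMap.id) i X)

theorem derivForm_apply (η : M [⋀^Fin k]→ₗ[ℂ] ℂ) (X : Module.End ℂ M) (v : Fin k → M) :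
    derivForm η X v = ∑ i, η (Function.update v i (X (v i))) := by
  simp only [derivForm, sum_apply, MultilinearMap.compLinearMap_apply]
  refine Finset.sum_congr rfl fun i _ => congrArg η ?_
  ext j
  by_cases h : j = i
  · subst h; simp
  · simp [h]

/-- The alternating forms that are annihilated by a set of endomorphisms. -/
def invForms (k : ℕ) (S : Set (Module.End ℂ M)) : Submodule ℂ (M [⋀^Fin k]→ₗ[ℂ] ℂ) where
  carrier := {η | ∀ X ∈ S, ∀ v : Fin k → M, ∑ i, η (Function.update v i (X (v i))) = 0}
  zero_mem' := by simp
  add_mem' {a b} ha hb X hX v := by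
    simp [Finset.sum_add_distrib, ha X hX v, hb X hX v]
  smul_mem' c a ha X hX v := by
    simp [← Finset.mul_sum, ha X hX v]

theorem mem_invForms_iff_basis {ι : Type*} [Fintype ι] (β : Module.Basis ι ℂ M)
    {S : Set (Module.End ℂ M)} {η : M [⋀^Fin k]→ₗ[ℂ] ℂ} :
    η ∈ invForms k S ↔ ∀ X ∈ S, ∀ m : Fin k → ι,
      ∑ i, η (Function.update (fun j => β (m j)) i (X (β (m i)))) = 0 := by
  refine ⟨fun h X hX m => h X hX _, fun h X hX v => ?_⟩
  have h0 : derivForm η X = 0 := Module.Basis.ext_multilinear (fun _ => β) fun m => by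
    rw [derivForm_apply, h X hX m]; rfl
  rw [← derivForm_apply, h0]; rfl

/-- Invariance is linear in the endomorphism, so a Lie algebra may be replaced by spanning elements:
the Pauli roots, or its rational elements. -/
theorem invForms_span (S : Set (Module.End ℂ M)) :
    invForms k (Submodule.span ℂ S : Set (Module.End ℂ M)) = invForms k S := by
  refine le_antisymm (fun η h X hX => h X (Submodule.subset_span hX)) fun η h X hX v => ?_
  induction hX using Submodule.span_induction with
  | mem X hX => exact h X hX v
  | zero => exact Finset.sum_eq_zero fun i _ => by simp
  | add X Y _ _ hX hY =>
    simp only [LinearMap.add_apply, AlternatingMap.map_update_add, Finset.sum_add_distrib, hX, hY,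
      add_zero]
  | smul c X _ hX =>
    simp only [LinearMap.smul_apply, AlternatingMap.map_update_smul, ← Finset.smul_sum, hX,
      smul_zero]

end Alternating

/-! ### The action of so(7) on two copies of the spinors, in components. -/

namespace Spin7

variable {M : Type*} [AddCommGroup M] [Module ℂ M]

/-- The action of a matrix on two copies of the spinors. -/
noncomputable def doubleAct (d : Module.Basis (Fin 2 × Wt) ℂ M) :
    Matrix Wt Wt ℂ →ₗ[ℂ] Module.End ℂ M where
  -- Rows of `x` rather than columns: `d` will consist of coordinate functionals on H¹, on which an
  -- endomorphism acts by its transpose.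
  toFun x := d.constr ℂ fun p => ∑ J, x p.2 J • d (p.1, J)
  map_add' x y := d.ext fun p => by simp [add_smul, Finset.sum_add_distrib]
  map_smul' c x := d.ext fun p => by simp [Finset.smul_sum, smul_smul]

theorem doubleAct_basis (d : Module.Basis (Fin 2 × Wt) ℂ M) (x : Matrix Wt Wt ℂ)
    (p : Fin 2 × Wt) : doubleAct d x (d p) = ∑ J, x p.2 J • d (p.1, J) := by
  simp [doubleAct]

/-- The alternating forms on two copies of the spinors that are invariant under `so(7)`. -/
noncomputable def so7Forms (d : Module.Basis (Fin 2 × Wt) ℂ M) (k : ℕ) :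
    Submodule ℂ (M [⋀^Fin k]→ₗ[ℂ] ℂ) :=
  invForms k (Set.range fun x : so7 => doubleAct d (spinMatrix x))

theorem so7Forms_eq (d : Module.Basis (Fin 2 × Wt) ℂ M) (k : ℕ) :
    so7Forms d k = invForms k ((fun r => doubleAct d (pauli r)) '' roots) := by
  refine le_antisymm ?_ ?_
  · rintro η h _ ⟨r, hr, rfl⟩
    obtain ⟨x, hx⟩ := exists_spinMatrix_eq_pauli hr
    exact h _ ⟨x, by simp only [hx]⟩
  · rw [← invForms_span]
    rintro η h _ ⟨x, rfl⟩
    refine h _ ?_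
    have := Submodule.mem_map_of_mem (f := doubleAct d) (spinMatrix_mem_span_pauli x)
    rwa [Submodule.map_span, Set.image_image] at this

/-- The components of an alternating form of degree two in the two copies of the spinors. -/
noncomputable def component2 (d : Module.Basis (Fin 2 × Wt) ℂ M) (η : M [⋀^Fin 2]→ₗ[ℂ] ℂ) (a b : Fin 2) :
    Matrix Wt Wt ℂ := fun i j => η ![d (a, i), d (b, j)]

/-- The components of an alternating form of degree four in the two copies of the spinors. -/
noncomputable def component4 (d : Module.Basis (Fin 2 × Wt) ℂ M) (η : M [⋀^Fin 4]→ₗ[ℂ] ℂ) (a b c e : Fin 2) :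
    Tensor4 := fun i j k l => η ![d (a, i), d (b, j), d (c, k), d (e, l)]

theorem basis_comp2 (d : Module.Basis (Fin 2 × Wt) ℂ M) (m : Fin 2 → Fin 2 × Wt) :
    (fun i => d (m i)) = ![d (m 0), d (m 1)] := by
  ext i; fin_cases i <;> rfl

theorem basis_comp4 (d : Module.Basis (Fin 2 × Wt) ℂ M) (m : Fin 4 → Fin 2 × Wt) :
    (fun i => d (m i)) = ![d (m 0), d (m 1), d (m 2), d (m 3)] := by
  ext i; fin_cases i <;> rfl

theorem map_sum_slot {k : ℕ} (η : M [⋀^Fin k]→ₗ[ℂ] ℂ) (v : Fin k → M) (i : Fin k) (x : Wt → ℂ)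
    (y : Wt → M) : η (Function.update v i (∑ J, x J • y J)) =
      ∑ J, x J * η (Function.update v i (y J)) := by
  rw [AlternatingMap.map_update_sum]
  simp [AlternatingMap.map_update_smul]

/-- The Lie algebra acts alike on the two copies and does not mix them, so invariance is tested on
each component separately. -/
theorem mem_so7Forms_two (d : Module.Basis (Fin 2 × Wt) ℂ M) {η : M [⋀^Fin 2]→ₗ[ℂ] ℂ} :
    η ∈ so7Forms d 2 ↔ ∀ a b, ∀ r ∈ roots,
      pauli r * component2 d η a b + component2 d η a b * (pauli r).transpose = 0 := by
  have key : ∀ r, ∀ m : Fin 2 → Fin 2 × Wt, ∑ i, η (Function.update (fun j => d (m j)) i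
      (doubleAct d (pauli r) (d (m i)))) = (pauli r * component2 d η (m 0).1 (m 1).1 +
        component2 d η (m 0).1 (m 1).1 * (pauli r).transpose) (m 0).2 (m 1).2 := by
    intro r m
    simp only [doubleAct_basis, map_sum_slot, Fin.sum_univ_two, Matrix.add_apply, Matrix.mul_apply,
      Matrix.transpose_apply, component2]
    congr 1
    · refine Finset.sum_congr rfl fun J _ => ?_
      congr 2; ext i; fin_cases i <;> simp
    · refine Finset.sum_congr rfl fun J _ => ?_
      rw [mul_comm]
      congr 2; ext i; fin_cases i <;> simp
  rw [so7Forms_eq, mem_invForms_iff_basis d]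
  constructor
  · intro h a b r hr
    ext i j
    have := h _ ⟨r, hr, rfl⟩ ![(a, i), (b, j)]
    rw [key] at this
    exact this
  · rintro h _ ⟨r, hr, rfl⟩ m
    rw [key, h _ _ r hr]; rfl

theorem mem_so7Forms_four (d : Module.Basis (Fin 2 × Wt) ℂ M) {η : M [⋀^Fin 4]→ₗ[ℂ] ℂ} :
    η ∈ so7Forms d 4 ↔ ∀ a b c e, component4 d η a b c e ∈ invTensor := by
  have key : ∀ r, ∀ m : Fin 4 → Fin 2 × Wt, ∑ i, η (Function.update (fun j => d (m j)) i
      (doubleAct d (pauli r) (d (m i)))) =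
      derivTensor (pauli r) (component4 d η (m 0).1 (m 1).1 (m 2).1 (m 3).1)
        (m 0).2 (m 1).2 (m 2).2 (m 3).2 := by
    intro r m
    simp only [doubleAct_basis, map_sum_slot, Fin.sum_univ_four, derivTensor, LinearMap.coe_mk,
      AddHom.coe_mk, component4]
    congr 1
    · congr 1
      · congr 1
        · refine Finset.sum_congr rfl fun J _ => ?_
          congr 2; ext i; fin_cases i <;> simp
        · refine Finset.sum_congr rfl fun J _ => ?_
          congr 2; ext i; fin_cases i <;> simp
      · refine Finset.sum_congr rfl fun J _ => ?_
        congr 2; ext i; fin_cases i <;> simp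
    · refine Finset.sum_congr rfl fun J _ => ?_
      congr 2; ext i; fin_cases i <;> simp
  simp only [mem_invTensor]
  rw [so7Forms_eq, mem_invForms_iff_basis d]
  constructor
  · intro h a b c e r hr
    funext i j k l
    have := h _ ⟨r, hr, rfl⟩ ![(a, i), (b, j), (c, k), (e, l)]
    rw [key] at this
    exact this
  · rintro h _ ⟨r, hr, rfl⟩ m
    rw [key, h _ _ _ _ r hr]; rfl

end Spin7

namespace Spin7

variable {M : Type*} [AddCommGroup M] [Module ℂ M]

/-! ### Invariant forms of degree two -/

theorem component2_swap (d : Module.Basis (Fin 2 × Wt) ℂ M) (η : M [⋀^Fin 2]→ₗ[ℂ] ℂ)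
    (a b : Fin 2) (i j : Wt) : component2 d η b a j i = -component2 d η a b i j := by
  have h := η.map_swap ![d (a, i), d (b, j)] (i := 0) (j := 1) (by decide)
  rw [component2, component2, ← h]
  congr 1; ext p; fin_cases p <;> simp

/-- The alternating form on `ℂ²`. -/
def sgn2 (a b : Fin 2) : ℂ := (b.val : ℂ) - a.val

theorem sgn2_swap (a b : Fin 2) : sgn2 b a = -sgn2 a b := by simp [sgn2]

/-- The invariant alternating form of degree two, on basis vectors. -/
noncomputable def sympForm (p q : Fin 2 × Wt) : ℂ := sgn2 p.1 q.1 * form p.2 q.2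

theorem sympForm_swap (p q : Fin 2 × Wt) : sympForm q p = -sympForm p q := by
  rw [sympForm, sympForm, sgn2_swap, form_comm]; ring

theorem form_empty_univ : form ∅ Finset.univ = 1 := by
  rw [form_apply, form_values.2.1]; simp

theorem swap_two {i j : Fin 2} (hij : i ≠ j) {α : Type*} (m : Fin 2 → α) :
    (m ∘ Equiv.swap i j) 0 = m 1 ∧ (m ∘ Equiv.swap i j) 1 = m 0 := by
  fin_cases i <;> fin_cases j <;> simp at hij ⊢

theorem finrank_so7Forms_two (d : Module.Basis (Fin 2 × Wt) ℂ M) :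
    Module.finrank ℂ (so7Forms d 2) = 1 := by
  obtain ⟨η₀, hη₀⟩ := exists_alternatingMap_of_basis d
    (fun m : Fin 2 → Fin 2 × Wt => sympForm (m 0) (m 1)) (by
      intro m i j hij
      simp only [(swap_two hij m).1, (swap_two hij m).2]
      exact sympForm_swap _ _)
  have hc₀ : ∀ a b, component2 d η₀ a b = sgn2 a b • form := by
    intro a b
    ext i j
    have := hη₀ ![(a, i), (b, j)]
    rw [basis_comp2] at this
    exact this
  have hmem : η₀ ∈ so7Forms d 2 := by
    rw [mem_so7Forms_two]
    intro a b r hr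
    rw [hc₀, Matrix.mul_smul, Matrix.smul_mul, ← smul_add, pauli_mul_form hr, smul_zero]
  refine finrank_eq_one (⟨η₀, hmem⟩ : so7Forms d 2) ?_ ?_
  · intro h
    have h1 : η₀ = 0 := congrArg Subtype.val h
    have h2 := congrFun (congrFun (hc₀ 0 1) ∅) Finset.univ
    simp [h1, component2, sgn2, form_empty_univ] at h2
  · rintro ⟨η, hη⟩
    have hη' := (mem_so7Forms_two d).1 hη
    choose c hc using fun a b => eq_smul_form_of_invariant (hη' a b)
    -- `form` is symmetric, so the skewness of η passes to the coefficients on ℂ².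
    have hsw : ∀ a b, c b a = -c a b := by
      intro a b
      have h := component2_swap d η a b ∅ Finset.univ
      rw [hc, hc] at h
      simpa [form_comm Finset.univ ∅, form_empty_univ] using h
    refine ⟨c 0 1, Subtype.ext ?_⟩
    refine AlternatingMap.coe_multilinearMap_injective
      (Module.Basis.ext_multilinear (fun _ => d) fun m => ?_)
    have h1 : ∀ a b, c 0 1 * sgn2 a b = c a b := by
      intro a b
      have h00 := self_eq_neg.1 (hsw 0 0)
      have h11 := self_eq_neg.1 (hsw 1 1)
      fin_cases a <;> fin_cases b <;> simp [sgn2, h00, h11, hsw 0 1]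
    have h2 := congrFun (congrFun (hc (m 0).1 (m 1).1) (m 0).2) (m 1).2
    have h3 := congrFun (congrFun (hc₀ (m 0).1 (m 1).1) (m 0).2) (m 1).2
    simp only [component2, Matrix.smul_apply, smul_eq_mul, Prod.mk.eta] at h2 h3
    show c 0 1 * η₀ (fun i => d (m i)) = η (fun i => d (m i))
    rw [basis_comp2, h2, h3]
    linear_combination form (m 0).2 (m 1).2 * h1 (m 0).1 (m 1).1

/-! ### Invariant forms of degree four -/

theorem component4_swap01 (d : Module.Basis (Fin 2 × Wt) ℂ M) (η : M [⋀^Fin 4]→ₗ[ℂ] ℂ)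
    (a b c e : Fin 2) (i j k l : Wt) :
    component4 d η b a c e j i k l = -component4 d η a b c e i j k l := by
  have h := η.map_swap ![d (a, i), d (b, j), d (c, k), d (e, l)] (i := 0) (j := 1) (by decide)
  rw [component4, component4, ← h]
  congr 1; ext p; fin_cases p <;> rfl

theorem component4_swap12 (d : Module.Basis (Fin 2 × Wt) ℂ M) (η : M [⋀^Fin 4]→ₗ[ℂ] ℂ)
    (a b c e : Fin 2) (i j k l : Wt) :
    component4 d η a c b e i k j l = -component4 d η a b c e i j k l := by
  have h := η.map_swap ![d (a, i), d (b, j), d (c, k), d (e, l)] (i := 1) (j := 2) (by decide)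
  rw [component4, component4, ← h]
  congr 1; ext p; fin_cases p <;> rfl

theorem component4_swap23 (d : Module.Basis (Fin 2 × Wt) ℂ M) (η : M [⋀^Fin 4]→ₗ[ℂ] ℂ)
    (a b c e : Fin 2) (i j k l : Wt) :
    component4 d η a b e c i j l k = -component4 d η a b c e i j k l := by
  have h := η.map_swap ![d (a, i), d (b, j), d (c, k), d (e, l)] (i := 2) (j := 3) (by decide)
  rw [component4, component4, ← h]
  congr 1; ext p; fin_cases p <;> rfl

/-- The six values that determine an invariant alternating form of degree four. -/
noncomputable def evalForm4 (d : Module.Basis (Fin 2 × Wt) ℂ M) :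
    (M [⋀^Fin 4]→ₗ[ℂ] ℂ) →ₗ[ℂ] (Fin 6 → ℂ) where
  toFun η := ![component4 d η 0 0 0 0 ∅ {0, 1} {0, 2} {1, 2},
    component4 d η 0 0 0 1 ∅ {0, 1} {0, 2} {1, 2}, component4 d η 0 0 1 1 ∅ {0, 1} {0, 2} {1, 2},
    component4 d η 0 1 1 1 ∅ {0, 1} {0, 2} {1, 2}, component4 d η 1 1 1 1 ∅ {0, 1} {0, 2} {1, 2},
    component4 d η 0 1 0 1 ∅ Finset.univ {0} {1, 2}]
  map_add' _ _ := by simp [component4]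
  map_smul' _ _ := by simp [component4]

/-- The Cayley coefficient is symmetric in the four indices from `Fin 2`, hence determined by how
many of them are 1: five values. The coefficient of the first product is skew in the first pair and
in the last pair, hence determined by one value, and it determines the other two products. -/
theorem eq_zero_of_swap_relations {C : Fin 2 → Fin 2 → Fin 2 → Fin 2 → Fin 4 → ℂ}
    (h01 : ∀ a b c e, C b a c e 0 = -C a b c e 0 ∧ C b a c e 1 = -C a b c e 2 ∧
      C b a c e 3 = C a b c e 3)
    (h12 : ∀ a b c e, C a c b e 1 = -C a b c e 0 ∧ C a c b e 3 = C a b c e 3)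
    (h23 : ∀ a b c e, C a b e c 0 = -C a b c e 0 ∧ C a b e c 3 = C a b c e 3)
    (h0 : C 0 0 0 0 3 = 0) (h1 : C 0 0 0 1 3 = 0) (h2 : C 0 0 1 1 3 = 0) (h3 : C 0 1 1 1 3 = 0)
    (h4 : C 1 1 1 1 3 = 0) (h5 : C 0 1 0 1 0 = 0) : C = 0 := by
  have e3 : ∀ a b c e, C a b c e 3 = 0 := by
    have a1 : C 0 0 1 0 3 = 0 := by rw [(h23 0 0 0 1).2, h1]
    have a2 : C 0 1 0 0 3 = 0 := by rw [(h12 0 0 1 0).2, a1]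
    have a3 : C 1 0 0 0 3 = 0 := by rw [(h01 0 1 0 0).2.2, a2]
    have b1 : C 0 1 0 1 3 = 0 := by rw [(h12 0 0 1 1).2, h2]
    have b2 : C 1 0 0 1 3 = 0 := by rw [(h01 0 1 0 1).2.2, b1]
    have b3 : C 0 1 1 0 3 = 0 := by rw [(h23 0 1 0 1).2, b1]
    have b4 : C 1 0 1 0 3 = 0 := by rw [(h23 1 0 0 1).2, b2]
    have b5 : C 1 1 0 0 3 = 0 := by rw [(h12 1 0 1 0).2, b4]
    have c1 : C 1 0 1 1 3 = 0 := by rw [(h01 0 1 1 1).2.2, h3]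
    have c2 : C 1 1 0 1 3 = 0 := by rw [(h12 1 0 1 1).2, c1]
    have c3 : C 1 1 1 0 3 = 0 := by rw [(h23 1 1 0 1).2, c2]
    simp only [Fin.forall_fin_two]
    simp only [h0, h1, h2, h3, h4, a1, a2, a3, b1, b2, b3, b4, b5, c1, c2, c3, and_self]
  have e0 : ∀ a b c e, C a b c e 0 = 0 := by
    have d1 : ∀ a c e, C a a c e 0 = 0 := fun a c e => self_eq_neg.1 (h01 a a c e).1
    have d2 : ∀ a b c, C a b c c 0 = 0 := fun a b c => self_eq_neg.1 (h23 a b c c).1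
    have a1 : C 1 0 0 1 0 = 0 := by rw [(h01 0 1 0 1).1, h5, neg_zero]
    have a2 : C 0 1 1 0 0 = 0 := by rw [(h23 0 1 0 1).1, h5, neg_zero]
    have a3 : C 1 0 1 0 0 = 0 := by rw [(h23 1 0 0 1).1, a1, neg_zero]
    simp only [Fin.forall_fin_two]
    simp only [h5, d1, d2, a1, a2, a3, and_self]
  have e1 : ∀ a b c e, C a b c e 1 = 0 := fun a b c e => by rw [(h12 a c b e).1, e0, neg_zero]
  have e2 : ∀ a b c e, C a b c e 2 = 0 := fun a b c e => by
    rw [← neg_neg (C a b c e 2), ← (h01 a b c e).2.1, e1, neg_zero]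
  funext a b c e n
  fin_cases n
  exacts [e0 a b c e, e1 a b c e, e2 a b c e, e3 a b c e]

theorem eq_zero_of_evalForm4 (d : Module.Basis (Fin 2 × Wt) ℂ M) {η : M [⋀^Fin 4]→ₗ[ℂ] ℂ}
    (hη : η ∈ so7Forms d 4) (h0 : evalForm4 d η = 0) : η = 0 := by
  choose C hC using fun a b c e => exists_eq_sum_invBasis ((mem_so7Forms_four d).1 hη a b c e)
  have hval : ∀ a b c e i j k l, component4 d η a b c e i j k l =
      C a b c e 0 * (form i j * form k l) + C a b c e 1 * (form i k * form j l) +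
      C a b c e 2 * (form i l * form j k) + C a b c e 3 * cayley i j k l := by
    intro a b c e i j k l
    rw [← sum_invBasis_apply, ← hC]
  obtain ⟨f1, f2, f3, f4, f5, f6, f7, f8, f9⟩ := form_values
  have hcay : ∀ a b c e, component4 d η a b c e ∅ {0, 1} {0, 2} {1, 2} = C a b c e 3 * 6 := by
    intro a b c e
    rw [hval, form_apply, form_apply, form_apply, form_apply, form_apply, form_apply, cayley_apply,
      f5, f6, f7, cayley_values.1]
    push_cast; ring
  have hz : ∀ n, evalForm4 d η n = 0 := fun n => congrFun h0 n
  have z : ∀ a b c e, component4 d η a b c e ∅ {0, 1} {0, 2} {1, 2} = 0 → C a b c e 3 = 0 := by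
    intro a b c e h
    rw [hcay] at h
    simpa using h
  -- Exchanging the first two slots fixes the first product, exchanges the other two and negates the
  -- Cayley form. Skewness of η then gives relations by comparing coefficients in `invBasis`.
  have rel01 : ∀ a b c e, C b a c e 0 = -C a b c e 0 ∧ C b a c e 1 = -C a b c e 2 ∧
      C b a c e 3 = C a b c e 3 := by
    intro a b c e
    have hs := sum_invBasis_eq_zero (c := ![C b a c e 0 + C a b c e 0, C b a c e 2 + C a b c e 1,
      C b a c e 1 + C a b c e 2, C a b c e 3 - C b a c e 3]) (by
        funext i j k l
        rw [sum_invBasis_apply]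
        have h := component4_swap01 d η a b c e i j k l
        rw [hval, hval, cayley_swap01, form_comm j i] at h
        simp only [Matrix.cons_val, Pi.zero_apply]
        linear_combination h)
    have s0 := congrFun hs 0
    have s2 := congrFun hs 2
    have s3 := congrFun hs 3
    simp only [Matrix.cons_val, Pi.zero_apply] at s0 s2 s3
    exact ⟨by linear_combination s0, by linear_combination s2, by linear_combination -s3⟩
  have rel12 : ∀ a b c e, C a c b e 1 = -C a b c e 0 ∧ C a c b e 3 = C a b c e 3 := by
    intro a b c e
    have hs := sum_invBasis_eq_zero (c := ![C a c b e 1 + C a b c e 0, C a c b e 0 + C a b c e 1,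
      C a c b e 2 + C a b c e 2, C a b c e 3 - C a c b e 3]) (by
        funext i j k l
        rw [sum_invBasis_apply]
        have h := component4_swap12 d η a b c e i j k l
        rw [hval, hval, cayley_swap12, form_comm k j] at h
        simp only [Matrix.cons_val, Pi.zero_apply]
        linear_combination h)
    have s0 := congrFun hs 0
    have s3 := congrFun hs 3
    simp only [Matrix.cons_val, Pi.zero_apply] at s0 s3
    exact ⟨by linear_combination s0, by linear_combination -s3⟩
  have rel23 : ∀ a b c e, C a b e c 0 = -C a b c e 0 ∧ C a b e c 3 = C a b c e 3 := by
    intro a b c e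
    have hs := sum_invBasis_eq_zero (c := ![C a b e c 0 + C a b c e 0, C a b e c 2 + C a b c e 1,
      C a b e c 1 + C a b c e 2, C a b c e 3 - C a b e c 3]) (by
        funext i j k l
        rw [sum_invBasis_apply]
        have h := component4_swap23 d η a b c e i j k l
        rw [hval, hval, cayley_swap23, form_comm l k] at h
        simp only [Matrix.cons_val, Pi.zero_apply]
        linear_combination h)
    have s0 := congrFun hs 0
    have s3 := congrFun hs 3
    simp only [Matrix.cons_val, Pi.zero_apply] at s0 s3
    exact ⟨by linear_combination s0, by linear_combination -s3⟩
  have h3 : C 0 1 0 1 3 = 0 := by rw [(rel12 0 0 1 1).2]; exact z _ _ _ _ (hz 2)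
  -- With ∅, univ and {0}, {1, 2} as the complementary pairs, only the first product survives, with
  -- value −1; `h3` has removed the Cayley term.
  have h5 : C 0 1 0 1 0 = 0 := by
    have h : component4 d η 0 1 0 1 ∅ Finset.univ {0} {1, 2} = 0 := hz 5
    rw [hval, h3, form_apply, form_apply, form_apply, form_apply, form_apply, form_apply,
      f2, f9, f7, f8] at h
    push_cast at h
    linear_combination -h
  have hC0 := eq_zero_of_swap_relations rel01 rel12 rel23 (z _ _ _ _ (hz 0)) (z _ _ _ _ (hz 1))
    (z _ _ _ _ (hz 2)) (z _ _ _ _ (hz 3)) (z _ _ _ _ (hz 4)) h5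
  refine AlternatingMap.coe_multilinearMap_injective
    (Module.Basis.ext_multilinear (fun _ => d) fun m => ?_)
  show η (fun i => d (m i)) = 0
  rw [basis_comp4]
  have h := hval (m 0).1 (m 1).1 (m 2).1 (m 3).1 (m 0).2 (m 1).2 (m 2).2 (m 3).2
  simp only [hC0, Pi.zero_apply, zero_mul, add_zero] at h
  exact h

theorem swap_four_of_adjacent {α : Type*} {F : α → α → α → α → ℂ}
    (h01 : ∀ a b c e, F b a c e = -F a b c e) (h12 : ∀ a b c e, F a c b e = -F a b c e)
    (h23 : ∀ a b c e, F a b e c = -F a b c e) (m : Fin 4 → α) (i j : Fin 4) (hij : i ≠ j) :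
    F ((m ∘ Equiv.swap i j) 0) ((m ∘ Equiv.swap i j) 1) ((m ∘ Equiv.swap i j) 2)
      ((m ∘ Equiv.swap i j) 3) = -F (m 0) (m 1) (m 2) (m 3) := by
  have h02 : ∀ a b c e, F c b a e = -F a b c e := fun a b c e => by
    rw [h01 b c a e, h12 b a c e, h01 a b c e]; simp
  have h13 : ∀ a b c e, F a e c b = -F a b c e := fun a b c e => by
    rw [h12 a c e b, h23 a c b e, h12 a b c e]; simp
  have h03 : ∀ a b c e, F e b c a = -F a b c e := fun a b c e => by
    rw [h01 b e c a, h13 b a c e, h01 a b c e]; simp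
  fin_cases i <;> fin_cases j <;> first | exact absurd rfl hij | skip
  exacts [h01 _ _ _ _, h02 _ _ _ _, h03 _ _ _ _, h01 _ _ _ _, h12 _ _ _ _, h13 _ _ _ _,
    h02 _ _ _ _, h12 _ _ _ _, h23 _ _ _ _, h03 _ _ _ _, h13 _ _ _ _, h23 _ _ _ _]

/-- Invariant alternating forms of degree four, on basis vectors. -/
noncomputable def quarticForm (g : ℕ → ℂ) (c : ℂ) (p q r s : Fin 2 × Wt) : ℂ :=
  g (p.1.val + q.1.val + r.1.val + s.1.val) * cayley p.2 q.2 r.2 s.2 +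
    c * (sympForm p q * sympForm r s - sympForm p r * sympForm q s + sympForm p s * sympForm q r)

theorem exists_quarticForm (d : Module.Basis (Fin 2 × Wt) ℂ M) (g : ℕ → ℂ) (c : ℂ) :
    ∃ η ∈ so7Forms d 4, ∀ a b c' e i j k l, component4 d η a b c' e i j k l =
      quarticForm g c (a, i) (b, j) (c', k) (e, l) := by
  obtain ⟨η, hη⟩ := exists_alternatingMap_of_basis d
    (fun m : Fin 4 → Fin 2 × Wt => quarticForm g c (m 0) (m 1) (m 2) (m 3)) (by
      intro m i j hij
      refine swap_four_of_adjacent ?_ ?_ ?_ m i j hij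
      · intro p q r s
        simp only [quarticForm, cayley_swap01 p.2 q.2 r.2 s.2, sympForm_swap p q,
          add_comm q.1.val p.1.val]
        ring
      · intro p q r s
        simp only [quarticForm, cayley_swap12 p.2 q.2 r.2 s.2, sympForm_swap q r,
          add_right_comm p.1.val r.1.val]
        ring
      · intro p q r s
        simp only [quarticForm, cayley_swap23 p.2 q.2 r.2 s.2, sympForm_swap r s,
          add_right_comm _ s.1.val]
        ring)
  have hcomp : ∀ a b c' e i j k l, component4 d η a b c' e i j k l =
      quarticForm g c (a, i) (b, j) (c', k) (e, l) := by
    intro a b c' e i j k l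
    have := hη ![(a, i), (b, j), (c', k), (e, l)]
    rw [basis_comp4] at this
    exact this
  refine ⟨η, (mem_so7Forms_four d).2 fun a b c' e => ?_, hcomp⟩
  have : component4 d η a b c' e = ∑ n, (![c * (sgn2 a b * sgn2 c' e), -c * (sgn2 a c' * sgn2 b e),
      c * (sgn2 a e * sgn2 b c'), g (a.val + b.val + c'.val + e.val)] : Fin 4 → ℂ) n •
        invBasis n := by
    funext i j k l
    rw [hcomp, sum_invBasis_apply]
    simp only [quarticForm, sympForm, Matrix.cons_val]
    ring
  rw [this]
  exact Submodule.sum_mem _ fun n _ => Submodule.smul_mem _ _ (invBasis_mem n)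

theorem cayley_value_empty_univ : cayleyInt ∅ Finset.univ {0} {1, 2} = -3 := by decide +kernel

theorem finrank_so7Forms_four (d : Module.Basis (Fin 2 × Wt) ℂ M) :
    Module.finrank ℂ (so7Forms d 4) = 6 := by
  have hbij : Function.Bijective (evalForm4 d ∘ₗ (so7Forms d 4).subtype) := by
    constructor
    · rw [← LinearMap.ker_eq_bot, LinearMap.ker_eq_bot']
      rintro ⟨η, hη⟩ h
      exact Subtype.ext (eq_zero_of_evalForm4 d hη h)
    · intro y
      let g : ℕ → ℂ := fun n => if n = 0 then y 0 / 6 else if n = 1 then y 1 / 6 else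
        if n = 2 then y 2 / 6 else if n = 3 then y 3 / 6 else y 4 / 6
      -- The Cayley form takes the value 6 at the quadruple behind the first five coordinates,
      -- whence the divisions in `g`. At the sixth it is −3, so that the sixth coordinate is −3 · (y
      -- 2 / 6) − c, and this is solved for c.
      obtain ⟨η, hη, hc⟩ := exists_quarticForm d g (-y 5 - y 2 / 2)
      obtain ⟨f1, f2, f3, f4, f5, f6, f7, f8, f9⟩ := form_values
      have g1 : form ∅ {0, 1} = 0 := by rw [form_apply, f5, Int.cast_zero]
      have g2 : form ∅ {0, 2} = 0 := by rw [form_apply, f6, Int.cast_zero]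
      have g3 : form ∅ {1, 2} = 0 := by rw [form_apply, f7, Int.cast_zero]
      have g4 : form ∅ {0} = 0 := by rw [form_apply, f8, Int.cast_zero]
      have g5 : form {0} {1, 2} = -1 := by rw [form_apply, f9]; norm_num
      have k1 : cayley ∅ {0, 1} {0, 2} {1, 2} = 6 := by
        rw [cayley_apply, cayley_values.1]; norm_num
      have k2 : cayley ∅ Finset.univ {0} {1, 2} = -3 := by
        rw [cayley_apply, cayley_value_empty_univ]; norm_num
      have hq : ∀ a b c e, component4 d η a b c e ∅ {0, 1} {0, 2} {1, 2} =
          g (a.val + b.val + c.val + e.val) * 6 := by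
        intro a b c e
        rw [hc]
        simp only [quarticForm, sympForm, g1, g2, g3, k1, mul_zero, zero_mul, sub_zero, add_zero]
      have hs : component4 d η 0 1 0 1 ∅ Finset.univ {0} {1, 2} = y 5 := by
        rw [hc]
        simp only [quarticForm, sympForm, g3, g4, g5, k2, form_empty_univ, sgn2]
        norm_num [g]
        ring
      refine ⟨⟨η, hη⟩, ?_⟩
      funext n
      fin_cases n
      · exact (hq 0 0 0 0).trans (by norm_num [g])
      · exact (hq 0 0 0 1).trans (by norm_num [g])
      · exact (hq 0 0 1 1).trans (by norm_num [g]; rfl)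
      · exact (hq 0 1 1 1).trans (by norm_num [g]; rfl)
      · exact (hq 1 1 1 1).trans (by norm_num [g]; rfl)
      · exact hs
  have h := (LinearEquiv.ofBijective _ hbij).finrank_eq
  simpa using h

end Spin7

/-! ### Descent from `ℂ` to `ℚ` -/

section Descent

variable {U κ : Type*} [AddCommGroup U] [Module ℂ U]

/-- A subspace that is stable under `ℚ`-linear maps acting on coordinates is spanned by its
rational vectors. -/
theorem mem_span_rational [Fintype κ] {c : U →ₗ[ℂ] (κ → ℂ)} (hc : Function.Injective c) {W : Submodule ℂ U}
    (hW : ∀ u ∈ W, ∀ f : ℂ →ₗ[ℚ] ℂ, ∃ u' ∈ W, ∀ j, c u' j = f (c u j)) {x : U} (hx : x ∈ W) :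
    x ∈ Submodule.span ℂ {u | u ∈ W ∧ ∀ j, ∃ q : ℚ, c u j = q} := by
  classical
  let B := Module.Basis.ofVectorSpace ℚ ℂ
  -- `y i` collects the `i`-th rational coordinates, in a ℚ-basis of ℂ, of all entries of `c x`.
  choose y hyW hy using fun i => hW x hx (Algebra.linearMap ℚ ℂ ∘ₗ B.coord i)
  let F : Finset _ := Finset.univ.biUnion fun j => (B.repr (c x j)).support
  have hsum : x = ∑ i ∈ F, (B i : ℂ) • y i := by
    refine hc (funext fun j => ?_)
    rw [map_sum, Finset.sum_apply]
    have h1 : ∀ i, c ((B i : ℂ) • y i) j = B.repr (c x j) i • B i := by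
      intro i
      rw [map_smul, Pi.smul_apply, hy, smul_eq_mul, mul_comm, Algebra.smul_def]
      rfl
    simp only [h1]
    rw [← Finset.sum_subset (Finset.subset_biUnion_of_mem
      (fun j => (B.repr (c x j)).support) (Finset.mem_univ j))]
    · exact (B.linearCombination_repr (c x j)).symm
    · intro i _ hi
      rw [Finsupp.notMem_support_iff.1 hi, zero_smul]
  rw [hsum]
  exact Submodule.sum_mem _ fun i _ => Submodule.smul_mem _ _
    (Submodule.subset_span ⟨hyW i, fun j => ⟨B.coord i (c x j), hy i j⟩⟩)

/-- Applying a ℚ-linear functional of ℂ to a complex relation between rational vectors gives a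
rational relation, and such functionals separate complex numbers. -/
theorem linearIndependent_of_rational [Module ℚ U] {I : Type*} {c : U →ₗ[ℂ] (κ → ℂ)}
    (hc : Function.Injective c) {w : I → U} (hw : ∀ i j, ∃ q : ℚ, c (w i) j = q)
    (hli : LinearIndependent ℚ w) : LinearIndependent ℂ w := by
  rw [linearIndependent_iff'] at hli ⊢
  intro s a ha i hi
  refine (Module.forall_dual_apply_eq_zero_iff ℚ (a i)).1 fun f => ?_
  refine hli s (fun i => f (a i)) ?_ i hi
  refine hc (funext fun j => ?_)
  have h1 := congrFun (congrArg c ha) j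
  choose q hq using hw
  have hQ : ∀ (r : ℚ) (u : U), c (r • u) = (r : ℂ) • c u := by
    intro r u
    have := map_rat_smul c.toAddMonoidHom r u
    simp only [LinearMap.toAddMonoidHom_coe] at this
    rw [this]
    ext j; simp [Rat.smul_def]
  simp only [map_sum, map_smul, Finset.sum_apply, Pi.smul_apply, hq, map_zero, Pi.zero_apply,
    smul_eq_mul, hQ] at h1 ⊢
  have h2 := congrArg f h1
  rw [map_sum, map_zero] at h2
  have h3 : ∀ i, f (a i * (q i j : ℂ)) = f (a i) * q i j := by
    intro i
    have : a i * (q i j : ℂ) = q i j • a i := by rw [Rat.smul_def, mul_comm]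
    rw [this, map_smul, smul_eq_mul, mul_comm]
  simp only [h3] at h2
  exact_mod_cast congrArg (fun r : ℚ => (r : ℂ)) h2

/-- A ℚ-basis of the rational vectors stays independent over ℂ, and stability of `W` makes it span
`W`. -/
theorem finrank_rational_eq [Fintype κ] [Module ℚ U] {c : U →ₗ[ℂ] (κ → ℂ)}
    (hc : Function.Injective c)
    {W : Submodule ℂ U}
    (hW : ∀ u ∈ W, ∀ f : ℂ →ₗ[ℚ] ℂ, ∃ u' ∈ W, ∀ j, c u' j = f (c u j))
    {R : Submodule ℚ U} (hR : ∀ u, u ∈ R ↔ u ∈ W ∧ ∀ j, ∃ q : ℚ, c u j = q) :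
    Module.finrank ℚ R = Module.finrank ℂ W := by
  let v := Module.Basis.ofVectorSpace ℚ R
  let w : _ → W := fun i => ⟨(v i : U), ((hR _).1 (v i).2).1⟩
  have hli : LinearIndependent ℚ fun i => (v i : U) :=
    v.linearIndependent.map' R.subtype (Submodule.ker_subtype R)
  have hliC : LinearIndependent ℂ fun i => (v i : U) :=
    linearIndependent_of_rational hc (fun i j => ((hR _).1 (v i).2).2 j) hli
  have hliW : LinearIndependent ℂ w := LinearIndependent.of_comp W.subtype hliC
  have hspan : ⊤ ≤ Submodule.span ℂ (Set.range w) := by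
    rintro ⟨x, hx⟩ -
    have h1 : x ∈ Submodule.span ℂ (Set.range fun i => (v i : U)) := by
      refine (Submodule.span_le.2 ?_) (mem_span_rational hc hW hx)
      intro u hu
      have h2 := v.mem_span ⟨u, (hR u).2 hu⟩
      have h3 := Submodule.mem_map_of_mem (f := R.subtype) h2
      rw [Submodule.map_span, ← Set.range_comp] at h3
      have h4 : ∀ y ∈ Submodule.span ℚ (Set.range (R.subtype ∘ v)),
          y ∈ Submodule.span ℂ (Set.range fun i => (v i : U)) := by
        intro y hy
        induction hy using Submodule.span_induction with
        | mem y hy => exact Submodule.subset_span hy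
        | zero => exact zero_mem _
        | add y z _ _ hy hz => exact add_mem hy hz
        | smul r y _ hy =>
          have : r • y = (r : ℂ) • y := (Rat.cast_smul_eq_qsmul ℂ r y).symm
          rw [this]
          exact Submodule.smul_mem _ _ hy
      exact h4 _ h3
    have h5 : (Set.range fun i => (v i : U)) = W.subtype '' Set.range w := by
      rw [← Set.range_comp]; rfl
    rw [h5, ← Submodule.map_span] at h1
    obtain ⟨z, hz, hzx⟩ := h1
    have : z = ⟨x, hx⟩ := Subtype.ext hzx
    rwa [← this]
  rw [Module.finrank_eq_nat_card_basis v,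
    Module.finrank_eq_nat_card_basis (Module.Basis.mk hliW hspan)]

end Descent

namespace ComplexAbelianVariety

variable {V : Type*} [NormedAddCommGroup V] [NormedSpace ℂ V]

/-! ### Coordinates on the cohomology -/

section Coordinates

variable {n : ℕ} (b : Module.Basis (Fin n) ℝ V)

/-- The basis of `H¹(A, ℂ)` dual to a real basis of `V`. -/
noncomputable def h1Basis : Module.Basis (Fin n) ℂ (H1 V) := Module.Basis.ofEquivFun (b.constr ℂ).symm

theorem h1Basis_repr (ω : H1 V) (i : Fin n) : (h1Basis b).repr ω i = ω (b i) := by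
  simp [h1Basis, Module.Basis.ofEquivFun_repr_apply]

theorem h1Basis_apply (i j : Fin n) : h1Basis b i (b j) = if i = j then 1 else 0 := by
  rw [← h1Basis_repr, Module.Basis.repr_self, Finsupp.single_apply]

theorem h1_eq_sum (ω : H1 V) : ω = ∑ i, ω (b i) • h1Basis b i := by
  conv_lhs => rw [← (h1Basis b).sum_repr ω]
  simp only [h1Basis_repr]

theorem end_apply_apply (X : Module.End ℂ (H1 V)) (ω : H1 V) (v : V) :
    X ω v = ∑ i, ∑ j, ω (b i) * (b.repr v j : ℂ) * X (h1Basis b i) (b j) := by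
  conv_lhs => rw [h1_eq_sum b ω, map_sum]
  rw [LinearMap.sum_apply]
  refine Finset.sum_congr rfl fun i _ => ?_
  rw [map_smul, LinearMap.smul_apply]
  conv_lhs => rw [← b.sum_repr v, map_sum, Finset.smul_sum]
  refine Finset.sum_congr rfl fun j _ => ?_
  rw [map_smul, smul_eq_mul, Complex.real_smul]
  ring

/-- Matrix coefficients of an endomorphism of `H¹(A, ℂ)`. -/
noncomputable def endCoord : Module.End ℂ (H1 V) →ₗ[ℂ] (Fin n × Fin n → ℂ) where
  toFun X p := X (h1Basis b p.1) (b p.2)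
  map_add' _ _ := rfl
  map_smul' _ _ := rfl

theorem endCoord_injective : Function.Injective (endCoord b) := by
  intro X Y h
  refine (h1Basis b).ext fun i => b.ext fun j => congrFun h (i, j)

theorem endCoord_surjective : Function.Surjective (endCoord b) := by
  intro x
  refine ⟨(h1Basis b).constr ℂ fun i => b.constr ℂ fun j => x (i, j), ?_⟩
  ext ⟨i, j⟩
  simp [endCoord]

end Coordinates

/-! ### The Lie algebra of the Hodge group and its rational structure. -/

/-- The complex structure, acting on `H¹(A, ℂ)` by pull-back. -/
noncomputable def hodgeDeriv (V : Type*) [NormedAddCommGroup V] [NormedSpace ℂ V] :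
    Module.End ℂ (H1 V) where
  toFun ω := ω ∘ₗ DistribSMul.toLinearMap ℝ V Complex.I
  map_add' _ _ := rfl
  map_smul' _ _ := rfl

theorem hodgeDeriv_apply (ω : H1 V) (v : V) : hodgeDeriv V ω v = ω (Complex.I • v) := rfl

theorem hodgeCircle_apply (z : Circle) (ω : H1 V) (v : V) :
    (hodgeCircle V z : Module.End ℂ (H1 V)) ω v = ω ((z : ℂ) • v) := rfl

theorem circle_exp_smul (t : ℝ) (v : V) :
    (Circle.exp t : ℂ) • v = Real.cos t • v + Real.sin t • (Complex.I • v) := by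
  rw [Circle.coe_exp, Complex.exp_mul_I, add_smul, mul_smul, ← Complex.ofReal_cos,
    ← Complex.ofReal_sin, Complex.coe_smul, Complex.coe_smul]

variable [FiniteDimensional ℂ V] (A : ComplexAbelianVariety V)

/-- A real basis of `V` that generates the lattice. -/
def IsLatticeBasis {n : ℕ} (b : Module.Basis (Fin n) ℝ V) : Prop :=
  Submodule.span ℤ (Set.range b) = A.lattice

theorem exists_isLatticeBasis : ∃ (n : ℕ) (b : Module.Basis (Fin n) ℝ V), A.IsLatticeBasis b := by
  have := A.discrete
  have : IsZLattice ℝ A.lattice := ⟨A.span_eq_top⟩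
  have : Module.Free ℤ A.lattice := ZLattice.module_free ℝ _
  have : Module.Finite ℤ A.lattice := ZLattice.module_finite ℝ _
  exact ⟨_, (Module.finBasis ℤ A.lattice).ofZLatticeBasis ℝ _,
    Module.Basis.ofZLatticeBasis_span ℝ _ _⟩

variable {A} {n : ℕ} {b : Module.Basis (Fin n) ℝ V}

theorem IsLatticeBasis.mem (hb : A.IsLatticeBasis b) (i : Fin n) : b i ∈ A.lattice := by
  rw [← hb]; exact Submodule.subset_span ⟨i, rfl⟩

theorem IsLatticeBasis.mem_iff (hb : A.IsLatticeBasis b) {v : V} :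
    v ∈ A.lattice ↔ ∀ i, ∃ N : ℤ, b.repr v i = N := by
  rw [← hb]
  simp only [Module.Basis.mem_span_iff_repr_mem]
  simp [Set.mem_range, eq_comm]

theorem IsLatticeBasis.mem_H1Rat_iff (hb : A.IsLatticeBasis b) {ω : H1 V} :
    ω ∈ A.H1Rat ↔ ∀ i, ∃ r : ℚ, ω (b i) = r := by
  refine ⟨fun h i => h _ (hb.mem i), fun h v hv => ?_⟩
  choose r hr using h
  choose N hN using hb.mem_iff.1 hv
  refine ⟨∑ i, N i * r i, ?_⟩
  conv_lhs => rw [← b.sum_repr v, map_sum]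
  push_cast
  refine Finset.sum_congr rfl fun i _ => ?_
  rw [map_smul, hr, hN]
  simp

theorem IsLatticeBasis.h1Basis_mem (hb : A.IsLatticeBasis b) (i : Fin n) : h1Basis b i ∈ A.H1Rat := by
  refine hb.mem_H1Rat_iff.2 fun j => ⟨if i = j then 1 else 0, ?_⟩
  rw [h1Basis_apply]; split_ifs <;> simp

/-- A rational polynomial on `End(H¹(A, ℂ))` has a rational differential at the identity, which
computes its derivatives along lines and along the circle. -/
theorem exists_differential (hb : A.IsLatticeBasis b) {F : Module.End ℂ (H1 V) → ℂ}
    (hF : F ∈ A.ratPolynomials) : ∃ q : Fin n × Fin n → ℚ, (∃ a : ℚ, F 1 = a) ∧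
      (∀ X, HasDerivAt (fun t : ℂ => F (1 + t • X)) (∑ p, (q p : ℂ) * endCoord b X p) 0) ∧
      HasDerivAt (fun t : ℝ => F (hodgeCircle V (Circle.exp t) : Module.End ℂ (H1 V)))
        (∑ p, (q p : ℂ) * endCoord b (hodgeDeriv V) p) 0 := by
  have hone : (hodgeCircle V (Circle.exp 0) : Module.End ℂ (H1 V)) = 1 := by simp
  induction hF using Algebra.adjoin_induction with
  | mem F hF =>
    obtain ⟨ω, hω, v, hv, rfl⟩ := hF
    choose r hr using hb.mem_H1Rat_iff.1 hω
    choose N hN using hb.mem_iff.1 hv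
    have hsum : ∀ X : Module.End ℂ (H1 V), ∑ p : Fin n × Fin n, ((r p.1 * N p.2 : ℚ) : ℂ) * endCoord b X p =
        X ω v := by
      intro X
      rw [end_apply_apply b X ω v, Fintype.sum_prod_type]
      refine Finset.sum_congr rfl fun i _ => Finset.sum_congr rfl fun j _ => ?_
      rw [hr, hN]
      push_cast; rfl
    refine ⟨fun p => r p.1 * N p.2, hω v hv, fun X => ?_, ?_⟩
    · rw [hsum]
      have : (fun t : ℂ => (1 + t • X) ω v) = fun t => ω v + t * X ω v := by
        ext t; simp
      rw [this]
      simpa using ((hasDerivAt_id (0 : ℂ)).mul_const (X ω v)).const_add (ω v)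
    · rw [hsum, hodgeDeriv_apply]
      have : (fun t : ℝ => (hodgeCircle V (Circle.exp t) : Module.End ℂ (H1 V)) ω v) =
          fun t => (Real.cos t : ℂ) * ω v + (Real.sin t : ℂ) * ω (Complex.I • v) := by
        ext t
        rw [hodgeCircle_apply, circle_exp_smul, map_add, map_smul, map_smul, Complex.real_smul,
          Complex.real_smul]
      rw [this]
      have hc : HasDerivAt (fun t : ℝ => (Real.cos t : ℂ) * ω v +
          (Real.sin t : ℂ) * ω (Complex.I • v)) _ 0 := ((Real.hasDerivAt_cos 0).ofReal_comp.mul_const (ω v)).add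
        ((Real.hasDerivAt_sin 0).ofReal_comp.mul_const (ω (Complex.I • v)))
      simpa using hc
  | algebraMap r =>
    refine ⟨0, ⟨r, by simp⟩, fun X => ?_, ?_⟩
    · simpa using hasDerivAt_const (0 : ℂ) ((r : ℂ))
    · simpa using hasDerivAt_const (0 : ℝ) ((r : ℂ))
  | add F G _ _ hF hG =>
    obtain ⟨q, ⟨a, ha⟩, h1, h2⟩ := hF
    obtain ⟨q', ⟨a', ha'⟩, h1', h2'⟩ := hG
    have hsum : ∀ X, ∑ p, (((q + q') p : ℚ) : ℂ) * endCoord b X p =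
        ∑ p, (q p : ℂ) * endCoord b X p + ∑ p, (q' p : ℂ) * endCoord b X p := by
      intro X
      simp [add_mul, Finset.sum_add_distrib]
    refine ⟨q + q', ⟨a + a', by simp [ha, ha']⟩, fun X => ?_, ?_⟩
    · rw [hsum]; exact (h1 X).add (h1' X)
    · rw [hsum]; exact h2.add h2'
  -- The Leibniz rule brings in `F 1` and `G 1`, which is why rationality of the value at the
  -- identity is part of the induction.
  | mul F G _ _ hF hG =>
    obtain ⟨q, ⟨a, ha⟩, h1, h2⟩ := hF
    obtain ⟨q', ⟨a', ha'⟩, h1', h2'⟩ := hG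
    have hsum : ∀ X, ∑ p, (((a' • q + a • q') p : ℚ) : ℂ) * endCoord b X p =
        (∑ p, (q p : ℂ) * endCoord b X p) * G 1 + F 1 * ∑ p, (q' p : ℂ) * endCoord b X p := by
      intro X
      rw [ha, ha', Finset.sum_mul, Finset.mul_sum, ← Finset.sum_add_distrib]
      refine Finset.sum_congr rfl fun p _ => ?_
      simp only [Pi.add_apply, Pi.smul_apply, smul_eq_mul]
      push_cast; ring
    refine ⟨a' • q + a • q', ⟨a * a', by simp [ha, ha']⟩, fun X => ?_, ?_⟩
    · rw [hsum]
      have := (h1 X).mul (h1' X)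
      simp only [zero_smul, add_zero] at this
      exact this
    · rw [hsum]
      have := h2.mul h2'
      simp only [hone] at this
      exact this

theorem hodgeCircle_mem_hodgeGroup (z : Circle) : hodgeCircle V z ∈ A.hodgeGroup :=
  Subgroup.mem_sInf.2 fun _ hG => hG.2 z

/-- The derivative of the Hodge circle lies in the Lie algebra of the Hodge group. -/
theorem hodgeDeriv_mem_hodgeLie : hodgeDeriv V ∈ A.hodgeLie := by
  obtain ⟨n, b, hb⟩ := A.exists_isLatticeBasis
  intro F hF h0
  obtain ⟨q, -, h1, h2⟩ := exists_differential hb hF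
  -- `F` vanishes along the circle, and its derivative there has the same formula as its line
  -- derivative in the direction `hodgeDeriv V`.
  have h3 : (fun t : ℝ => F (hodgeCircle V (Circle.exp t) : Module.End ℂ (H1 V))) = fun _ => 0 :=
    funext fun t => h0 _ (hodgeCircle_mem_hodgeGroup _)
  rw [h3] at h2
  have h4 := h2.unique (hasDerivAt_const (0 : ℝ) (0 : ℂ))
  have h5 : lineDeriv ℂ F 1 (hodgeDeriv V) = _ := (h1 (hodgeDeriv V)).deriv
  rw [h5, h4]

/-- The Lie algebra of the Hodge group, as a subspace of `End(H¹(A, ℂ))`. -/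
noncomputable def hodgeLieSubmodule (A : ComplexAbelianVariety V) :
    Submodule ℂ (Module.End ℂ (H1 V)) where
  carrier := A.hodgeLie
  zero_mem' F _ _ := lineDeriv_zero
  add_mem' {X Y} hX hY F hF h0 := by
    obtain ⟨n, b, hb⟩ := A.exists_isLatticeBasis
    obtain ⟨q, -, h1, -⟩ := exists_differential hb hF
    have hl : ∀ X, lineDeriv ℂ F 1 X = ∑ p, (q p : ℂ) * endCoord b X p := fun X => (h1 X).deriv
    have hx := hX F hF h0
    have hy := hY F hF h0
    rw [hl] at hx hy ⊢
    simp [mul_add, Finset.sum_add_distrib, hx, hy]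
  smul_mem' c X hX F hF h0 := by
    rw [lineDeriv_smul, hX F hF h0, smul_zero]

/-- The Lie algebra of the Hodge group is defined over `ℚ`. -/
theorem hodgeLie_stable (hb : A.IsLatticeBasis b) : ∀ X ∈ A.hodgeLieSubmodule, ∀ f : ℂ →ₗ[ℚ] ℂ,
    ∃ X' ∈ A.hodgeLieSubmodule, ∀ p, endCoord b X' p = f (endCoord b X p) := by
  intro X hX f
  obtain ⟨X', hX'⟩ := endCoord_surjective b fun p => f (endCoord b X p)
  refine ⟨X', fun F hF h0 => ?_, fun p => congrFun hX' p⟩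
  obtain ⟨q, -, h1, -⟩ := exists_differential hb hF
  have hl : ∀ X, lineDeriv ℂ F 1 X = ∑ p, (q p : ℂ) * endCoord b X p := fun X => (h1 X).deriv
  have hx := hX F hF h0
  rw [hl] at hx ⊢
  -- The equations of the Lie algebra have rational coefficients, so they survive a ℚ-linear map
  -- applied to the coordinates.
  have h2 := congrArg f hx
  rw [map_sum, map_zero] at h2
  rw [← h2]
  refine Finset.sum_congr rfl fun p _ => ?_
  rw [hX']
  simp only [← Rat.smul_def, map_smul]

/-- The rational elements of the Lie algebra of the Hodge group. -/
def ratLie (A : ComplexAbelianVariety V) (b : Module.Basis (Fin n) ℝ V) : Set (Module.End ℂ (H1 V)) :=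
  {X | X ∈ A.hodgeLieSubmodule ∧ ∀ p, ∃ q : ℚ, endCoord b X p = q}

theorem span_ratLie (hb : A.IsLatticeBasis b) :
    Submodule.span ℂ (ratLie A b) = A.hodgeLieSubmodule :=
  le_antisymm (Submodule.span_le.2 fun _ h => h.1) fun _ hX =>
    mem_span_rational (endCoord_injective b) (hodgeLie_stable hb) hX

end ComplexAbelianVariety

/-! ### Differentiation of multilinear forms. -/

/-- The derivative of a multilinear form along a curve `t ↦ a(t) d₀ + c(t) d₁`. -/
theorem MultilinearMap.hasDerivAt_combination {𝕜 N : Type*} [RCLike 𝕜] [NormedSpace 𝕜 ℂ]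
    [AddCommGroup N] [Module 𝕜 N] {k : ℕ} (μ : MultilinearMap 𝕜 (fun _ : Fin k => N) ℂ)
    (d d' : Fin k → N) {a c : 𝕜 → 𝕜} (ha0 : a 0 = 1) (hc0 : c 0 = 0) (ha : HasDerivAt a 0 0)
    (hc : HasDerivAt c 1 0) :
    HasDerivAt (fun t => μ fun i => a t • d i + c t • d' i)
      (∑ i, μ (Function.update d i (d' i))) 0 := by
  classical
  have hexp : (fun t => μ fun i => a t • d i + c t • d' i) = fun t => ∑ s : Finset (Fin k),
      (∏ i, if i ∈ s then a t else c t) • μ (s.piecewise d d') := by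
    funext t
    have h1 : (fun i => a t • d i + c t • d' i) = (fun i => a t • d i) + fun i => c t • d' i := rfl
    rw [h1, μ.map_add_univ]
    refine Finset.sum_congr rfl fun s _ => ?_
    rw [← μ.map_smul_univ]
    congr 1
    funext i
    by_cases hi : i ∈ s <;> simp [hi]
  -- A product with two or more factors `c` vanishes to second order at 0, and the product without
  -- such a factor has derivative 0; only subsets omitting exactly one index contribute.
  have hprod : ∀ s : Finset (Fin k), HasDerivAt (fun t => ∏ i, if i ∈ s then a t else c t)
      (∑ i, if s = Finset.univ.erase i then (1 : 𝕜) else 0) 0 := by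
    intro s
    have h := HasDerivAt.fun_finsetProd (u := Finset.univ) (x := (0 : 𝕜))
      (f := fun i t => if i ∈ s then a t else c t) (f' := fun i => if i ∈ s then 0 else 1)
      (fun i _ => by by_cases hi : i ∈ s <;> simp [hi, ha, hc])
    refine h.congr_deriv (Finset.sum_congr rfl fun i _ => ?_)
    symm
    simp only [ha0, hc0, smul_eq_mul]
    by_cases hs : s = Finset.univ.erase i
    · subst hs
      rw [if_pos rfl, if_neg (by simp), mul_one, eq_comm]
      exact Finset.prod_eq_one fun j hj => by rw [if_pos hj]
    · rw [if_neg hs]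
      by_cases hi : i ∈ s
      · simp [hi]
      · rw [if_neg hi, mul_one, eq_comm]
        by_contra hne
        refine hs (Finset.ext fun j => ?_)
        by_cases hji : j = i
        · subst hji; simp [hi]
        · have : j ∈ s := by
            by_contra hj
            exact hne (Finset.prod_eq_zero (Finset.mem_erase.2 ⟨hji, Finset.mem_univ j⟩) (by simp [hj]))
          simp [this, hji]
  rw [hexp]
  have h := HasDerivAt.fun_sum (u := Finset.univ) (x := (0 : 𝕜))
    (fun s _ => (hprod s).smul_const (μ (s.piecewise d d')))
  refine h.congr_deriv ?_
  simp only [Finset.sum_smul, ite_smul, one_smul, zero_smul]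
  rw [Finset.sum_comm]
  refine Finset.sum_congr rfl fun i _ => ?_
  rw [Finset.sum_ite_eq' Finset.univ (Finset.univ.erase i) (fun s => μ (s.piecewise d d')),
    if_pos (Finset.mem_univ _)]
  congr 1
  funext j
  by_cases hj : j = i
  · subst hj; simp
  · simp [hj]

namespace ComplexAbelianVariety

variable {V : Type*} [NormedAddCommGroup V] [NormedSpace ℂ V]

/-! ### Hodge classes as invariants -/

/-- Evaluation of classes in `H¹(A, ℂ)` at vectors of `V`. -/
noncomputable def evalDual (V : Type*) [NormedAddCommGroup V] [NormedSpace ℂ V] :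
    V →ₗ[ℝ] Module.Dual ℂ (H1 V) where
  toFun v := { toFun := fun ω => ω v, map_add' := fun _ _ => rfl, map_smul' := fun _ _ => rfl }
  map_add' v w := by ext ω; simp
  map_smul' c v := by ext ω; simp

theorem evalDual_apply (v : V) (ω : H1 V) : evalDual V v ω = ω v := rfl

/-- The complex basis of the dual of `H¹(A, ℂ)` that is given by a real basis of `V`. -/
noncomputable def homBasis {n : ℕ} (b : Module.Basis (Fin n) ℝ V) :
    Module.Basis (Fin n) ℂ (Module.Dual ℂ (H1 V)) := (h1Basis b).dualBasis

theorem homBasis_apply {n : ℕ} (b : Module.Basis (Fin n) ℝ V) (i : Fin n) :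
    homBasis b i = evalDual V (b i) := by
  ext ω
  rw [homBasis, Module.Basis.dualBasis_apply, h1Basis_repr, evalDual_apply]

/-- Restriction to `V` of an alternating form on the dual of `H¹(A, ℂ)`. -/
noncomputable def restrictForm (V : Type*) [NormedAddCommGroup V] [NormedSpace ℂ V] (k : ℕ) :
    (Module.Dual ℂ (H1 V) [⋀^Fin k]→ₗ[ℂ] ℂ) →ₗ[ℂ] H V k where
  toFun η :=
    { (η.toMultilinearMap.restrictScalars ℝ).compLinearMap fun _ => evalDual V with
      map_eq_zero_of_eq' := fun v _ _ hv hij =>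
        η.map_eq_zero_of_eq (fun i => evalDual V (v i)) (congrArg _ hv) hij }
  map_add' _ _ := rfl
  map_smul' _ _ := rfl

theorem restrictForm_apply {k : ℕ} (η : Module.Dual ℂ (H1 V) [⋀^Fin k]→ₗ[ℂ] ℂ) (v : Fin k → V) :
    restrictForm V k η v = η fun i => evalDual V (v i) := rfl

theorem restrictForm_basis {n k : ℕ} (b : Module.Basis (Fin n) ℝ V)
    (η : Module.Dual ℂ (H1 V) [⋀^Fin k]→ₗ[ℂ] ℂ) (m : Fin k → Fin n) :
    restrictForm V k η (fun i => b (m i)) = η fun i => homBasis b (m i) := by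
  simp only [homBasis_apply, restrictForm_apply]

/-- The dual of H¹(A, ℂ) is the complexification of `V`: a real basis of `V` becomes a complex basis
there, so forms extend uniquely. -/
theorem restrictForm_bijective {n : ℕ} (b : Module.Basis (Fin n) ℝ V) (k : ℕ) :
    Function.Bijective (restrictForm V k) := by
  constructor
  · intro η η' h
    refine AlternatingMap.coe_multilinearMap_injective
      (Module.Basis.ext_multilinear (fun _ => homBasis b) fun m => ?_)
    have := congrArg (fun ω => ω fun i => b (m i)) h
    simp only [restrictForm_basis] at this
    exact this
  · intro ω
    obtain ⟨η, hη⟩ := exists_alternatingMap_of_basis (homBasis b)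
      (fun m : Fin k → Fin n => ω fun i => b (m i)) fun m i j hij =>
        ω.map_swap (fun i => b (m i)) hij
    refine ⟨η, AlternatingMap.coe_multilinearMap_injective
      (Module.Basis.ext_multilinear (fun _ => b) fun m => ?_)⟩
    exact (restrictForm_basis b η m).trans (hη m)

variable {n : ℕ} {b : Module.Basis (Fin n) ℝ V} {k : ℕ}

/-- Composition with an endomorphism of `H¹(A, ℂ)`, in coordinates. -/
theorem homBasis_comp (X : Module.End ℂ (H1 V)) (j : Fin n) :
    (homBasis b j ∘ₗ X : Module.Dual ℂ (H1 V)) = ∑ l, X (h1Basis b l) (b j) • homBasis b l := by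
  refine (h1Basis b).ext fun l => ?_
  simp only [homBasis_apply, LinearMap.comp_apply, evalDual_apply, LinearMap.sum_apply,
    LinearMap.smul_apply, h1Basis_apply]
  simp

/-- The polynomial functions whose vanishing defines the stabilizer of a form. -/
noncomputable def stabPolynomial (b : Module.Basis (Fin n) ℝ V)
    (η : Module.Dual ℂ (H1 V) [⋀^Fin k]→ₗ[ℂ] ℂ) (m : Fin k → Fin n)
    (g : Module.End ℂ (H1 V)) : ℂ :=
  η (fun i => homBasis b (m i) ∘ₗ g) - η fun i => homBasis b (m i)

/-- The stabilizer of a form in `GL(H¹(A, ℂ))`. -/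
noncomputable def formStabilizer (η : Module.Dual ℂ (H1 V) [⋀^Fin k]→ₗ[ℂ] ℂ) :
    Subgroup (Module.End ℂ (H1 V))ˣ where
  carrier := {g | ∀ d : Fin k → Module.Dual ℂ (H1 V),
    η (fun i => d i ∘ₗ (g : Module.End ℂ (H1 V))) = η d}
  one_mem' _ := rfl
  mul_mem' {g h} hg hh d := (hh fun i => d i ∘ₗ (g : Module.End ℂ (H1 V))).trans (hg d)
  inv_mem' {g} hg d := by
    rw [← hg fun i => d i ∘ₗ ((g⁻¹ : (Module.End ℂ (H1 V))ˣ) : Module.End ℂ (H1 V))]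
    congr 1
    funext i
    rw [LinearMap.comp_assoc]
    show d i ∘ₗ (((g⁻¹ : (Module.End ℂ (H1 V))ˣ) : Module.End ℂ (H1 V)) *
      (g : Module.End ℂ (H1 V))) = _
    rw [Units.inv_mul]; rfl

theorem mem_formStabilizer_iff (b : Module.Basis (Fin n) ℝ V)
    {η : Module.Dual ℂ (H1 V) [⋀^Fin k]→ₗ[ℂ] ℂ} {g : (Module.End ℂ (H1 V))ˣ} :
    g ∈ formStabilizer η ↔ ∀ m, stabPolynomial b η m g = 0 := by
  refine ⟨fun h m => sub_eq_zero.2 (h _), fun h d => ?_⟩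
  have : (η : MultilinearMap ℂ (fun _ : Fin k => Module.Dual ℂ (H1 V)) ℂ).compLinearMap
      (fun _ => (g : Module.End ℂ (H1 V)).dualMap) = η :=
    Module.Basis.ext_multilinear (fun _ => homBasis b) fun m => sub_eq_zero.1 (h m)
  exact congrArg (fun f => f d) this

theorem evalDual_comp_hodgeCircle (z : Circle) (v : V) :
    (evalDual V v ∘ₗ (hodgeCircle V z : Module.End ℂ (H1 V)) : Module.Dual ℂ (H1 V)) =
      evalDual V ((z : ℂ) • v) := rfl

variable [FiniteDimensional ℂ V] {A : ComplexAbelianVariety V}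

theorem IsLatticeBasis.mem_HRat_iff (hb : A.IsLatticeBasis b) {ω : H V k} :
    ω ∈ A.HRat k ↔ ∀ m : Fin k → Fin n, ∃ q : ℚ, ω (fun i => b (m i)) = q := by
  refine ⟨fun h m => h _ fun i => hb.mem (m i), fun h v hv => ?_⟩
  choose q hq using h
  choose N hN using fun i => hb.mem_iff.1 (hv i)
  refine ⟨∑ r : Fin k → Fin n, (∏ i, (N i (r i) : ℚ)) * q r, ?_⟩
  have hv' : v = fun i => ∑ j, (N i j : ℝ) • b j := by
    funext i
    conv_lhs => rw [← b.sum_repr (v i)]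
    simp only [hN]
  have h1 := (ω : MultilinearMap ℝ (fun _ : Fin k => V) ℂ).map_sum
    (fun i j => (N i j : ℝ) • b j)
  rw [hv']
  refine h1.trans ?_
  push_cast
  refine Finset.sum_congr rfl fun r _ => ?_
  refine ((ω : MultilinearMap ℝ (fun _ : Fin k => V) ℂ).map_smul_univ _ _).trans ?_
  show (∏ i, (N i (r i) : ℝ)) • ω (fun i => b (r i)) = _
  rw [hq, Complex.real_smul]
  push_cast; rfl

theorem stabPolynomial_mem (hb : A.IsLatticeBasis b)
    {η : Module.Dual ℂ (H1 V) [⋀^Fin k]→ₗ[ℂ] ℂ}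
    (hη : ∀ m : Fin k → Fin n, ∃ q : ℚ, η (fun i => homBasis b (m i)) = q) (m : Fin k → Fin n) :
    stabPolynomial b η m ∈ A.ratPolynomials := by
  choose q hq using hη
  have h : stabPolynomial b η m = (∑ r : Fin k → Fin n, (∏ i,
      fun g : Module.End ℂ (H1 V) => g (h1Basis b (r i)) (b (m i))) *
        algebraMap ℚ (Module.End ℂ (H1 V) → ℂ) (q r)) -
      algebraMap ℚ (Module.End ℂ (H1 V) → ℂ) (q m) := by
    funext g
    have h1 := (η : MultilinearMap ℂ (fun _ : Fin k => Module.Dual ℂ (H1 V)) ℂ).map_sum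
      (fun i l => g (h1Basis b l) (b (m i)) • homBasis b l)
    rw [stabPolynomial, hq, Pi.sub_apply, Finset.sum_apply]
    congr 1
    simp only [homBasis_comp]
    refine h1.trans (Finset.sum_congr rfl fun r _ => ?_)
    rw [MultilinearMap.map_smul_univ, Pi.mul_apply, Finset.prod_apply]
    show _ • η (fun i => homBasis b (r i)) = _
    rw [hq]; rfl
  rw [h]
  refine sub_mem (sum_mem fun r _ => mul_mem (prod_mem fun i _ => ?_)
    (Subalgebra.algebraMap_mem _ _)) (Subalgebra.algebraMap_mem _ _)
  exact Algebra.subset_adjoin ⟨_, hb.h1Basis_mem _, _, hb.mem _, rfl⟩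

/-- The Lie algebra of the Hodge group, acting on the dual of `H¹(A, ℂ)`. -/
def dualLie (A : ComplexAbelianVariety V) : Set (Module.End ℂ (Module.Dual ℂ (H1 V))) :=
  {Y | ∃ X ∈ A.hodgeLieSubmodule, Y = X.dualMap}

/-- For a rational form the stabilizer is cut out by rational polynomials, so by minimality it
contains the Hodge group as soon as it contains the circle. Differentiating those polynomials at 1
yields the infinitesimal invariance. -/
theorem mem_invForms_of_stabilizer (hb : A.IsLatticeBasis b)
    {η : Module.Dual ℂ (H1 V) [⋀^Fin k]→ₗ[ℂ] ℂ}
    (hη : ∀ m : Fin k → Fin n, ∃ q : ℚ, η (fun i => homBasis b (m i)) = q)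
    (hz : ∀ z, hodgeCircle V z ∈ formStabilizer η) : η ∈ invForms k A.dualLie := by
  have hle : A.hodgeGroup ≤ formStabilizer η := by
    refine sInf_le ⟨⟨Set.range (stabPolynomial b η), ?_, fun g => ?_⟩, hz⟩
    · rintro _ ⟨m, rfl⟩
      exact stabPolynomial_mem hb hη m
    · rw [mem_formStabilizer_iff b]
      simp
  rw [mem_invForms_iff_basis (homBasis b)]
  rintro _ ⟨X, hX, rfl⟩ m
  have h0 : deriv (fun t : ℂ => stabPolynomial b η m (1 + t • X)) 0 = 0 :=
    hX _ (stabPolynomial_mem hb hη m) fun g hg => (mem_formStabilizer_iff b).1 (hle hg) m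
  have h1 := (η : MultilinearMap ℂ (fun _ : Fin k => Module.Dual ℂ (H1 V)) ℂ).hasDerivAt_combination
    (fun i => homBasis b (m i)) (fun i => homBasis b (m i) ∘ₗ X) (a := fun _ => 1) (c := id) rfl rfl
    (hasDerivAt_const _ _) (hasDerivAt_id _)
  have h2 : (fun t : ℂ => stabPolynomial b η m (1 + t • X)) = fun t =>
      (η : MultilinearMap ℂ (fun _ : Fin k => Module.Dual ℂ (H1 V)) ℂ)
        (fun i => (1 : ℂ) • homBasis b (m i) + id t • (homBasis b (m i) ∘ₗ X)) -
      η fun i => homBasis b (m i) := by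
    funext t
    rw [stabPolynomial]
    refine congrArg (fun d => η d - _) (funext fun i => LinearMap.ext fun ω => ?_)
    simp
  rw [h2, (h1.sub_const _).deriv] at h0
  exact h0

/-- The complex structure belongs to the Lie algebra, so the pull-back of the form along the circle
has derivative 0 at every point. -/
theorem restrictForm_circle {η : Module.Dual ℂ (H1 V) [⋀^Fin k]→ₗ[ℂ] ℂ}
    (hη : η ∈ invForms k A.dualLie) (t : ℝ) (v : Fin k → V) :
    restrictForm V k η (fun i => (Circle.exp t : ℂ) • v i) = restrictForm V k η v := by
  have hd0 : ∀ w : Fin k → V, HasDerivAt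
      (fun s : ℝ => restrictForm V k η fun i => (Circle.exp s : ℂ) • w i) 0 0 := by
    intro w
    have h1 := (restrictForm V k η : MultilinearMap ℝ (fun _ : Fin k => V) ℂ).hasDerivAt_combination
      w (fun i => Complex.I • w i) (a := Real.cos) (c := Real.sin) Real.cos_zero Real.sin_zero
      (by simpa using Real.hasDerivAt_cos 0) (by simpa using Real.hasDerivAt_sin 0)
    have h2 : ∑ i, restrictForm V k η (Function.update w i (Complex.I • w i)) = 0 := by
      have := hη _ ⟨hodgeDeriv V, hodgeDeriv_mem_hodgeLie, rfl⟩ fun i => evalDual V (w i)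
      rw [← this]
      refine Finset.sum_congr rfl fun i _ => ?_
      rw [restrictForm_apply]
      congr 1
      funext j
      by_cases hj : j = i
      · subst hj
        simp only [Function.update_self]; rfl
      · simp [hj]
    refine (h1.congr_deriv h2).congr_of_eventuallyEq (Filter.Eventually.of_forall fun s => ?_)
    simp only [circle_exp_smul]
    rfl
  have hd : ∀ t₀ : ℝ, HasDerivAt
      (fun s : ℝ => restrictForm V k η fun i => (Circle.exp s : ℂ) • v i) 0 t₀ := by
    intro t₀
    have h := hd0 fun i => (Circle.exp t₀ : ℂ) • v i
    rw [← sub_self t₀] at h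
    have h' := HasDerivAt.comp_sub_const t₀ t₀ h
    refine h'.congr_of_eventuallyEq (Filter.Eventually.of_forall fun s => ?_)
    simp only [smul_smul, ← Circle.coe_mul, ← Circle.exp_add, sub_add_cancel]
  have hconst := is_const_of_deriv_eq_zero (fun s => (hd s).differentiableAt)
    (fun s => (hd s).deriv) t 0
  simpa using hconst

/-- On type (p, p) the factor is |z|^{2p}, which is 1 on the circle. Rationality of the form turns
invariance under the circle into invariance under the whole Lie algebra. -/
theorem restrictForm_mem_hodgeClasses_iff (hb : A.IsLatticeBasis b) {p : ℕ}
    (η : Module.Dual ℂ (H1 V) [⋀^Fin (p + p)]→ₗ[ℂ] ℂ) :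
    restrictForm V (p + p) η ∈ A.hodgeClasses p ↔ η ∈ invForms (p + p) A.dualLie ∧
      ∀ m : Fin (p + p) → Fin n, ∃ q : ℚ, η (fun i => homBasis b (m i)) = q := by
  have hrat : restrictForm V (p + p) η ∈ A.HRat (p + p) ↔
      ∀ m : Fin (p + p) → Fin n, ∃ q : ℚ, η (fun i => homBasis b (m i)) = q := by
    rw [hb.mem_HRat_iff]
    simp only [restrictForm_basis]
  constructor
  · rintro ⟨h1, h2⟩
    refine ⟨mem_invForms_of_stabilizer hb (hrat.1 h1) fun z => ?_, hrat.1 h1⟩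
    rw [mem_formStabilizer_iff b]
    intro m
    rw [stabPolynomial, sub_eq_zero]
    simp only [homBasis_apply, evalDual_comp_hodgeCircle]
    have h3 := h2 z fun i => b (m i)
    rw [← mul_pow, Complex.mul_conj, Complex.normSq_eq_norm_sq] at h3
    simp only [Circle.norm_coe, one_pow, Complex.ofReal_one, one_mul] at h3
    exact h3
  · rintro ⟨h1, h2⟩
    refine ⟨hrat.2 h2, fun z v => ?_⟩
    -- Polar coordinates: the argument acts trivially, and real homogeneity of degree p + p supplies
    -- the factor |z|^{2p}.
    have hz : ∀ i, z • v i = ‖z‖ • ((Circle.exp z.arg : ℂ) • v i) := by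
      intro i
      rw [← Complex.coe_smul, smul_smul, Circle.coe_exp, Complex.norm_mul_exp_arg_mul_I]
    simp only [hz]
    have h3 := (restrictForm V (p + p) η : MultilinearMap ℝ (fun _ => V) ℂ).map_smul_univ
      (fun _ => ‖z‖) fun i => (Circle.exp z.arg : ℂ) • v i
    refine h3.trans ?_
    show (∏ i, ‖z‖) • restrictForm V (p + p) η (fun i => (Circle.exp z.arg : ℂ) • v i) = _
    rw [restrictForm_circle h1, ← mul_pow, Complex.mul_conj, Complex.normSq_eq_norm_sq,
      Complex.real_smul]
    congr 1
    simp only [Finset.prod_const, Finset.card_univ, Fintype.card_fin]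
    push_cast
    ring

end ComplexAbelianVariety

/-! ### Descent for Hodge classes. -/

namespace ComplexAbelianVariety

variable {V : Type*} [NormedAddCommGroup V] [NormedSpace ℂ V]
  {n : ℕ} {b : Module.Basis (Fin n) ℝ V} {k : ℕ}

/-- The values of an alternating form on the vectors of a basis. -/
noncomputable def formCoord (b : Module.Basis (Fin n) ℝ V) (k : ℕ) :
    H V k →ₗ[ℂ] ((Fin k → Fin n) → ℂ) where
  toFun ω m := ω fun i => b (m i)
  map_add' _ _ := rfl
  map_smul' _ _ := rfl

theorem formCoord_injective (b : Module.Basis (Fin n) ℝ V) (k : ℕ) :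
    Function.Injective (formCoord b k) := by
  intro ω ω' h
  exact AlternatingMap.coe_multilinearMap_injective
    (Module.Basis.ext_multilinear (fun _ => b) fun m => congrFun h m)

/-- Exhibits invariance under `X` as linear equations in the coordinates of η whose coefficients are
matrix entries of `X`, hence rational for rational `X`. -/
theorem sum_update_dualMap (η : Module.Dual ℂ (H1 V) [⋀^Fin k]→ₗ[ℂ] ℂ)
    (X : Module.End ℂ (H1 V)) (m : Fin k → Fin n) :
    ∑ i, η (Function.update (fun j => homBasis b (m j)) i (X.dualMap (homBasis b (m i)))) =
      ∑ i, ∑ l, endCoord b X (l, m i) * η fun j => homBasis b (Function.update m i l j) := by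
  refine Finset.sum_congr rfl fun i _ => ?_
  have h : X.dualMap (homBasis b (m i)) = ∑ l, X (h1Basis b l) (b (m i)) • homBasis b l :=
    homBasis_comp X (m i)
  rw [h, AlternatingMap.map_update_sum]
  refine Finset.sum_congr rfl fun l _ => ?_
  rw [AlternatingMap.map_update_smul, smul_eq_mul]
  congr 2
  funext j
  by_cases hj : j = i
  · subst hj; simp
  · simp [hj]

/-! ### The spin structure -/

/-- Coordinates on two copies of the spinors. -/
noncomputable def spinorPairEquiv :
    (Spin7.Spinor × Spin7.Spinor) ≃ₗ[ℂ] (Fin 2 × Spin7.Wt → ℂ) where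
  toFun s p := if p.1 = 0 then s.1 p.2 else s.2 p.2
  invFun x := (fun I => x (0, I), fun I => x (1, I))
  map_add' s t := by ext p; by_cases h : p.1 = 0 <;> simp [h]
  map_smul' c s := by ext p; by_cases h : p.1 = 0 <;> simp [h]
  left_inv s := by simp
  right_inv x := by
    ext ⟨a, I⟩
    fin_cases a <;> simp

/-- The basis of the dual of `H¹(A, ℂ)` that is given by an isomorphism with two copies of the
spinors. -/
noncomputable def spinBasis (e : H1 V ≃ₗ[ℂ] Spin7.Spinor × Spin7.Spinor) :
    Module.Basis (Fin 2 × Spin7.Wt) ℂ (Module.Dual ℂ (H1 V)) :=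
  (Module.Basis.ofEquivFun (e.trans spinorPairEquiv)).dualBasis

theorem spinBasis_apply (e : H1 V ≃ₗ[ℂ] Spin7.Spinor × Spin7.Spinor) (p : Fin 2 × Spin7.Wt)
    (ω : H1 V) : spinBasis e p ω = if p.1 = 0 then (e ω).1 p.2 else (e ω).2 p.2 := by
  rw [spinBasis, Module.Basis.dualBasis_apply, Module.Basis.ofEquivFun_repr_apply]
  rfl

theorem dualMap_eq_doubleAct (e : H1 V ≃ₗ[ℂ] Spin7.Spinor × Spin7.Spinor)
    {X : Module.End ℂ (H1 V)} {x : Spin7.so7}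
    (hX : ∀ ω, e (X ω) = (Spin7.spin x (e ω).1, Spin7.spin x (e ω).2)) :
    X.dualMap = Spin7.doubleAct (spinBasis e) (Spin7.spinMatrix x) := by
  refine (spinBasis e).ext fun p => ?_
  rw [Spin7.doubleAct_basis]
  ext ω
  rw [LinearMap.dualMap_apply, spinBasis_apply, hX, LinearMap.sum_apply]
  simp only [LinearMap.smul_apply, spinBasis_apply, smul_eq_mul]
  by_cases h : p.1 = 0
  · simp only [h, if_true, Spin7.spin, Matrix.toLin'_apply, Matrix.mulVec, dotProduct]
  · simp only [h, if_false, Spin7.spin, Matrix.toLin'_apply, Matrix.mulVec, dotProduct]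

variable [FiniteDimensional ℂ V] {A : ComplexAbelianVariety V}

theorem invForms_dualLie (hb : A.IsLatticeBasis b) :
    invForms k A.dualLie = invForms k ((fun X => X.dualMap) '' ratLie A b) := by
  refine le_antisymm ?_ ?_
  · rintro η h _ ⟨X, hX, rfl⟩
    exact h _ ⟨X, hX.1, rfl⟩
  · rw [← invForms_span]
    rintro η h _ ⟨X, hX, rfl⟩
    refine h _ ?_
    rw [← span_ratLie hb] at hX
    have := Submodule.mem_map_of_mem (f := Module.Dual.transpose (R := ℂ) (M := H1 V)
      (M' := H1 V)) hX
    rwa [Submodule.map_span] at this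

/-- Since the Lie algebra is spanned by rational endomorphisms, its invariants solve a rational
linear system and are stable under coordinatewise ℚ-linear maps. -/
theorem finrank_hodgeClasses (A : ComplexAbelianVariety V) (p : ℕ) :
    Module.finrank ℚ (A.hodgeClasses p) = Module.finrank ℂ (invForms (p + p) A.dualLie) := by
  obtain ⟨n, b, hb⟩ := A.exists_isLatticeBasis
  have hbij := restrictForm_bijective b (p + p)
  rw [(Submodule.equivMapOfInjective _ hbij.1 (invForms (p + p) A.dualLie)).finrank_eq]
  refine finrank_rational_eq (formCoord_injective b (p + p)) ?_ ?_
  · rintro _ ⟨η, hη, rfl⟩ f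
    obtain ⟨η', hη'⟩ := exists_alternatingMap_of_basis (homBasis b)
      (fun m : Fin (p + p) → Fin n => f (η fun i => homBasis b (m i))) fun m i j hij => by
        rw [← map_neg, ← η.map_swap (fun i => homBasis b (m i)) hij]; rfl
    refine ⟨restrictForm V (p + p) η', ⟨η', ?_, rfl⟩, fun m => ?_⟩
    · rw [SetLike.mem_coe, invForms_dualLie hb, mem_invForms_iff_basis (homBasis b)]
      rintro _ ⟨X, hX, rfl⟩ m
      have h0 := hη _ ⟨X, hX.1, rfl⟩ fun i => homBasis b (m i)
      rw [sum_update_dualMap] at h0 ⊢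
      have h1 := congrArg f h0
      rw [map_zero, map_sum] at h1
      rw [← h1]
      refine Finset.sum_congr rfl fun i _ => ?_
      rw [map_sum]
      refine Finset.sum_congr rfl fun l _ => ?_
      obtain ⟨q, hq⟩ := hX.2 (l, m i)
      rw [hη', hq, ← Rat.smul_def, ← Rat.smul_def, map_smul]
    · show restrictForm V (p + p) η' (fun i => b (m i)) =
        f (restrictForm V (p + p) η fun i => b (m i))
      rw [restrictForm_basis, restrictForm_basis, hη']
  · intro ω
    obtain ⟨η, rfl⟩ := hbij.2 ω
    rw [restrictForm_mem_hodgeClasses_iff hb]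
    refine and_congr ?_ (forall_congr' fun m => ?_)
    · exact (Function.Injective.mem_set_image hbij.1).symm
    · rw [← restrictForm_basis]; rfl

theorem dualLie_eq (e : H1 V ≃ₗ[ℂ] Spin7.Spinor × Spin7.Spinor)
    (he : A.hodgeLie = {X | ∃ x : Spin7.so7, ∀ ω,
        e (X ω) = (Spin7.spin x (e ω).1, Spin7.spin x (e ω).2)}) :
    A.dualLie = Set.range fun x : Spin7.so7 =>
      Spin7.doubleAct (spinBasis e) (Spin7.spinMatrix x) := by
  have hmem : ∀ X, X ∈ A.hodgeLieSubmodule ↔ ∃ x : Spin7.so7, ∀ ω,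
      e (X ω) = (Spin7.spin x (e ω).1, Spin7.spin x (e ω).2) := fun X => Set.ext_iff.1 he X
  ext Y
  constructor
  · rintro ⟨X, hX, rfl⟩
    obtain ⟨x, hx⟩ := (hmem X).1 hX
    exact ⟨x, (dualMap_eq_doubleAct e hx).symm⟩
  · rintro ⟨x, rfl⟩
    have hx : ∀ ω, e ((e.symm.toLinearMap ∘ₗ (Spin7.spin x).prodMap (Spin7.spin x) ∘ₗ
        e.toLinearMap) ω) = (Spin7.spin x (e ω).1, Spin7.spin x (e ω).2) := by
      intro ω; simp
    exact ⟨_, (hmem _).2 ⟨x, hx⟩, (dualMap_eq_doubleAct e hx).symm⟩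

end ComplexAbelianVariety

/-! ### Schur's lemma and the commutant of the Lie algebra. -/

namespace Spin7

/-- Schur's lemma for the spin representation. -/
theorem eq_smul_of_commute_spin {Y : Module.End ℂ Spinor}
    (hY : ∀ x : so7, spin x * Y = Y * spin x) : ∃ c : ℂ, Y = c • 1 := by
  set y := LinearMap.toMatrix' Y with hy
  have hYy : Y = Matrix.toLin' y := by rw [hy, Matrix.toLin'_toMatrix']
  have hcomm : ∀ r ∈ roots, pauli r * y = y * pauli r := by
    intro r hr
    obtain ⟨x, hx⟩ := exists_spinMatrix_eq_pauli hr
    have h := congrArg LinearMap.toMatrix' (hY x)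
    rw [LinearMap.toMatrix'_mul, LinearMap.toMatrix'_mul, spin, LinearMap.toMatrix'_toLin', hx] at h
    exact h
  -- An operator commuting with so(7), multiplied by `form`, is again an invariant bilinear form;
  -- uniqueness of that form makes the operator scalar.
  obtain ⟨c, hc⟩ := eq_smul_form_of_invariant (t := y * form) fun r hr => by
    rw [← Matrix.mul_assoc, hcomm r hr, Matrix.mul_assoc, Matrix.mul_assoc, ← Matrix.mul_add,
      pauli_mul_form hr, Matrix.mul_zero]
  refine ⟨c, ?_⟩
  have h1 : form * form.transpose = 1 := mul_eq_one_comm.1 form_transpose_mul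
  have h2 : y = c • 1 := by
    calc y = y * form * form.transpose := by rw [Matrix.mul_assoc, h1, Matrix.mul_one]
      _ = c • 1 := by rw [hc, Matrix.smul_mul, h1]
  rw [hYy, h2, map_smul, Matrix.toLin'_one]
  rfl

end Spin7

namespace ComplexAbelianVariety

variable {V : Type*} [NormedAddCommGroup V] [NormedSpace ℂ V]
  {n : ℕ} {b : Module.Basis (Fin n) ℝ V}

theorem endCoord_mul (X Y : Module.End ℂ (H1 V))
    (p : Fin n × Fin n) :
    endCoord b (X * Y) p = ∑ l, endCoord b Y (p.1, l) * endCoord b X (l, p.2) := by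
  show X (Y (h1Basis b p.1)) (b p.2) = _
  rw [h1_eq_sum b (Y (h1Basis b p.1)), map_sum, LinearMap.sum_apply]
  simp only [map_smul, LinearMap.smul_apply, smul_eq_mul]
  rfl

/-- A matrix acting on two copies of the spinors. -/
noncomputable def blockAct (e : H1 V ≃ₗ[ℂ] Spin7.Spinor × Spin7.Spinor) :
    (Fin 4 → ℂ) →ₗ[ℂ] Module.End ℂ (H1 V) where
  toFun c :=
    { toFun := fun ω => e.symm (c 0 • (e ω).1 + c 1 • (e ω).2, c 2 • (e ω).1 + c 3 • (e ω).2)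
      map_add' := fun ω ω' => by
        rw [← map_add]; congr 1
        ext <;> simp <;> ring
      map_smul' := fun a ω => by
        rw [RingHom.id_apply, ← map_smul]; congr 1
        ext <;> simp <;> ring }
  map_add' c c' := by
    ext1 ω
    simp only [LinearMap.coe_mk, AddHom.coe_mk, LinearMap.add_apply]
    rw [← map_add]; congr 1
    ext <;> simp <;> ring
  map_smul' a c := by
    ext1 ω
    simp only [LinearMap.coe_mk, AddHom.coe_mk, LinearMap.smul_apply, RingHom.id_apply]
    rw [← map_smul]; congr 1
    ext <;> simp <;> ring

theorem blockAct_apply (e : H1 V ≃ₗ[ℂ] Spin7.Spinor × Spin7.Spinor) (c : Fin 4 → ℂ) (ω : H1 V) :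
    e (blockAct e c ω) = (c 0 • (e ω).1 + c 1 • (e ω).2, c 2 • (e ω).1 + c 3 • (e ω).2) :=
  e.apply_symm_apply _

variable [FiniteDimensional ℂ V]

/-- The commutant of the Lie algebra of the Hodge group. -/
noncomputable def commutant (A : ComplexAbelianVariety V) : Submodule ℂ (Module.End ℂ (H1 V)) where
  carrier := {Z | ∀ X ∈ A.hodgeLieSubmodule, X * Z = Z * X}
  zero_mem' := by simp
  add_mem' {Y Z} hY hZ X hX := by rw [mul_add, add_mul, hY X hX, hZ X hX]
  smul_mem' c Z hZ X hX := by rw [mul_smul_comm, smul_mul_assoc, hZ X hX]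

variable {A : ComplexAbelianVariety V}

theorem mem_commutant_iff (hb : A.IsLatticeBasis b) {Z : Module.End ℂ (H1 V)} :
    Z ∈ A.commutant ↔ ∀ X ∈ ratLie A b, X * Z = Z * X := by
  refine ⟨fun h X hX => h X hX.1, fun h X hX => ?_⟩
  rw [← span_ratLie hb] at hX
  induction hX using Submodule.span_induction with
  | mem X hX => exact h X hX
  | zero => simp
  | add X Y _ _ hX hY => rw [add_mul, mul_add, hX, hY]
  | smul c X _ hX => rw [smul_mul_assoc, mul_smul_comm, hX]

theorem commutant_stable (hb : A.IsLatticeBasis b) : ∀ Z ∈ A.commutant, ∀ f : ℂ →ₗ[ℚ] ℂ,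
    ∃ Z' ∈ A.commutant, ∀ p, endCoord b Z' p = f (endCoord b Z p) := by
  intro Z hZ f
  obtain ⟨Z', hZ'⟩ := endCoord_surjective b fun p => f (endCoord b Z p)
  refine ⟨Z', (mem_commutant_iff hb).2 fun X hX => ?_, fun p => congrFun hZ' p⟩
  refine endCoord_injective b (funext fun p => ?_)
  have h := congrArg f (congrFun (congrArg (endCoord b) (hZ X hX.1)) p)
  choose q hq using hX.2
  rw [endCoord_mul, endCoord_mul, map_sum, map_sum] at h
  rw [endCoord_mul, endCoord_mul]
  simp only [hZ', hq] at h ⊢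
  simp only [mul_comm _ ((q _ : ℚ) : ℂ), ← Rat.smul_def, map_smul] at h ⊢
  exact h

/-- The rational elements of the commutant of the Lie algebra of the Hodge group. -/
noncomputable def ratCommutant (A : ComplexAbelianVariety V) (b : Module.Basis (Fin n) ℝ V) :
    Submodule ℚ (Module.End ℂ (H1 V)) where
  carrier := {Z | Z ∈ A.commutant ∧ ∀ p, ∃ q : ℚ, endCoord b Z p = q}
  zero_mem' := ⟨zero_mem _, fun p => ⟨0, by simp⟩⟩
  add_mem' {Y Z} hY hZ := ⟨add_mem hY.1 hZ.1, fun p => by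
    obtain ⟨q, hq⟩ := hY.2 p
    obtain ⟨r, hr⟩ := hZ.2 p
    exact ⟨q + r, by simp [hq, hr]⟩⟩
  smul_mem' c Z hZ := by
    have hc : c • Z = (c : ℂ) • Z := (Rat.cast_smul_eq_qsmul ℂ c Z).symm
    refine ⟨by rw [hc]; exact Submodule.smul_mem _ _ hZ.1, fun p => ?_⟩
    obtain ⟨q, hq⟩ := hZ.2 p
    exact ⟨c * q, by rw [hc]; simp [hq]⟩

theorem finrank_ratCommutant (hb : A.IsLatticeBasis b) :
    Module.finrank ℚ (ratCommutant A b) = Module.finrank ℂ A.commutant :=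
  finrank_rational_eq (endCoord_injective b) (commutant_stable hb) fun _ => Iff.rfl

/-- Each of the four blocks of a commuting endomorphism commutes with the spin representation, hence
is scalar, and all choices of the four scalars occur. -/
theorem finrank_commutant (e : H1 V ≃ₗ[ℂ] Spin7.Spinor × Spin7.Spinor)
    (he : A.hodgeLie = {X | ∃ x : Spin7.so7, ∀ ω,
        e (X ω) = (Spin7.spin x (e ω).1, Spin7.spin x (e ω).2)}) :
    Module.finrank ℂ A.commutant = 4 := by
  have hmem : ∀ X, X ∈ A.hodgeLieSubmodule ↔ ∃ x : Spin7.so7, ∀ ω,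
      e (X ω) = (Spin7.spin x (e ω).1, Spin7.spin x (e ω).2) := fun X => Set.ext_iff.1 he X
  have hrange : LinearMap.range (blockAct e) = A.commutant := by
    refine le_antisymm ?_ fun Z hZ => ?_
    · rintro _ ⟨c, rfl⟩ X hX
      obtain ⟨x, hx⟩ := (hmem X).1 hX
      refine LinearMap.ext fun ω => e.injective ?_
      simp only [Module.End.mul_apply]
      rw [hx, blockAct_apply, blockAct_apply, hx]
      simp
    · let Zt : Module.End ℂ (Spin7.Spinor × Spin7.Spinor) :=
        e.toLinearMap ∘ₗ Z ∘ₗ e.symm.toLinearMap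
      have hZt : ∀ (x : Spin7.so7) (s : Spin7.Spinor × Spin7.Spinor),
          Zt (Spin7.spin x s.1, Spin7.spin x s.2) =
            (Spin7.spin x (Zt s).1, Spin7.spin x (Zt s).2) := by
        intro x s
        let X : Module.End ℂ (H1 V) := e.symm.toLinearMap ∘ₗ
          (Spin7.spin x).prodMap (Spin7.spin x) ∘ₗ e.toLinearMap
        have hx : ∀ ω, e (X ω) = (Spin7.spin x (e ω).1, Spin7.spin x (e ω).2) := by
          intro ω; simp [X]
        have h := congrArg (fun Y => e (Y (e.symm s))) (hZ X ((hmem X).2 ⟨x, hx⟩))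
        simp only [Module.End.mul_apply, hx] at h
        have hXs : X (e.symm s) = e.symm (Spin7.spin x s.1, Spin7.spin x s.2) := by
          apply e.injective; rw [hx]; simp
        rw [hXs] at h
        exact h.symm
      have hblock : ∀ (L : (Spin7.Spinor × Spin7.Spinor) →ₗ[ℂ] Spin7.Spinor)
          (R : Spin7.Spinor →ₗ[ℂ] (Spin7.Spinor × Spin7.Spinor)),
          (∀ x s, L (Spin7.spin x s.1, Spin7.spin x s.2) = Spin7.spin x (L s)) →
          (∀ x s, R (Spin7.spin x s) = (Spin7.spin x (R s).1, Spin7.spin x (R s).2)) →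
          ∃ c : ℂ, L ∘ₗ Zt ∘ₗ R = c • 1 := by
        intro L R hL hR
        refine Spin7.eq_smul_of_commute_spin fun x => LinearMap.ext fun s => ?_
        simp only [Module.End.mul_apply, LinearMap.comp_apply]
        rw [hR, hZt, hL]
      have hfst : ∀ (x : Spin7.so7) (s : Spin7.Spinor × Spin7.Spinor), LinearMap.fst ℂ _ _
          (Spin7.spin x s.1, Spin7.spin x s.2) = Spin7.spin x (LinearMap.fst ℂ _ _ s) :=
        fun _ _ => rfl
      have hsnd : ∀ (x : Spin7.so7) (s : Spin7.Spinor × Spin7.Spinor), LinearMap.snd ℂ _ _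
          (Spin7.spin x s.1, Spin7.spin x s.2) = Spin7.spin x (LinearMap.snd ℂ _ _ s) :=
        fun _ _ => rfl
      obtain ⟨c0, h0⟩ := hblock (LinearMap.fst ℂ _ _) (LinearMap.inl ℂ _ _) hfst (by simp)
      obtain ⟨c1, h1⟩ := hblock (LinearMap.fst ℂ _ _) (LinearMap.inr ℂ _ _) hfst (by simp)
      obtain ⟨c2, h2⟩ := hblock (LinearMap.snd ℂ _ _) (LinearMap.inl ℂ _ _) hsnd (by simp)
      obtain ⟨c3, h3⟩ := hblock (LinearMap.snd ℂ _ _) (LinearMap.inr ℂ _ _) hsnd (by simp)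
      refine ⟨![c0, c1, c2, c3], LinearMap.ext fun ω => e.injective ?_⟩
      rw [blockAct_apply]
      have hω : e (Z ω) = Zt ((e ω).1, 0) + Zt (0, (e ω).2) := by
        rw [← map_add]; simp [Zt]
      have k0 := LinearMap.congr_fun h0 (e ω).1
      have k1 := LinearMap.congr_fun h1 (e ω).2
      have k2 := LinearMap.congr_fun h2 (e ω).1
      have k3 := LinearMap.congr_fun h3 (e ω).2
      simp only [LinearMap.comp_apply, LinearMap.fst_apply, LinearMap.snd_apply,
        LinearMap.inl_apply, LinearMap.inr_apply, LinearMap.smul_apply, Module.End.one_apply]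
        at k0 k1 k2 k3
      rw [hω, Prod.ext_iff]
      simp [k0, k1, k2, k3]
  have hinj : Function.Injective (blockAct e) := by
    rw [← LinearMap.ker_eq_bot, LinearMap.ker_eq_bot']
    intro c hc
    have h1 := blockAct_apply e c (e.symm (fun _ => 1, 0))
    have h2 := blockAct_apply e c (e.symm (0, fun _ => 1))
    rw [hc] at h1 h2
    simp only [LinearMap.zero_apply, map_zero, LinearEquiv.apply_symm_apply, Prod.ext_iff] at h1 h2
    have a0 := congrFun h1.1 ∅
    have a2 := congrFun h1.2 ∅
    have a1 := congrFun h2.1 ∅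
    have a3 := congrFun h2.2 ∅
    simp at a0 a1 a2 a3
    ext i
    fin_cases i
    · exact a0.symm
    · exact a1.symm
    · exact a2.symm
    · exact a3.symm
  rw [← hrange, LinearMap.finrank_range_of_inj hinj]
  simp

end ComplexAbelianVariety

namespace ComplexAbelianVariety

variable {V : Type*} [NormedAddCommGroup V] [NormedSpace ℂ V]

/-- Pull-back of classes in `H¹(A, ℂ)` along a linear endomorphism of `V`. -/
noncomputable def pullback (T : V →ₗ[ℂ] V) : Module.End ℂ (H1 V) where
  toFun ω := ω ∘ₗ T.restrictScalars ℝ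
  map_add' _ _ := rfl
  map_smul' _ _ := rfl

theorem pullback_apply (T : V →ₗ[ℂ] V) (ω : H1 V) (v : V) : pullback T ω v = ω (T v) := rfl

/-- The elements of `GL(H¹(A, ℂ))` that commute with a given endomorphism. -/
noncomputable def unitCentralizer (Z : Module.End ℂ (H1 V)) :
    Subgroup (Module.End ℂ (H1 V))ˣ where
  carrier := {g | Commute (g : Module.End ℂ (H1 V)) Z}
  one_mem' := Commute.one_left Z
  mul_mem' hg hh := Commute.mul_left hg hh
  inv_mem' hg := Commute.units_inv_left hg

variable [FiniteDimensional ℂ V] {A : ComplexAbelianVariety V}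

/-! ### Endomorphisms of the lattice -/

/-- Commuting with the pull-back is a condition on `g` given by rational polynomials, because `T`
preserves the lattice. It holds on the circle, because `T` is complex linear, hence on the Hodge
group. -/
theorem pullback_mem_commutant {T : V →ₗ[ℂ] V} (hT : ∀ v ∈ A.lattice, T v ∈ A.lattice) :
    pullback T ∈ A.commutant := by
  obtain ⟨n, b, hb⟩ := A.exists_isLatticeBasis
  let F : Fin n × Fin n → Module.End ℂ (H1 V) → ℂ := fun p g =>
    g (pullback T (h1Basis b p.1)) (b p.2) - g (h1Basis b p.1) (T (b p.2))
  have hF : ∀ p, F p ∈ A.ratPolynomials := by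
    intro p
    refine sub_mem (Algebra.subset_adjoin ⟨_, ?_, _, hb.mem _, rfl⟩)
      (Algebra.subset_adjoin ⟨_, hb.h1Basis_mem _, _, hT _ (hb.mem _), rfl⟩)
    exact fun v hv => hb.h1Basis_mem p.1 _ (hT v hv)
  have hzero : ∀ g : Module.End ℂ (H1 V), (∀ p, F p g = 0) ↔ Commute g (pullback T) := by
    intro g
    constructor
    · intro h
      exact (h1Basis b).ext fun i => b.ext fun j => sub_eq_zero.1 (h (i, j))
    · intro h p
      exact sub_eq_zero.2 (congrArg (fun Y : Module.End ℂ (H1 V) => Y (h1Basis b p.1) (b p.2)) h.eq)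
  have hle : A.hodgeGroup ≤ unitCentralizer (pullback T) := by
    refine sInf_le ⟨⟨Set.range F, ?_, fun g => ?_⟩, fun z => ?_⟩
    · rintro _ ⟨p, rfl⟩
      exact hF p
    · rw [Set.forall_mem_range]
      exact (hzero g).symm
    · refine LinearMap.ext fun ω => LinearMap.ext fun v => ?_
      show ω (T ((z : ℂ) • v)) = ω ((z : ℂ) • T v)
      rw [map_smul]
  intro X hX
  refine (hzero X).1 fun p => ?_
  have h0 : deriv (fun t : ℂ => F p (1 + t • X)) 0 = 0 :=
    hX _ (hF p) fun g hg => (hzero g).2 (hle hg) p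
  -- `F p` is linear and vanishes at 1, so it is its own differential.
  have h1 : (fun t : ℂ => F p (1 + t • X)) = fun t => t * F p X := by
    funext t
    simp only [F, LinearMap.add_apply, Module.End.one_apply, LinearMap.smul_apply, smul_eq_mul,
      pullback_apply]
    ring
  rw [h1] at h0
  simpa using h0

theorem exists_lattice_norm_lt (A : ComplexAbelianVariety V) :
    ∃ ε > 0, ∀ v ∈ A.lattice, ‖v‖ < ε → v = 0 := by
  have hd : IsDiscrete (A.lattice : Set V) := ⟨A.discrete⟩
  obtain ⟨ε, hε, h⟩ := Metric.exists_ball_inter_eq_singleton_of_mem_discrete hd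
    (zero_mem A.lattice)
  refine ⟨ε, hε, fun v hv hlt => ?_⟩
  have : v ∈ Metric.ball 0 ε ∩ (A.lattice : Set V) := ⟨by simpa using hlt, hv⟩
  rw [h] at this
  exact this

/-- A nonzero value could be rescaled to a lattice vector of norm ε / 2, contradicting discreteness.
-/
theorem eq_zero_of_forall_mem_lattice {T : V →ₗ[ℂ] V} (hT : ∀ v, T v ∈ A.lattice) : T = 0 := by
  obtain ⟨ε, hε, h⟩ := A.exists_lattice_norm_lt
  refine LinearMap.ext fun v => ?_
  by_contra hne
  have hpos : 0 < ‖T v‖ := norm_pos_iff.2 hne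
  have h1 := h _ (hT (((ε / (2 * ‖T v‖) : ℝ) : ℂ) • v)) (by
    rw [map_smul, norm_smul, Complex.norm_real, Real.norm_of_nonneg (by positivity)]
    have : ε / (2 * ‖T v‖) * ‖T v‖ = ε / 2 := by field_simp
    rw [this]; linarith)
  rw [map_smul, smul_eq_zero] at h1
  rcases h1 with h1 | h1
  · have : ε / (2 * ‖T v‖) ≠ 0 := by positivity
    exact this (by exact_mod_cast h1)
  · exact hne h1

/-- A holomorphic endomorphism of `A = V / Λ` lifts to a linear endomorphism of `V`. -/
theorem exists_linear_lift {φ : AddMonoid.End (V ⧸ A.lattice)} (hφ : φ ∈ A.endRing) :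
    ∃ T : V →ₗ[ℂ] V, ∀ v, A.lattice.mkQ (T v) = φ (A.lattice.mkQ v) := by
  obtain ⟨ε, hε, hsmall⟩ := A.exists_lattice_norm_lt
  obtain ⟨f, hf⟩ := hφ 0
  have hf0 := hf.self_of_nhds
  have hker : f 0 ∈ A.lattice := by
    rw [← Submodule.ker_mkQ A.lattice, LinearMap.mem_ker, hf0.2, map_zero, map_zero]
  have hderiv := hf0.1.hasFDerivAt
  set T := fderiv ℂ f 0
  -- The bound ε / 3 serves the estimate ‖g w‖ + 2 ‖g (w / 2)‖ < ε in `hhalf`.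
  have hcont : ∀ᶠ w in 𝓝 (0 : V), ‖f w - f 0‖ < ε / 3 := by
    have := hf0.1.continuousAt.eventually (Metric.ball_mem_nhds (f 0) (ε := ε / 3) (by positivity))
    filter_upwards [this] with w hw
    simpa [dist_eq_norm] using hw
  obtain ⟨r, hr, hball⟩ := Metric.eventually_nhds_iff.1 (hf.and hcont)
  let g : V → V := fun w => f w - f 0
  have hg : ∀ w, ‖w‖ < r → A.lattice.mkQ (g w) = φ (A.lattice.mkQ w) ∧ ‖g w‖ < ε / 3 := by
    intro w hw
    have h := hball (y := w) (by simpa using hw)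
    refine ⟨?_, h.2⟩
    have h0 : A.lattice.mkQ (f 0) = 0 := by
      rw [← LinearMap.mem_ker, Submodule.ker_mkQ]; exact hker
    rw [map_sub, h.1.2, h0, sub_zero]
  -- The difference of the two sides is a lattice vector, as φ is additive, and it is too short to
  -- be nonzero.
  have hhalf : ∀ w, ‖w‖ < r → g w = (2 : ℂ) • g ((2 : ℂ)⁻¹ • w) := by
    intro w hw
    have hw' : ‖(2 : ℂ)⁻¹ • w‖ < r := by
      rw [norm_smul]
      have : ‖(2 : ℂ)⁻¹‖ = 1 / 2 := by norm_num
      rw [this]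
      linarith [norm_nonneg w]
    obtain ⟨h1, h2⟩ := hg w hw
    obtain ⟨h3, h4⟩ := hg _ hw'
    rw [← sub_eq_zero]
    refine hsmall _ ?_ ?_
    · rw [← Submodule.ker_mkQ A.lattice, LinearMap.mem_ker, map_sub, h1, two_smul, map_add, h3,
        ← map_add, ← map_add, ← two_smul ℂ, smul_smul]
      norm_num
    · have h5 : ‖(2 : ℂ) • g ((2 : ℂ)⁻¹ • w)‖ = 2 * ‖g ((2 : ℂ)⁻¹ • w)‖ := by
        rw [norm_smul]; norm_num
      calc ‖g w - (2 : ℂ) • g ((2 : ℂ)⁻¹ • w)‖ ≤ ‖g w‖ + ‖(2 : ℂ) • g ((2 : ℂ)⁻¹ • w)‖ :=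
            norm_sub_le _ _
        _ < ε := by rw [h5]; linarith
  have hiter : ∀ (N : ℕ) (w : V), ‖w‖ < r → g w = ((2 : ℂ) ^ N) • g (((2 : ℂ) ^ N)⁻¹ • w) := by
    intro N
    induction N with
    | zero => intro w _; simp
    | succ N ih =>
      intro w hw
      have hw' : ‖((2 : ℂ) ^ N)⁻¹ • w‖ < r := by
        rw [norm_smul, norm_inv, norm_pow]
        have h2 : ‖(2 : ℂ)‖ = 2 := by norm_num
        rw [h2]
        have h1 : ((2 : ℝ) ^ N)⁻¹ ≤ 1 := inv_le_one_of_one_le₀ (one_le_pow₀ (by norm_num))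
        calc ((2 : ℝ) ^ N)⁻¹ * ‖w‖ ≤ 1 * ‖w‖ := by gcongr
          _ < r := by rwa [one_mul]
      rw [ih w hw, hhalf _ hw', smul_smul, smul_smul, ← pow_succ, ← mul_inv, ← pow_succ']
  -- The difference quotients 2^N g(w / 2^N) converge to the derivative at 0, but by `hiter` they
  -- are all equal to `g w`.
  have hlin : ∀ w, ‖w‖ < r → g w = T w := by
    intro w hw
    have hlim := hderiv.lim w (c := fun N : ℕ => (2 : ℂ) ^ N) (l := Filter.atTop) (by
      simp only [norm_pow, Complex.norm_ofNat]
      exact tendsto_pow_atTop_atTop_of_one_lt (by norm_num))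
    simp only [zero_add] at hlim
    have hconst : (fun N : ℕ => (2 : ℂ) ^ N • (f (((2 : ℂ) ^ N)⁻¹ • w) - f 0)) = fun _ => g w :=
      funext fun N => (hiter N w hw).symm
    rw [hconst] at hlim
    exact tendsto_nhds_unique tendsto_const_nhds hlim
  refine ⟨T, fun v => ?_⟩
  -- Both sides are additive in `v`, so it suffices to compare them at the small vector v / N.
  obtain ⟨N, hN⟩ := exists_nat_gt (‖v‖ / r)
  have hNpos : (0 : ℝ) < N := lt_of_le_of_lt (by positivity) hN
  have hN0 : (N : ℂ) ≠ 0 := by exact_mod_cast hNpos.ne'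
  have hw : ‖(N : ℂ)⁻¹ • v‖ < r := by
    rw [norm_smul, norm_inv, Complex.norm_natCast, inv_mul_lt_iff₀ hNpos]
    rwa [div_lt_iff₀ hr] at hN
  have hv : v = N • ((N : ℂ)⁻¹ • v) := by
    rw [← Nat.cast_smul_eq_nsmul ℂ, smul_smul, mul_inv_cancel₀ hN0, one_smul]
  rw [hv, ContinuousLinearMap.coe_coe, map_nsmul, map_nsmul, map_nsmul, map_nsmul, ← hlin _ hw,
    (hg _ hw).1]

theorem map_lattice_of_lift {φ : AddMonoid.End (V ⧸ A.lattice)} {T : V →ₗ[ℂ] V}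
    (hT : ∀ v, A.lattice.mkQ (T v) = φ (A.lattice.mkQ v)) : ∀ v ∈ A.lattice, T v ∈ A.lattice := by
  intro v hv
  have h0 : A.lattice.mkQ v = 0 := by
    rwa [← LinearMap.mem_ker, Submodule.ker_mkQ]
  rw [← Submodule.ker_mkQ A.lattice, LinearMap.mem_ker, hT, h0, map_zero]

theorem lift_unique {φ : AddMonoid.End (V ⧸ A.lattice)} {T T' : V →ₗ[ℂ] V}
    (hT : ∀ v, A.lattice.mkQ (T v) = φ (A.lattice.mkQ v))
    (hT' : ∀ v, A.lattice.mkQ (T' v) = φ (A.lattice.mkQ v)) : T = T' := by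
  rw [← sub_eq_zero]
  refine eq_zero_of_forall_mem_lattice (A := A) fun v => ?_
  rw [← Submodule.ker_mkQ A.lattice, LinearMap.mem_ker, LinearMap.sub_apply, map_sub, hT, hT',
    sub_self]

/-- The linear lift of a holomorphic endomorphism. -/
noncomputable def linearLift (φ : A.endRing) : V →ₗ[ℂ] V := (exists_linear_lift φ.2).choose

theorem linearLift_spec (φ : A.endRing) (v : V) :
    A.lattice.mkQ (linearLift φ v) = (φ : AddMonoid.End (V ⧸ A.lattice)) (A.lattice.mkQ v) :=
  (exists_linear_lift φ.2).choose_spec v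

variable {n : ℕ} {b : Module.Basis (Fin n) ℝ V}

theorem pullback_mem_ratCommutant (hb : A.IsLatticeBasis b) {T : V →ₗ[ℂ] V}
    (hT : ∀ v ∈ A.lattice, T v ∈ A.lattice) : pullback T ∈ ratCommutant A b :=
  ⟨pullback_mem_commutant hT, fun p => hb.h1Basis_mem p.1 _ (hT _ (hb.mem p.2))⟩

theorem linearLift_zero : linearLift (0 : A.endRing) = 0 :=
  lift_unique (A := A) (φ := 0) (fun v => linearLift_spec 0 v) fun _ =>
    map_zero A.lattice.mkQ

theorem linearLift_add (φ ψ : A.endRing) :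
    linearLift (φ + ψ) = linearLift φ + linearLift ψ :=
  lift_unique (A := A) (φ := (φ : AddMonoid.End (V ⧸ A.lattice)) + ψ)
    (fun v => linearLift_spec (φ + ψ) v) fun v => by
      rw [LinearMap.add_apply, map_add, linearLift_spec, linearLift_spec]; rfl

/-- The action of `End(A)` on `H¹(A, ℚ)`. -/
noncomputable def endRingPullbackHom (hb : A.IsLatticeBasis b) :
    A.endRing →+ ratCommutant A b where
  toFun φ := ⟨pullback (linearLift φ),
    pullback_mem_ratCommutant hb (map_lattice_of_lift (linearLift_spec φ))⟩
  map_zero' := by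
    refine Subtype.ext (LinearMap.ext fun ω => LinearMap.ext fun v => ?_)
    simp [pullback_apply, linearLift_zero]
  map_add' φ ψ := by
    refine Subtype.ext (LinearMap.ext fun ω => LinearMap.ext fun v => ?_)
    simp [pullback_apply, linearLift_add]

/-- The action of `End(A)` on `H¹(A, ℚ)` as a `ℤ`-linear map. -/
noncomputable def endRingPullback (hb : A.IsLatticeBasis b) :
    A.endRing →ₗ[ℤ] ratCommutant A b :=
  (endRingPullbackHom hb).toIntLinearMap

theorem endRingPullback_apply (hb : A.IsLatticeBasis b) (φ : A.endRing) :
    (endRingPullback hb φ : Module.End ℂ (H1 V)) = pullback (linearLift φ) := rfl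

theorem pullback_injective (b : Module.Basis (Fin n) ℝ V) {T T' : V →ₗ[ℂ] V}
    (h : pullback T = pullback T') : T = T' := by
  refine LinearMap.ext fun v => b.ext_elem fun i => ?_
  have h1 := congrArg (fun Y : Module.End ℂ (H1 V) => Y (Complex.ofRealCLM.toLinearMap ∘ₗ b.coord i) v) h
  simpa [pullback_apply] using h1

theorem endRingPullback_injective (hb : A.IsLatticeBasis b) :
    Function.Injective (endRingPullback hb) := by
  intro φ ψ h
  have h1 : linearLift φ = linearLift ψ := pullback_injective b (congrArg Subtype.val h)
  refine Subtype.ext (AddMonoidHom.ext fun x => ?_)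
  obtain ⟨v, rfl⟩ := A.lattice.mkQ_surjective x
  have h2 := congrArg (fun T : V →ₗ[ℂ] V => A.lattice.mkQ (T v)) h1
  exact (linearLift_spec φ v).symm.trans (h2.trans (linearLift_spec ψ v))

/-- A linear endomorphism of `V` that preserves the lattice induces an endomorphism of `A`. -/
theorem exists_endRing_of_linear {T : V →ₗ[ℂ] V} (hT : ∀ v ∈ A.lattice, T v ∈ A.lattice) :
    ∃ φ : A.endRing, linearLift φ = T := by
  let ψ : AddMonoid.End (V ⧸ A.lattice) :=
    (A.lattice.mapQ A.lattice (T.restrictScalars ℤ) hT).toAddMonoidHom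
  have hψ : ∀ v, A.lattice.mkQ (T v) = ψ (A.lattice.mkQ v) := fun v => rfl
  have hmem : ψ ∈ A.endRing := fun v => ⟨T, Filter.Eventually.of_forall fun w =>
    ⟨(LinearMap.toContinuousLinearMap T).differentiableAt, hψ w⟩⟩
  exact ⟨⟨ψ, hmem⟩, lift_unique (linearLift_spec _) hψ⟩

/-- A rational element of the commutant is the pull-back along a linear endomorphism of `V`. -/
theorem exists_eq_pullback {Z : Module.End ℂ (H1 V)} (hZ : Z ∈ ratCommutant A b) :
    ∃ T : V →ₗ[ℂ] V, Z = pullback T := by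
  choose q hq using hZ.2
  let T₀ : V →ₗ[ℝ] V := b.constr ℝ fun j => ∑ i, ((q (i, j) : ℚ) : ℝ) • b i
  have hT₀ : ∀ ω v, Z ω v = ω (T₀ v) := by
    have : Z = { toFun := fun ω => ω ∘ₗ T₀, map_add' := fun _ _ => rfl,
                 map_smul' := fun _ _ => rfl } := by
      refine (h1Basis b).ext fun i => b.ext fun j => ?_
      have h1 : Z (h1Basis b i) (b j) = q (i, j) := hq (i, j)
      rw [h1]
      simp only [LinearMap.coe_mk, AddHom.coe_mk, LinearMap.comp_apply, T₀,
        Module.Basis.constr_basis, map_sum, map_smul, h1Basis_apply]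
      simp
    intro ω v
    conv_lhs => rw [this]
    rfl
  -- Commuting with the complex structure, an element of the Lie algebra, makes `T₀` complex linear.
  have hI : ∀ v, T₀ (Complex.I • v) = Complex.I • T₀ v := by
    intro v
    refine b.ext_elem fun i => ?_
    have h1 := congrArg (fun Y : Module.End ℂ (H1 V) => Y (Complex.ofRealCLM.toLinearMap ∘ₗ b.coord i) v)
      (hZ.1 _ hodgeDeriv_mem_hodgeLie)
    simp only [Module.End.mul_apply, hodgeDeriv_apply, hT₀] at h1
    simpa using h1
  let T : V →ₗ[ℂ] V :=
    { toFun := T₀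
      map_add' := map_add T₀
      map_smul' := fun c v => by
        rw [RingHom.id_apply, ← Complex.re_add_im c, add_smul, add_smul, map_add, mul_smul,
          mul_smul, Complex.coe_smul, Complex.coe_smul, Complex.coe_smul, Complex.coe_smul,
          map_smul, map_smul, hI] }
  exact ⟨T, LinearMap.ext fun ω => LinearMap.ext fun v => hT₀ ω v⟩

theorem exists_int_mul_eq {κ : Type*} [Fintype κ] (q : κ → ℚ) :
    ∃ N : ℤ, N ≠ 0 ∧ ∀ p, ∃ m : ℤ, (N : ℚ) * q p = m := by
  classical
  refine ⟨∏ p, ((q p).den : ℤ), Finset.prod_ne_zero_iff.2 fun p _ => by simp, fun p => ?_⟩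
  refine ⟨(∏ l ∈ Finset.univ.erase p, ((q l).den : ℤ)) * (q p).num, ?_⟩
  rw [← Finset.mul_prod_erase _ _ (Finset.mem_univ p)]
  push_cast
  have := Rat.den_mul_eq_num (q p)
  rw [← this]; ring

/-- In a lattice basis the linear map behind `Z` has a rational matrix. Clearing denominators makes
it preserve the lattice. -/
theorem exists_zsmul_mem_range (hb : A.IsLatticeBasis b) (Z : ratCommutant A b) :
    ∃ N : ℤ, N ≠ 0 ∧ ∃ φ : A.endRing, N • Z = endRingPullback hb φ := by
  obtain ⟨T, hT⟩ := exists_eq_pullback Z.2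
  choose q hq using Z.2.2
  obtain ⟨N, hN, hm⟩ := exists_int_mul_eq q
  choose m hm using hm
  have hcoord : ∀ i j, b.repr (T (b j)) i = q (i, j) := by
    intro i j
    have h1 : (Z : Module.End ℂ (H1 V)) (Complex.ofRealCLM.toLinearMap ∘ₗ b.coord i) (b j) = q (i, j) := by
      have : Complex.ofRealCLM.toLinearMap ∘ₗ b.coord i = h1Basis b i := by
        refine b.ext fun l => ?_
        rw [h1Basis_apply]
        by_cases h : i = l <;> simp [h]
      rw [this]; exact hq (i, j)
    rw [hT, pullback_apply] at h1
    have h2 : ((b.repr (T (b j)) i : ℝ) : ℂ) = ((q (i, j) : ℝ) : ℂ) := by simpa using h1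
    exact_mod_cast h2
  have hlat : ∀ v ∈ A.lattice, (N • T) v ∈ A.lattice := by
    intro v hv
    rw [← hb] at hv
    induction hv using Submodule.span_induction with
    | mem v hv =>
      obtain ⟨j, rfl⟩ := hv
      refine hb.mem_iff.2 fun i => ⟨m (i, j), ?_⟩
      rw [LinearMap.smul_apply, map_zsmul, Finsupp.smul_apply, hcoord, zsmul_eq_mul]
      exact_mod_cast congrArg (fun r : ℚ => (r : ℝ)) (hm (i, j))
    | zero => simp
    | add v w _ _ hv hw => rw [map_add]; exact add_mem hv hw
    | smul a v _ hv => rw [map_zsmul]; exact A.lattice.smul_mem a hv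
  obtain ⟨φ, hφ⟩ := exists_endRing_of_linear hlat
  refine ⟨N, hN, φ, Subtype.ext ?_⟩
  rw [endRingPullback_apply, hφ]
  refine LinearMap.ext fun ω => LinearMap.ext fun v => ?_
  have h1 : ((N • Z : ratCommutant A b) : Module.End ℂ (H1 V)) = N • pullback T := by
    rw [← hT]; rfl
  rw [h1, pullback_apply]
  simp [pullback_apply]

theorem finrank_endRing (A : ComplexAbelianVariety V) :
    Module.finrank ℚ (ℚ ⊗[ℤ] A.endRing) = Module.finrank ℂ A.commutant := by
  obtain ⟨n, b, hb⟩ := A.exists_isLatticeBasis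
  rw [← finrank_ratCommutant hb]
  have key : ∀ (N : ℤ) (Y : ratCommutant A b), N • Y = (N : ℚ) • Y := fun N Y =>
    (Int.cast_smul_eq_zsmul ℚ N Y).symm
  -- The rational commutant is the localization of End(A) at the nonzero integers, hence its base
  -- change to ℚ.
  have hloc : IsLocalizedModule (nonZeroDivisors ℤ) (endRingPullback hb) := by
    refine ⟨fun N => ?_, fun Z => ?_, fun {φ ψ} h => ⟨1, ?_⟩⟩
    · have hN : ((N : ℤ) : ℚ) ≠ 0 := by
        exact_mod_cast nonZeroDivisors.coe_ne_zero N
      rw [Module.End.isUnit_iff]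
      constructor
      · intro Y Z h
        have h' : (N : ℤ) • Y = (N : ℤ) • Z := h
        rw [key, key] at h'
        exact smul_right_injective _ hN h'
      · intro Z
        refine ⟨((N : ℤ) : ℚ)⁻¹ • Z, ?_⟩
        show (N : ℤ) • (((N : ℤ) : ℚ)⁻¹ • Z) = Z
        rw [key, smul_smul, mul_inv_cancel₀ hN, one_smul]
    · obtain ⟨N, hN, φ, h⟩ := exists_zsmul_mem_range hb Z
      exact ⟨(φ, ⟨N, mem_nonZeroDivisors_of_ne_zero hN⟩), h⟩
    · rw [endRingPullback_injective hb h]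
  exact (IsLocalizedModule.isBaseChange (nonZeroDivisors ℤ) ℚ (endRingPullback hb)).equiv.finrank_eq

end ComplexAbelianVariety

/-! ### The three dimensions. -/

theorem corollary6p5 {V : Type*} [NormedAddCommGroup V] [NormedSpace ℂ V]
    [FiniteDimensional ℂ V] (A : ComplexAbelianVariety V) (hA : A.IsSo7Type) :
    Module.finrank ℚ (A.hodgeClasses 1) = 1 ∧
    Module.finrank ℚ (A.hodgeClasses 2) = 6 ∧
    Module.finrank ℚ (ℚ ⊗[ℤ] A.endRing) = 4 := by
  obtain ⟨-, e, he⟩ := hA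
  have h := A.dualLie_eq e he
  refine ⟨?_, ?_, ?_⟩
  · rw [A.finrank_hodgeClasses, h]
    exact Spin7.finrank_so7Forms_two (ComplexAbelianVariety.spinBasis e)
  · rw [A.finrank_hodgeClasses, h]
    exact Spin7.finrank_so7Forms_four (ComplexAbelianVariety.spinBasis e)
  · rw [A.finrank_endRing, ComplexAbelianVariety.finrank_commutant e he]
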